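/- Work over $k=\mathbb{R}$, let $r\ge 1$, and let $U(r;\mathbb{A}^2)\subset(\mathbb{A}^2)^r$ be the open subscheme of $r$-tuples of pairs $\big((x_1,y_1),\dots,(x_r,y_r)\big)$, the complement of the closed subscheme $x_1=y_1,\dots,x_r=y_r$. The symmetric group $S_2$ acts freely on it by exchanging $x_l$ and $y_l$ simultaneously for all $l$; let $B(r;\mathbb{A}^2)=U(r;\mathbb{A}^2)/S_2$ be the quotient scheme. Augmenting an $r$-tuple by the pair $(0,0)$ gives an $S_2$-equivariant map $U(r;\mathbb{A}^2)\to U(r+1;\mathbb{A}^2)$, which descends to the stabilization map $s_r:B(r;\mathbb{A}^2)\to B(r+1;\mathbb{A}^2)$. For an $\mathbb{R}$-variety $X$, let $X(\mathbb{R})$ be the space of $\operatorname{Gal}(\mathbb{C}/\mathbb{R})$-fixed points of $X(\mathbb{C})$, where $X(\mathbb{C})$ has the analytic topology. Then the map induced by $s_r$ on singular cohomology, \[ s_r^*:\mathrm{H}^j\big(B(r+1;\mathbb{A}^2)(\mathbb{R});\mathbb{F}_2\big)\to \mathrm{H}^j\big(B(r;\mathbb{A}^2)(\mathbb{R});\mathbb{F}_2\big),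 \] is an isomorphism when $0\le j\le r-1$ and is $0$ when $j\ge r$. -/

import Mathlib

open CategoryTheory AlgebraicGeometry

noncomputable section

namespace EtaleGen

/-! ### The schemes `U(r; 𝔸ⁿ)` and `B(r; 𝔸ⁿ)` over a base ring `k`

The affine space `(𝔸ⁿ)ʳ` over `k` is the spectrum of the polynomial ring in the variables `x_{l i}`,
`l < r`, `i < n`; here `x_{l i}` is `MvPolynomial.X (l, i)`. -/

section Schemes

universe u

variable (k : Type u) [CommRing k] (r n : ℕ)

/-- The coordinate ring of `(𝔸ⁿ)ʳ`. -/
abbrev Coord : Type u := MvPolynomial (Fin r × Fin n) k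

/-- A permutation `σ` of the `n` coordinates acts by the algebra automorphism
`x_{l i} ↦ x_{l σ(i)}`. -/
def permHom : Equiv.Perm (Fin n) →* (Coord k r n ≃ₐ[k] Coord k r n) where
  toFun σ := MvPolynomial.renameEquiv k (Equiv.prodCongr (Equiv.refl (Fin r)) σ)
  map_one' := by
    apply AlgEquiv.ext
    intro p
    exact MvPolynomial.rename_id_apply p
  map_mul' σ τ := by
    apply AlgEquiv.ext
    intro p
    exact (MvPolynomial.rename_rename (R := k) (Prod.map id τ) (Prod.map id σ) p).symm

/-- The diagonal action of `Sₙ` on the coordinate ring of `(𝔸ⁿ)ʳ`. -/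
instance permAction : MulSemiringAction (Equiv.Perm (Fin n)) (Coord k r n) :=
  MulSemiringAction.compHom _ (permHom k r n)

theorem perm_smul_def (σ : Equiv.Perm (Fin n)) (p : Coord k r n) :
    σ • p = MvPolynomial.rename (Prod.map id σ) p := rfl

theorem perm_smul_X (σ : Equiv.Perm (Fin n)) (l : Fin r) (i : Fin n) :
    σ • (MvPolynomial.X (l, i) : Coord k r n) = MvPolynomial.X (l, σ i) := by
  simp [perm_smul_def]

instance : SMulCommClass (Equiv.Perm (Fin n)) k (Coord k r n) where
  smul_comm σ c p := by simp [perm_smul_def]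

/-- The ring `k[x_{l i}]^{Sₙ}` of invariant polynomials. -/
abbrev Invariants : Subalgebra k (Coord k r n) :=
  FixedPoints.subalgebra k (Coord k r n) (Equiv.Perm (Fin n))

instance : Algebra.IsInvariant (Invariants k r n) (Coord k r n) (Equiv.Perm (Fin n)) where
  isInvariant b hb := ⟨⟨b, hb⟩, rfl⟩

instance : Algebra.IsIntegral (Invariants k r n) (Coord k r n) :=
  Algebra.IsInvariant.isIntegral _ _ (Equiv.Perm (Fin n))

/-- The affine space `(𝔸ⁿ)ʳ` over `k`. -/
abbrev affineSpace : Scheme.{u} := Spec (.of (Coord k r n))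

/-- The quotient `(𝔸ⁿ)ʳ / Sₙ`, the spectrum of the ring of invariants. -/
abbrev affineQuotient : Scheme.{u} := Spec (.of (Invariants k r n))

/-- The quotient map `(𝔸ⁿ)ʳ ⟶ (𝔸ⁿ)ʳ / Sₙ`. -/
def affineProj : affineSpace k r n ⟶ affineQuotient k r n :=
  Spec.map (CommRingCat.ofHom (algebraMap (Invariants k r n) (Coord k r n)))

/-- The closed subset `Z_{ij}` of `(𝔸ⁿ)ʳ`, where `x_{l i} = x_{l j}` for all `l`. -/
def diag (i j : Fin n) : Set (affineSpace k r n) :=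
  PrimeSpectrum.zeroLocus
    (Set.range fun l : Fin r => (MvPolynomial.X (l, i) - MvPolynomial.X (l, j) : Coord k r n))

/-- The open subscheme `U(r; 𝔸ⁿ) = (𝔸ⁿ)ʳ - ⋃_{i < j} Z_{ij}` of `(𝔸ⁿ)ʳ`. -/
def UOpen : (affineSpace k r n).Opens where
  carrier := (⋃ (i : Fin n) (j : Fin n) (_ : i < j), diag k r n i j)ᶜ
  is_open' := by
    rw [isOpen_compl_iff]
    refine isClosed_iUnion_of_finite fun i => isClosed_iUnion_of_finite fun j =>
      isClosed_iUnion_of_finite fun _ => PrimeSpectrum.isClosed_zeroLocus _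

theorem mem_UOpen_iff (x : affineSpace k r n) :
    x ∈ UOpen k r n ↔ ∀ i j : Fin n, i ≠ j → ∃ l : Fin r,
      (MvPolynomial.X (l, i) - MvPolynomial.X (l, j) : Coord k r n) ∉ x.asIdeal := by
  have key : x ∈ UOpen k r n ↔ ∀ i j : Fin n, i < j → ∃ l : Fin r,
      (MvPolynomial.X (l, i) - MvPolynomial.X (l, j) : Coord k r n) ∉ x.asIdeal := by
    change x ∈ (⋃ (i : Fin n) (j : Fin n) (_ : i < j), diag k r n i j)ᶜ ↔ _
    simp only [Set.mem_compl_iff, Set.mem_iUnion, not_exists]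
    refine forall_congr' fun i => forall_congr' fun j => forall_congr' fun _ => ?_
    rw [← not_forall]
    exact not_congr Set.range_subset_iff
  rw [key]
  refine ⟨fun h i j hij => ?_, fun h i j hij => h i j hij.ne⟩
  rcases lt_or_gt_of_ne hij with hlt | hlt
  · exact h i j hlt
  · obtain ⟨l, hl⟩ := h j i hlt
    refine ⟨l, fun hmem => hl ?_⟩
    rw [← neg_sub]
    exact neg_mem hmem

/-- The fibres of the quotient map are orbits, so `U(r; 𝔸ⁿ)` is a union of fibres. -/
theorem mem_UOpen_of_proj_eq {x y : affineSpace k r n}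
    (h : affineProj k r n x = affineProj k r n y) (hx : x ∈ UOpen k r n) : y ∈ UOpen k r n := by
  have h' : x.asIdeal.under (Invariants k r n) = y.asIdeal.under (Invariants k r n) :=
    congrArg PrimeSpectrum.asIdeal h
  have hxp : x.asIdeal.IsPrime := PrimeSpectrum.isPrime x
  have hyp : y.asIdeal.IsPrime := PrimeSpectrum.isPrime y
  obtain ⟨g, hg⟩ := Algebra.IsInvariant.exists_smul_of_under_eq (Invariants k r n) (Coord k r n)
    (Equiv.Perm (Fin n)) y.asIdeal x.asIdeal h'.symm
  rw [mem_UOpen_iff] at hx ⊢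
  intro i j hij
  obtain ⟨l, hl⟩ := hx (g i) (g j) (g.injective.ne hij)
  refine ⟨l, fun hmem => hl ?_⟩
  rw [hg, ← perm_smul_X, ← perm_smul_X, ← smul_sub]
  exact Ideal.smul_mem_pointwise_smul g _ _ hmem

theorem affineProj_surjective : Function.Surjective (affineProj k r n) :=
  Algebra.IsIntegral.comap_surjective (Invariants k r n) (Coord k r n)

theorem affineProj_isClosedMap : IsClosedMap (affineProj k r n) :=
  PrimeSpectrum.isClosedMap_comap_of_isIntegral _ (algebraMap_isIntegral_iff.mpr inferInstance)

/-- The image of `U(r; 𝔸ⁿ)` in `(𝔸ⁿ)ʳ / Sₙ`, an open subscheme. -/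
def BOpen : (affineQuotient k r n).Opens where
  carrier := affineProj k r n '' (UOpen k r n : Set (affineSpace k r n))
  is_open' := by
    have h : affineProj k r n '' (UOpen k r n : Set (affineSpace k r n)) =
        (affineProj k r n '' (UOpen k r n : Set (affineSpace k r n))ᶜ)ᶜ := by
      ext y
      constructor
      · rintro ⟨u, hu, rfl⟩ ⟨z, hz, hzu⟩
        exact hz (mem_UOpen_of_proj_eq k r n hzu.symm hu)
      · intro hy
        obtain ⟨x, rfl⟩ := affineProj_surjective k r n y
        by_contra hx
        exact hy ⟨x, fun hxu => hx ⟨x, hxu, rfl⟩, rfl⟩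
    rw [h, isOpen_compl_iff]
    exact affineProj_isClosedMap k r n _ (UOpen k r n).isOpen.isClosed_compl

theorem affineProj_preimage_BOpen : affineProj k r n ⁻¹ᵁ BOpen k r n = UOpen k r n := by
  ext x
  constructor
  · rintro ⟨u, hu, hux⟩
    exact mem_UOpen_of_proj_eq k r n hux hu
  · intro hx
    exact ⟨x, hx, rfl⟩

/-- The scheme `U(r; 𝔸ⁿ)` over `k`. -/
def U : Over (Spec (.of k)) :=
  Over.mk ((UOpen k r n).ι ≫ Spec.map (CommRingCat.ofHom (algebraMap k (Coord k r n))))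

/-- The scheme `B(r; 𝔸ⁿ) = U(r; 𝔸ⁿ) / Sₙ` over `k`. Since `U(r; 𝔸ⁿ)` is an `Sₙ`-stable open
subscheme of the affine scheme `(𝔸ⁿ)ʳ`, its quotient by the finite group `Sₙ` is the image of
`U(r; 𝔸ⁿ)` in `(𝔸ⁿ)ʳ / Sₙ`: the stable affine opens `Spec R` covering `U(r; 𝔸ⁿ)` have the
spectra `Spec R^{Sₙ}` as their images, and these cover the image of `U(r; 𝔸ⁿ)`. -/
def B : Over (Spec (.of k)) :=
  Over.mk ((BOpen k r n).ι ≫ Spec.map (CommRingCat.ofHom (algebraMap k (Invariants k r n))))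

/-- The quotient map `π : U(r; 𝔸ⁿ) ⟶ B(r; 𝔸ⁿ)`. -/
def proj : U k r n ⟶ B k r n :=
  Over.homMk ((affineProj k r n).resLE (BOpen k r n) (UOpen k r n)
    (affineProj_preimage_BOpen k r n).ge) (by
      simp only [U, B, Over.mk_hom, Scheme.Hom.resLE_comp_ι_assoc]
      rw [affineProj, ← Spec.map_comp]
      rfl)

/-! ### The stabilization maps -/

/-- The map of coordinate rings of `(𝔸ⁿ)ʳ ⟶ (𝔸ⁿ)ʳ⁺¹`, `(a₁, …, a_r) ↦ (a₁, …, a_r, 0)`. -/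
def stabRing : Coord k (r + 1) n →ₐ[k] Coord k r n :=
  MvPolynomial.aeval fun q =>
    Fin.snoc (α := fun _ => Coord k r n) (fun l => MvPolynomial.X (l, q.2)) 0 q.1

theorem stabRing_smul (σ : Equiv.Perm (Fin n)) (p : Coord k (r + 1) n) :
    stabRing k r n (σ • p) = σ • stabRing k r n p := by
  have h : (stabRing k r n).comp (MvPolynomial.rename (Prod.map id σ)) =
      (MvPolynomial.rename (Prod.map id σ)).comp (stabRing k r n) := by
    refine MvPolynomial.algHom_ext fun q => ?_
    obtain ⟨l, i⟩ := q
    refine Fin.lastCases ?_ (fun l => ?_) l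
    · simp [stabRing]
    · simp [stabRing]
  exact DFunLike.congr_fun h p

/-- The map on invariants induced by the equivariant map `stabRing`. -/
def stabInvariants : Invariants k (r + 1) n →ₐ[k] Invariants k r n :=
  ((stabRing k r n).comp (Invariants k (r + 1) n).val).codRestrict (Invariants k r n)
    (fun p σ => by
      have h := stabRing_smul k r n σ p
      rw [p.2 σ] at h
      exact h.symm)

/-- The map `(𝔸ⁿ)ʳ ⟶ (𝔸ⁿ)ʳ⁺¹`, `(a₁, …, a_r) ↦ (a₁, …, a_r, 0)`. -/
def affineStab : affineSpace k r n ⟶ affineSpace k (r + 1) n :=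
  Spec.map (CommRingCat.ofHom (stabRing k r n).toRingHom)

/-- The map `(𝔸ⁿ)ʳ / Sₙ ⟶ (𝔸ⁿ)ʳ⁺¹ / Sₙ` induced by `affineStab`. -/
def affineQuotientStab : affineQuotient k r n ⟶ affineQuotient k (r + 1) n :=
  Spec.map (CommRingCat.ofHom (stabInvariants k r n).toRingHom)

theorem affineStab_proj :
    affineStab k r n ≫ affineProj k (r + 1) n = affineProj k r n ≫ affineQuotientStab k r n := by
  rw [affineStab, affineProj, affineProj, affineQuotientStab, ← Spec.map_comp, ← Spec.map_comp]
  rfl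

theorem UOpen_le_preimage : UOpen k r n ≤ affineStab k r n ⁻¹ᵁ UOpen k (r + 1) n := by
  intro x hx
  change affineStab k r n x ∈ UOpen k (r + 1) n
  rw [mem_UOpen_iff] at hx ⊢
  intro i j hij
  obtain ⟨l, hl⟩ := hx i j hij
  refine ⟨l.castSucc, fun hmem => hl ?_⟩
  have hmem' : stabRing k r n (MvPolynomial.X (l.castSucc, i) - MvPolynomial.X (l.castSucc, j)) ∈
      x.asIdeal := hmem
  simpa [stabRing] using hmem'

theorem BOpen_le_preimage : BOpen k r n ≤ affineQuotientStab k r n ⁻¹ᵁ BOpen k (r + 1) n := by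
  rintro y ⟨x, hx, rfl⟩
  refine ⟨affineStab k r n x, UOpen_le_preimage k r n hx, ?_⟩
  rw [← Scheme.Hom.comp_apply, affineStab_proj, Scheme.Hom.comp_apply]

/-- The stabilization map `U(r; 𝔸ⁿ) ⟶ U(r + 1; 𝔸ⁿ)`, augmenting by `(0, …, 0)`. -/
def stabU : U k r n ⟶ U k (r + 1) n :=
  Over.homMk ((affineStab k r n).resLE (UOpen k (r + 1) n) (UOpen k r n)
    (UOpen_le_preimage k r n)) (by
      simp only [U, Over.mk_hom, Scheme.Hom.resLE_comp_ι_assoc]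
      rw [affineStab, ← Spec.map_comp, ← CommRingCat.ofHom_comp]
      congr 3
      exact (stabRing k r n).comp_algebraMap)

/-- The stabilization map `s_r : B(r; 𝔸ⁿ) ⟶ B(r + 1; 𝔸ⁿ)`. -/
def stab : B k r n ⟶ B k (r + 1) n :=
  Over.homMk ((affineQuotientStab k r n).resLE (BOpen k (r + 1) n) (BOpen k r n)
    (BOpen_le_preimage k r n)) (by
      simp only [B, Over.mk_hom, Scheme.Hom.resLE_comp_ι_assoc]
      rw [affineQuotientStab, ← Spec.map_comp, ← CommRingCat.ofHom_comp]
      congr 3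
      exact (stabInvariants k r n).comp_algebraMap)

/-- The map `s_r` is the one to which the stabilization map `U(r; 𝔸ⁿ) ⟶ U(r + 1; 𝔸ⁿ)` descends. -/
theorem stabU_proj : stabU k r n ≫ proj k (r + 1) n = proj k r n ≫ stab k r n := by
  apply Over.OverMorphism.ext
  change (affineStab k r n).resLE _ _ _ ≫ (affineProj k (r + 1) n).resLE _ _ _ =
    (affineProj k r n).resLE _ _ _ ≫ (affineQuotientStab k r n).resLE _ _ _
  simp only [Scheme.Hom.resLE_comp_resLE, affineStab_proj]

end Schemes

/-! ### Complex and real points of a scheme over `ℝ` -/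

/-- `Spec ℂ` as a scheme over `ℝ`. -/
abbrev specComplex : Over (Spec (.of ℝ)) :=
  Over.mk (Spec.map (CommRingCat.ofHom (algebraMap ℝ ℂ)))

/-- Complex conjugation as an automorphism of `Spec ℂ` over `ℝ`. -/
def specConj : specComplex ⟶ specComplex :=
  Over.homMk (Spec.map (CommRingCat.ofHom (starRingEnd ℂ))) (by
    simp only [specComplex, Over.mk_hom]
    have h : (starRingEnd ℂ).comp (algebraMap ℝ ℂ) = algebraMap ℝ ℂ :=
      RingHom.ext fun x => Complex.conj_ofReal x
    rw [← Spec.map_comp, ← CommRingCat.ofHom_comp, h])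

/-- The set `X(ℂ)` of complex points of a scheme `X` over `ℝ`. -/
abbrev ComplexPoints (X : Over (Spec (.of ℝ))) : Type := specComplex ⟶ X

namespace ComplexPoints

variable {X Y : Over (Spec (.of ℝ))}

/-- The complex point `p` lies in the open subscheme `V`. -/
abbrev InOpen (p : ComplexPoints X) (V : X.left.Opens) : Prop :=
  ⊤ ≤ p.left ⁻¹ᵁ V

/-- The value `f(p) ∈ ℂ` of a regular function `f` on `V` at a complex point `p` of `V`. -/
def eval (p : ComplexPoints X) (V : X.left.Opens) (h : p.InOpen V) (f : Γ(X.left, V)) : ℂ :=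
  (Scheme.ΓSpecIso (.of ℂ)).hom (p.left.appLE V ⊤ h f)

/-- The analytic topology on `X(ℂ)`: the coarsest topology for which `V(ℂ)` is open for every open
subscheme `V`, and every regular function on `V` is continuous on `V(ℂ)`. -/
instance : TopologicalSpace (ComplexPoints X) :=
  TopologicalSpace.generateFrom
    {S | ∃ (V : X.left.Opens) (f : Γ(X.left, V)) (W : Set ℂ), IsOpen W ∧
      S = {p | ∃ h : p.InOpen V, p.eval V h f ∈ W}}

/-- The map `X(ℂ) → Y(ℂ)` induced by a morphism `X ⟶ Y` over `ℝ`. -/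
def map (φ : X ⟶ Y) (p : ComplexPoints X) : ComplexPoints Y :=
  p ≫ φ

/-- The action of the nontrivial element of `Gal(ℂ/ℝ)` on `X(ℂ)`. -/
def conj (p : ComplexPoints X) : ComplexPoints X :=
  specConj ≫ p

theorem continuous_map (φ : X ⟶ Y) : Continuous (map φ) := by
  refine continuous_generateFrom_iff.mpr ?_
  rintro _ ⟨V, f, W, hW, rfl⟩
  refine TopologicalSpace.isOpen_generateFrom_of_mem
    ⟨φ.left ⁻¹ᵁ V, φ.left.app V f, W, hW, ?_⟩
  ext p
  refine exists_congr fun h => ?_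
  suffices hs : (map φ p).eval V h f = p.eval (φ.left ⁻¹ᵁ V) h (φ.left.app V f) by
    rw [hs]
  simp [eval, Scheme.Hom.appLE]
  rfl

theorem conj_map (φ : X ⟶ Y) (p : ComplexPoints X) : (map φ p).conj = map φ p.conj :=
  (Category.assoc specConj p φ).symm

end ComplexPoints

/-- The space `X(ℝ)` of real points of a scheme `X` over `ℝ`: the points of `X(ℂ)` fixed by the
Galois group, with the subspace topology. -/
def RealPoints (X : Over (Spec (.of ℝ))) : TopCat.{0} :=
  TopCat.of {p : ComplexPoints X // p.conj = p}

/-- The continuous map `X(ℝ) → Y(ℝ)` induced by a morphism `X ⟶ Y` over `ℝ`. -/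
def RealPoints.map {X Y : Over (Spec (.of ℝ))} (φ : X ⟶ Y) : RealPoints X ⟶ RealPoints Y :=
  TopCat.ofHom
    { toFun := fun p => ⟨ComplexPoints.map φ p.1, by rw [ComplexPoints.conj_map, p.2]⟩
      continuous_toFun :=
        ((ComplexPoints.continuous_map φ).comp continuous_subtype_val).subtype_mk _ }

/-! ### Singular cohomology -/

/-- The singular cochain complex functor with coefficients in a commutative ring `R`: it sends a
space `T` to the complex of `R`-modules `Hom_R(C_•(T; R), R)`, where `C_•(T; R)` is the singular
chain complex. -/
def singularCochains (R : Type) [CommRing R] :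
    TopCat.{0}ᵒᵖ ⥤ HomologicalComplex (ModuleCat.{0} R) (ComplexShape.up ℕ) :=
  ((AlgebraicTopology.singularChainComplexFunctor (ModuleCat.{0} R)).obj (ModuleCat.of R R)).op ⋙
    HomologicalComplex.opFunctor (ModuleCat.{0} R) (ComplexShape.down ℕ) ⋙
      ((linearYoneda R (ModuleCat.{0} R)).obj (ModuleCat.of R R)).mapHomologicalComplex
        (ComplexShape.up ℕ)

/-- The singular cohomology functor `H^j(-; R)`. -/
def singularCohomology (R : Type) [CommRing R] (j : ℕ) : TopCat.{0}ᵒᵖ ⥤ ModuleCat.{0} R :=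
  singularCochains R ⋙ HomologicalComplex.homologyFunctor _ _ j

end EtaleGen

end

open CategoryTheory AlgebraicGeometry

noncomputable section

/-! ### Singular chains modulo two

Simplices are indexed by their number of vertices, so that degree `0` is the augmentation. -/

namespace ModTwo

open Finsupp

/-! A complex point of B(r; A²) is an unordered pair of distinct vectors x, y in ℂʳ. It is real
exactly when conjugation preserves the pair, so that x and y are either both real or conjugate to
one another. Writing a for the mean, the pair is a ± v or a ± iv, with a in ℝʳ and a nonzero v in ℝʳ
that is unique up to sign (`exists_eq_point`). Contracting a to 0 leaves two disjoint copies of the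
real projective space of dimension r - 1, one for each type (`meanHtpy`). Stabilization appends a
zero to a and to v, so on each copy it is the linear inclusion `Lines.pad` into projective r-space.

Everything thus rests on the mod two homology of projective space. Cover projective r-space by the
complement of the last axis, which deforms to the linear subspace, and an affine chart, which is
contractible. They meet in a space that deforms to punctured r-space, a homotopy sphere of dimension
r - 1. By Mayer-Vietoris the inclusion of the subspace can fail to be bijective on homology only
because of the fundamental class of that sphere. This class has the form c plus its antipode
(`Punct.exists_fundamental_cycle`), and c and its antipode have the same image in projective (r -
1)-space, so modulo two the class dies there (`Lines.map_block_mem_bdry`). Hence the inclusion is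
bijective on homology in degrees below r. The homology of projective (r - 1)-space vanishes from
degree r on (`Lines.cyc_le_bdry`).

Over a field, cohomology is the dual of homology, naturally in the space
(`dualHomologyIso_naturality`). This turns the bijections into isomorphisms, and makes the map zero
in the degrees where the smaller space has no homology.

The required singular homology is built by hand on finitely supported chains over `ZMod 2`: homotopy
invariance, barycentric subdivision and Mayer-Vietoris. It is then identified with the categorical
singular complex by `toSing`. On the algebraic side, `exists_evalAt_eq` lifts real points of the
quotient to pairs of complex vectors, and `continuous_of_toHom` reduces continuity into the analytic
topology to continuity of the values of global functions. -/

theorem add_eq_zero_iff_eq {M : Type*} [AddCommGroup M] [Module (ZMod 2) M] {x y : M} :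
    x + y = 0 ↔ x = y := by
  rw [← ZModModule.sub_eq_add, sub_eq_zero]

theorem eq_add_iff {M : Type*} [AddCommGroup M] [Module (ZMod 2) M] {x y z : M} :
    x = y + z ↔ x + y = z := by
  rw [← ZModModule.sub_eq_add x y, sub_eq_iff_eq_add']

/-- The double sum of the codimension two faces of a simplex vanishes modulo two. -/
theorem sum_succAbove_succAbove {M : Type*} [AddCommGroup M] [Module (ZMod 2) M] {n : ℕ}
    (F : (Fin n → Fin (n + 2)) → M) :
    ∑ j : Fin (n + 2), ∑ i : Fin (n + 1), F (fun k => j.succAbove (i.succAbove k)) = 0 := by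
  rw [← Finset.sum_product']
  -- Each codimension two face arises twice: the same two vertices are dropped in either order, and
  -- the involution exchanges the orders.
  refine Finset.sum_involution (fun a _ => (a.1.succAbove a.2, a.2.predAbove a.1)) ?_ ?_ ?_ ?_
  · rintro ⟨j, i⟩ _
    simp only [Fin.succAbove_succAbove_succAbove_predAbove]
    exact ZModModule.add_self _
  · rintro ⟨j, i⟩ _ _ h
    exact Fin.succAbove_ne j i (congrArg Prod.fst h)
  · simp
  · rintro ⟨j, i⟩ _
    simp only [Fin.succAbove_succAbove_predAbove, Fin.predAbove_predAbove_succAbove]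

/-! ### Affine chains -/

/-- Chains of ordered tuples of points of `V`. -/
abbrev AffChain (V : Type*) (n : ℕ) : Type _ := (Fin n → V) →₀ ZMod 2

section Aff

variable {V W V' W' : Type*}

/-- The boundary of a chain of tuples. -/
def affBd {n : ℕ} : AffChain V (n + 1) →ₗ[ZMod 2] AffChain V n :=
  linearCombination (ZMod 2) fun v => ∑ i : Fin (n + 1), single (fun k => v (i.succAbove k)) 1

theorem affBd_single {n : ℕ} (v : Fin (n + 1) → V) :
    affBd (single v 1) = ∑ i : Fin (n + 1), single (fun k => v (i.succAbove k)) 1 := by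
  simp [affBd]

theorem affBd_affBd {n : ℕ} (c : AffChain V (n + 2)) : affBd (affBd c) = 0 := by
  suffices h : (affBd (V := V) (n := n)).comp affBd = 0 from LinearMap.congr_fun h c
  refine lhom_ext' fun v => LinearMap.ext_ring ?_
  simp only [LinearMap.comp_apply, lsingle_apply, affBd_single, map_sum, LinearMap.zero_apply]
  exact sum_succAbove_succAbove fun f => single (fun k => v (f k)) (1 : ZMod 2)

/-- The map on chains of tuples induced by a map of points. -/
def affMap (f : V → W) (n : ℕ) : AffChain V n →ₗ[ZMod 2] AffChain W n :=
  lmapDomain (ZMod 2) (ZMod 2) fun v => f ∘ v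

@[simp] theorem affMap_single (f : V → W) {n : ℕ} (v : Fin n → V) (a : ZMod 2) :
    affMap f n (single v a) = single (f ∘ v) a := by simp [affMap]

theorem affBd_affMap (f : V → W) {n : ℕ} (c : AffChain V (n + 1)) :
    affBd (affMap f (n + 1) c) = affMap f n (affBd c) := by
  suffices h : affBd.comp (affMap f (n + 1)) = (affMap f n).comp affBd from LinearMap.congr_fun h c
  refine lhom_ext' fun v => LinearMap.ext_ring ?_
  simp [affBd_single, Function.comp_def]

/-- The cone with apex `b` on a chain of tuples. -/
def cone (b : V) {n : ℕ} : AffChain V n →ₗ[ZMod 2] AffChain V (n + 1) :=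
  lmapDomain (ZMod 2) (ZMod 2) fun v => Fin.cons b v

@[simp] theorem cone_single (b : V) {n : ℕ} (v : Fin n → V) (a : ZMod 2) :
    cone b (single v a) = single (Fin.cons b v : Fin (n + 1) → V) a := by simp [cone]

theorem affMap_cone (f : V → W) (b : V) {n : ℕ} (c : AffChain V n) :
    affMap f (n + 1) (cone b c) = cone (f b) (affMap f n c) := by
  suffices h : (affMap f (n + 1)).comp (cone b) = (cone (f b)).comp (affMap f n) from
    LinearMap.congr_fun h c
  refine lhom_ext' fun v => LinearMap.ext_ring ?_
  simp only [LinearMap.comp_apply, lsingle_apply, cone_single, affMap_single]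
  congr 1
  funext k
  refine Fin.cases ?_ (fun k => ?_) k <;> simp

theorem affBd_cone_zero (b : V) (c : AffChain V 0) : affBd (cone b c) = c := by
  suffices h : affBd.comp (cone b) = LinearMap.id from LinearMap.congr_fun h c
  refine lhom_ext' fun v => LinearMap.ext_ring ?_
  simp only [LinearMap.comp_apply, lsingle_apply, cone_single, affBd_single, LinearMap.id_apply]
  rw [Fin.sum_univ_one]
  congr 1

/-- Dropping the apex returns the base; dropping any other vertex commutes with coning. A chain with
zero boundary is therefore the boundary of its cone. -/
theorem affBd_cone_succ (b : V) {n : ℕ} (c : AffChain V (n + 1)) :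
    affBd (cone b c) = c + cone b (affBd c) := by
  suffices h : affBd.comp (cone b) = LinearMap.id + (cone b).comp affBd from
    LinearMap.congr_fun h c
  refine lhom_ext' fun v => LinearMap.ext_ring ?_
  simp only [LinearMap.comp_apply, lsingle_apply, cone_single, affBd_single, LinearMap.id_apply,
    LinearMap.add_apply, map_sum]
  rw [Fin.sum_univ_succ]
  congr 1
  refine Finset.sum_congr rfl fun i _ => ?_
  congr 1
  funext k
  refine Fin.cases ?_ (fun k => ?_) k <;> simp

/-- The subdivision of chains of tuples obtained by coning off subdivided boundaries. -/
def affSd (b : ∀ n, (Fin (n + 1) → V) → V) : ∀ n, AffChain V n →ₗ[ZMod 2] AffChain V n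
  | 0 => LinearMap.id
  | n + 1 => linearCombination (ZMod 2) fun v => cone (b n v) (affSd b n (affBd (single v 1)))

theorem affSd_succ_single (b : ∀ n, (Fin (n + 1) → V) → V) {n : ℕ} (v : Fin (n + 1) → V) :
    affSd b (n + 1) (single v 1) = cone (b n v) (affSd b n (affBd (single v 1))) := by
  simp [affSd]

/-- By induction the subdivided boundary is again a cycle, because the boundary of a boundary
vanishes; hence it is the boundary of the cone on it. -/
theorem affBd_affSd (b : ∀ n, (Fin (n + 1) → V) → V) {n : ℕ} (c : AffChain V (n + 1)) :
    affBd (affSd b (n + 1) c) = affSd b n (affBd c) := by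
  suffices h : affBd.comp (affSd b (n + 1)) = (affSd b n).comp affBd from LinearMap.congr_fun h c
  induction n with
  | zero =>
    refine lhom_ext' fun v => LinearMap.ext_ring ?_
    simp only [LinearMap.comp_apply, lsingle_apply, affSd_succ_single, affBd_cone_zero]
  | succ n ih =>
    refine lhom_ext' fun v => LinearMap.ext_ring ?_
    simp only [LinearMap.comp_apply, lsingle_apply]
    rw [affSd_succ_single, affBd_cone_succ]
    have h := LinearMap.congr_fun (ih (affBd c)) (affBd (single v 1))
    simp only [LinearMap.comp_apply, affBd_affBd, map_zero] at h
    rw [h, map_zero, add_zero]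

/-- Subdivision uses only the choice of apexes, so it is natural for maps that respect them. This is
what lets it pass from standard simplices to singular ones. -/
theorem affMap_affSd {b : ∀ n, (Fin (n + 1) → V) → V} {b' : ∀ n, (Fin (n + 1) → W) → W} {f : V → W}
    (hf : ∀ n v, f (b n v) = b' n (f ∘ v)) {n : ℕ} (c : AffChain V n) :
    affMap f n (affSd b n c) = affSd b' n (affMap f n c) := by
  suffices h : (affMap f n).comp (affSd b n) = (affSd b' n).comp (affMap f n) from
    LinearMap.congr_fun h c
  induction n with
  | zero => rfl
  | succ n ih =>
    refine lhom_ext' fun v => LinearMap.ext_ring ?_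
    have h := LinearMap.congr_fun (ih (affBd c)) (affBd (single v 1))
    simp only [LinearMap.comp_apply] at h
    simp only [LinearMap.comp_apply, lsingle_apply, affSd_succ_single, affMap_cone, h,
      affMap_single, hf, ← affBd_affMap]

/-- The homotopy between two chain maps `F` and `G` obtained by coning off. -/
def coneHtpy (F G : ∀ n, AffChain V n →ₗ[ZMod 2] AffChain W n) (b : ∀ n, (Fin (n + 1) → V) → W) :
    ∀ n, AffChain V n →ₗ[ZMod 2] AffChain W (n + 1)
  | 0 => 0
  | n + 1 => linearCombination (ZMod 2) fun v => cone (b n v)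
      (F (n + 1) (single v 1) + G (n + 1) (single v 1) + coneHtpy F G b n (affBd (single v 1)))

section Htpy

variable (F G : ∀ n, AffChain V n →ₗ[ZMod 2] AffChain W n) (b : ∀ n, (Fin (n + 1) → V) → W)

theorem coneHtpy_succ_single {n : ℕ} (v : Fin (n + 1) → V) :
    coneHtpy F G b (n + 1) (single v 1) = cone (b n v)
      (F (n + 1) (single v 1) + G (n + 1) (single v 1) + coneHtpy F G b n (affBd (single v 1))) := by
  simp [coneHtpy]

variable {F G}

/-- The method of acyclic models: the chain to be coned off, F + G plus the homotopy on the
boundary, is a cycle by induction. The condition on `F 0` and `G 0` starts the induction, since the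
homotopy is zero on the empty tuple. -/
theorem affBd_coneHtpy (h0 : F 0 = G 0) (hF : ∀ n c, affBd (F (n + 1) c) = F n (affBd c))
    (hG : ∀ n c, affBd (G (n + 1) c) = G n (affBd c)) {n : ℕ} (c : AffChain V (n + 1)) :
    affBd (coneHtpy F G b (n + 1) c) = F (n + 1) c + G (n + 1) c + coneHtpy F G b n (affBd c) := by
  suffices h : affBd.comp (coneHtpy F G b (n + 1)) =
      F (n + 1) + G (n + 1) + (coneHtpy F G b n).comp affBd from LinearMap.congr_fun h c
  induction n with
  | zero =>
    refine lhom_ext' fun v => LinearMap.ext_ring ?_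
    simp only [LinearMap.comp_apply, lsingle_apply, LinearMap.add_apply]
    rw [coneHtpy_succ_single, affBd_cone_succ, add_eq_left]
    simp only [map_add, hF, hG, h0, coneHtpy, LinearMap.zero_apply, add_zero]
    rw [← map_add, ZModModule.add_self, map_zero]
  | succ n ih =>
    refine lhom_ext' fun v => LinearMap.ext_ring ?_
    simp only [LinearMap.comp_apply, lsingle_apply, LinearMap.add_apply]
    have h := LinearMap.congr_fun (ih (affBd c)) (affBd (single v 1))
    simp only [LinearMap.comp_apply, LinearMap.add_apply, affBd_affBd, map_zero, add_zero] at h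
    rw [coneHtpy_succ_single, affBd_cone_succ, add_eq_left, map_add, h, map_add affBd, hF, hG,
      ZModModule.add_self, map_zero]

theorem affMap_coneHtpy {F' G' : ∀ n, AffChain V' n →ₗ[ZMod 2] AffChain W' n}
    {b} {b' : ∀ n, (Fin (n + 1) → V') → W'} {f : V → V'} {g : W → W'}
    (hb : ∀ n v, g (b n v) = b' n (f ∘ v))
    (hF : ∀ n c, affMap g n (F n c) = F' n (affMap f n c))
    (hG : ∀ n c, affMap g n (G n c) = G' n (affMap f n c)) {n : ℕ} (c : AffChain V n) :
    affMap g (n + 1) (coneHtpy F G b n c) = coneHtpy F' G' b' n (affMap f n c) := by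
  suffices h : (affMap g (n + 1)).comp (coneHtpy F G b n) =
      (coneHtpy F' G' b' n).comp (affMap f n) from LinearMap.congr_fun h c
  induction n with
  | zero => simp [coneHtpy]
  | succ n ih =>
    refine lhom_ext' fun v => LinearMap.ext_ring ?_
    have h := LinearMap.congr_fun (ih (affBd c)) (affBd (single v 1))
    simp only [LinearMap.comp_apply] at h
    simp only [LinearMap.comp_apply, lsingle_apply, coneHtpy_succ_single, affMap_cone, map_add, h,
      affMap_single, hb, ← affBd_affMap, hF, hG]

end Htpy

end Aff

/-! ### Singular chains -/

/-- Singular simplices with `n` vertices. -/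
abbrev Simp (X : Type*) [TopologicalSpace X] (n : ℕ) : Type _ := C(stdSimplex ℝ (Fin n), X)

/-- Augmented singular chains modulo two. -/
abbrev Chain (X : Type*) [TopologicalSpace X] (n : ℕ) : Type _ := Simp X n →₀ ZMod 2

/-- The affine map of standard simplices induced by a map of vertices. -/
def simplexMap {m n : ℕ} (f : Fin m → Fin n) :
    C(stdSimplex ℝ (Fin m), stdSimplex ℝ (Fin n)) :=
  ⟨stdSimplex.map f, stdSimplex.continuous_map f⟩

section Sing

variable {X Y Z : Type*} [TopologicalSpace X] [TopologicalSpace Y] [TopologicalSpace Z]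

/-- The boundary of a singular chain. -/
def bd {n : ℕ} : Chain X (n + 1) →ₗ[ZMod 2] Chain X n :=
  linearCombination (ZMod 2) fun σ =>
    ∑ i : Fin (n + 1), single (σ.comp (simplexMap i.succAbove)) 1

theorem bd_single {n : ℕ} (σ : Simp X (n + 1)) :
    bd (single σ 1) = ∑ i : Fin (n + 1), single (σ.comp (simplexMap i.succAbove)) 1 := by
  simp [bd]

/-- The map on chains induced by a continuous map. -/
def map (f : C(X, Y)) (n : ℕ) : Chain X n →ₗ[ZMod 2] Chain Y n :=
  lmapDomain (ZMod 2) (ZMod 2) fun σ => f.comp σ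

@[simp] theorem map_single (f : C(X, Y)) {n : ℕ} (σ : Simp X n) (a : ZMod 2) :
    map f n (single σ a) = single (f.comp σ) a := by simp [map]

theorem bd_map (f : C(X, Y)) {n : ℕ} (c : Chain X (n + 1)) :
    bd (map f (n + 1) c) = map f n (bd c) := by
  suffices h : bd.comp (map f (n + 1)) = (map f n).comp bd from LinearMap.congr_fun h c
  refine lhom_ext' fun v => LinearMap.ext_ring ?_
  simp [bd_single, ContinuousMap.comp_assoc]

theorem map_comp (g : C(Y, Z)) (f : C(X, Y)) {n : ℕ} (c : Chain X n) :
    map (g.comp f) n c = map g n (map f n c) := by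
  suffices h : map (g.comp f) n = (map g n).comp (map f n) from LinearMap.congr_fun h c
  refine lhom_ext' fun v => LinearMap.ext_ring ?_
  simp [ContinuousMap.comp_assoc]

@[simp] theorem map_id {n : ℕ} (c : Chain X n) : map (ContinuousMap.id X) n c = c := by
  suffices h : map (ContinuousMap.id X) n = LinearMap.id from LinearMap.congr_fun h c
  refine lhom_ext' fun v => LinearMap.ext_ring ?_
  simp

theorem map_injective {f : C(X, Y)} (hf : Function.Injective f) (n : ℕ) :
    Function.Injective (map f n) :=
  mapDomain_injective fun _ _ h => ContinuousMap.ext fun t => hf (DFunLike.congr_fun h t)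

end Sing

/-! ### Affine simplices in convex sets -/

section Convex

variable {E E' : Type*} [NormedAddCommGroup E] [NormedSpace ℝ E] [NormedAddCommGroup E']
  [NormedSpace ℝ E'] {K : Set E} {K' : Set E'}

/-- The affine simplex in a convex set with given vertices. -/
def affSimp (hK : Convex ℝ K) {n : ℕ} (v : Fin n → K) : Simp K n where
  toFun t := ⟨∑ i, t i • (v i : E), hK.sum_mem (fun i _ => t.2.1 i) t.2.2 fun i _ => (v i).2⟩
  continuous_toFun := by
    refine Continuous.subtype_mk (continuous_finsetSum _ fun i _ => ?_) _
    exact ((continuous_apply i).comp continuous_subtype_val).smul continuous_const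

theorem coe_affSimp (hK : Convex ℝ K) {n : ℕ} (v : Fin n → K) (t : stdSimplex ℝ (Fin n)) :
    (affSimp hK v t : E) = ∑ i, t i • (v i : E) := rfl

theorem sum_map_smul {m n : ℕ} (f : Fin m → Fin n) (t : stdSimplex ℝ (Fin m)) (v : Fin n → E) :
    ∑ j, stdSimplex.map f t j • v j = ∑ i, t i • v (f i) := by
  simp only [stdSimplex.map_coe, FunOnFinite.linearMap_apply_apply]
  simp only [Finset.sum_smul]
  rw [← Finset.sum_fiberwise (s := Finset.univ) (g := f)]
  refine Finset.sum_congr rfl fun j _ => Finset.sum_congr (by ext; simp) fun i hi => ?_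
  rw [(Finset.mem_filter.mp hi).2]

theorem affSimp_comp_simplexMap (hK : Convex ℝ K) {m n : ℕ} (f : Fin m → Fin n) (v : Fin n → K) :
    (affSimp hK v).comp (simplexMap f) = affSimp hK (v ∘ f) := by
  refine ContinuousMap.ext fun t => Subtype.ext ?_
  exact sum_map_smul f t fun i => (v i : E)

/-- A map of convex sets that preserves convex combinations. -/
def IsAff (hK : Convex ℝ K) (hK' : Convex ℝ K') (f : K → K') : Prop :=
  ∀ (n : ℕ) (v : Fin n → K) (t : stdSimplex ℝ (Fin n)),
    f (affSimp hK v t) = affSimp hK' (f ∘ v) t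

theorem convexSimplex (m : ℕ) : Convex ℝ (stdSimplex ℝ (Fin m)) := convex_stdSimplex ℝ (Fin m)

/-- A convex combination of convex combinations has as weights the sums of products of weights. -/
theorem isAff_affSimp (hK : Convex ℝ K) {m : ℕ} (w : Fin m → K) :
    IsAff (convexSimplex m) hK (affSimp hK w) := by
  intro n v t
  refine Subtype.ext ?_
  simp only [coe_affSimp, Function.comp_apply, Finset.smul_sum, smul_smul]
  rw [Finset.sum_comm]
  refine Finset.sum_congr rfl fun i _ => ?_
  have : (affSimp (convexSimplex m) v t) i = ∑ j, t j * v j i := by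
    have h := congrFun (coe_affSimp (convexSimplex m) v t) i
    simp only [Finset.sum_apply, Pi.smul_apply, smul_eq_mul] at h
    exact h
  rw [this, Finset.sum_smul]

/-- The barycenter of a tuple of points of a convex set. -/
def bary (hK : Convex ℝ K) (n : ℕ) (v : Fin (n + 1) → K) : K :=
  affSimp hK v stdSimplex.barycenter

theorem IsAff.bary {hK : Convex ℝ K} {hK' : Convex ℝ K'} {f : K → K'} (hf : IsAff hK hK' f) (n : ℕ)
    (v : Fin (n + 1) → K) : f (bary hK n v) = ModTwo.bary hK' n (f ∘ v) := hf _ _ _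

variable {X Y : Type*} [TopologicalSpace X] [TopologicalSpace Y]

/-- The singular chain of a space `X` obtained from an affine chain in `K` along `K → X`. -/
def push (hK : Convex ℝ K) (g : C(K, X)) (n : ℕ) : AffChain K n →ₗ[ZMod 2] Chain X n :=
  lmapDomain (ZMod 2) (ZMod 2) fun v => g.comp (affSimp hK v)

@[simp] theorem push_single (hK : Convex ℝ K) (g : C(K, X)) {n : ℕ} (v : Fin n → K) (a : ZMod 2) :
    push hK g n (single v a) = single (g.comp (affSimp hK v)) a := by simp [push]

theorem bd_push (hK : Convex ℝ K) (g : C(K, X)) {n : ℕ} (c : AffChain K (n + 1)) :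
    bd (push hK g (n + 1) c) = push hK g n (affBd c) := by
  suffices h : bd.comp (push hK g (n + 1)) = (push hK g n).comp affBd from LinearMap.congr_fun h c
  refine lhom_ext' fun v => LinearMap.ext_ring ?_
  simp [bd_single, affBd_single, ContinuousMap.comp_assoc, affSimp_comp_simplexMap,
    Function.comp_def]

theorem push_affMap {hK : Convex ℝ K} {hK' : Convex ℝ K'} (f : C(K, K')) (hf : IsAff hK hK' f)
    (g : C(K', X)) {n : ℕ} (c : AffChain K n) :
    push hK' g n (affMap f n c) = push hK (g.comp f) n c := by
  suffices h : (push hK' g n).comp (affMap f n) = push hK (g.comp f) n from LinearMap.congr_fun h c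
  refine lhom_ext' fun v => LinearMap.ext_ring ?_
  simp only [LinearMap.comp_apply, lsingle_apply, affMap_single, push_single]
  congr 1
  refine ContinuousMap.ext fun t => ?_
  simp [hf n v t]

/-- The tautological simplex. -/
def iota (n : ℕ) : Fin n → stdSimplex ℝ (Fin n) := stdSimplex.vertex

theorem affSimp_iota (n : ℕ) :
    affSimp (convexSimplex n) (iota n) = ContinuousMap.id _ := by
  refine ContinuousMap.ext fun t => Subtype.ext ?_
  rw [coe_affSimp]
  funext k
  simp [iota, Finset.sum_apply, Pi.single_apply]
  rfl

/-- Every singular simplex is pushed forward from the tautological affine one, so identities for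
singular chains reduce to identities for affine chains. -/
theorem push_iota {n : ℕ} (σ : Simp X n) :
    push (convexSimplex n) σ n (single (iota n) 1) = single σ 1 := by
  simp [affSimp_iota]

theorem affMap_affSimp_iota (hK : Convex ℝ K) {n : ℕ} (v : Fin n → K) :
    affMap (affSimp hK v) n (single (iota n) 1) = single v 1 := by
  rw [affMap_single]
  congr 1
  funext i
  refine Subtype.ext ?_
  simp [coe_affSimp, iota, stdSimplex.vertex]

theorem bd_bd {n : ℕ} (c : Chain X (n + 2)) : bd (bd c) = 0 := by
  suffices h : (bd (X := X) (n := n)).comp bd = 0 from LinearMap.congr_fun h c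
  refine lhom_ext' fun σ => LinearMap.ext_ring ?_
  simp only [LinearMap.comp_apply, lsingle_apply, LinearMap.zero_apply]
  rw [← push_iota σ, bd_push, bd_push, affBd_affBd, map_zero]

end Convex

/-! ### Subdivision of singular chains -/

section Sd

variable {X Y : Type*} [TopologicalSpace X] [TopologicalSpace Y]
variable {E : Type*} [NormedAddCommGroup E] [NormedSpace ℝ E] {K : Set E}

/-- Barycentric subdivision of affine chains. -/
abbrev barySd (hK : Convex ℝ K) (n : ℕ) : AffChain K n →ₗ[ZMod 2] AffChain K n :=
  affSd (bary hK) n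

/-- The homotopy between the identity and barycentric subdivision of affine chains. -/
abbrev barySdHtpy (hK : Convex ℝ K) (n : ℕ) : AffChain K n →ₗ[ZMod 2] AffChain K (n + 1) :=
  coneHtpy (fun _ => LinearMap.id) (barySd hK) (bary hK) n

/-- Barycentric subdivision of singular chains. -/
def sd (n : ℕ) : Chain X n →ₗ[ZMod 2] Chain X n :=
  linearCombination (ZMod 2) fun σ =>
    push (convexSimplex n) σ n (barySd (convexSimplex n) n (single (iota n) 1))

/-- The homotopy between the identity and barycentric subdivision of singular chains. -/
def sdHtpy (n : ℕ) : Chain X n →ₗ[ZMod 2] Chain X (n + 1) :=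
  linearCombination (ZMod 2) fun σ =>
    push (convexSimplex n) σ (n + 1) (barySdHtpy (convexSimplex n) n (single (iota n) 1))

theorem sd_single {n : ℕ} (σ : Simp X n) : sd n (single σ 1) =
    push (convexSimplex n) σ n (barySd (convexSimplex n) n (single (iota n) 1)) := by simp [sd]

theorem sdHtpy_single {n : ℕ} (σ : Simp X n) : sdHtpy n (single σ 1) =
    push (convexSimplex n) σ (n + 1) (barySdHtpy (convexSimplex n) n (single (iota n) 1)) := by
  simp [sdHtpy]

/-- The affine simplex with vertices v carries barycenters to barycenters, so subdividing before or
after applying it gives the same chain. -/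
theorem sd_push (hK : Convex ℝ K) (g : C(K, X)) {n : ℕ} (c : AffChain K n) :
    sd n (push hK g n c) = push hK g n (barySd hK n c) := by
  suffices h : (sd n).comp (push hK g n) = (push hK g n).comp (barySd hK n) from
    LinearMap.congr_fun h c
  refine lhom_ext' fun v => LinearMap.ext_ring ?_
  simp only [LinearMap.comp_apply, lsingle_apply, push_single, sd_single]
  rw [← push_affMap (affSimp hK v) (isAff_affSimp hK v),
    affMap_affSd (fun n w => (isAff_affSimp hK v).bary n w), affMap_affSimp_iota]

theorem sdHtpy_push (hK : Convex ℝ K) (g : C(K, X)) {n : ℕ} (c : AffChain K n) :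
    sdHtpy n (push hK g n c) = push hK g (n + 1) (barySdHtpy hK n c) := by
  suffices h : (sdHtpy n).comp (push hK g n) = (push hK g (n + 1)).comp (barySdHtpy hK n) from
    LinearMap.congr_fun h c
  refine lhom_ext' fun v => LinearMap.ext_ring ?_
  simp only [LinearMap.comp_apply, lsingle_apply, push_single, sdHtpy_single]
  rw [← push_affMap (affSimp hK v) (isAff_affSimp hK v),
    affMap_coneHtpy (F' := fun _ => LinearMap.id) (G' := barySd hK) (b' := bary hK)
      (f := affSimp hK v) (fun n w => (isAff_affSimp hK v).bary n w) (fun _ _ => rfl)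
      (fun n c => affMap_affSd (fun n w => (isAff_affSimp hK v).bary n w) c), affMap_affSimp_iota]

theorem bd_sd {n : ℕ} (c : Chain X (n + 1)) : bd (sd (n + 1) c) = sd n (bd c) := by
  suffices h : bd.comp (sd (X := X) (n + 1)) = (sd n).comp bd from LinearMap.congr_fun h c
  refine lhom_ext' fun σ => LinearMap.ext_ring ?_
  simp only [LinearMap.comp_apply, lsingle_apply]
  rw [← push_iota σ, sd_push, bd_push, affBd_affSd, bd_push, sd_push]

theorem sd_zero (c : Chain X 0) : sd 0 c = c := by
  suffices h : sd (X := X) 0 = LinearMap.id from LinearMap.congr_fun h c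
  refine lhom_ext' fun σ => LinearMap.ext_ring ?_
  simp only [LinearMap.comp_apply, lsingle_apply, LinearMap.id_apply]
  rw [← push_iota σ, sd_push]
  rfl

theorem sdHtpy_zero (c : Chain X 0) : sdHtpy 0 c = 0 := by
  suffices h : sdHtpy (X := X) 0 = 0 from LinearMap.congr_fun h c
  refine lhom_ext' fun σ => LinearMap.ext_ring ?_
  simp only [LinearMap.comp_apply, lsingle_apply]
  rw [← push_iota σ, sdHtpy_push]
  exact map_zero _

theorem bd_sdHtpy {n : ℕ} (c : Chain X (n + 1)) :
    bd (sdHtpy (n + 1) c) = c + sd (n + 1) c + sdHtpy n (bd c) := by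
  suffices h : bd.comp (sdHtpy (X := X) (n + 1)) = LinearMap.id + sd (n + 1) + (sdHtpy n).comp bd
    from LinearMap.congr_fun h c
  refine lhom_ext' fun σ => LinearMap.ext_ring ?_
  simp only [LinearMap.comp_apply, lsingle_apply, LinearMap.add_apply, LinearMap.id_apply]
  have h := affBd_coneHtpy (F := fun _ => LinearMap.id) (G := barySd (convexSimplex (n + 1)))
    (bary (convexSimplex (n + 1))) rfl (fun _ _ => rfl) (fun _ c => affBd_affSd _ c)
    (single (iota (n + 1)) 1)
  rw [← push_iota σ, sdHtpy_push, bd_push, h, sd_push, bd_push, sdHtpy_push, map_add, map_add]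
  rfl

end Sd

/-! ### Cycles, boundaries and homotopy invariance -/

section Cycles

variable {X Y : Type*} [TopologicalSpace X] [TopologicalSpace Y]

/-- Augmented cycles. -/
def cyc : ∀ n, Submodule (ZMod 2) (Chain X n)
  | 0 => ⊤
  | _ + 1 => LinearMap.ker bd

/-- Boundaries. -/
def bdry (X : Type*) [TopologicalSpace X] (n : ℕ) : Submodule (ZMod 2) (Chain X n) :=
  LinearMap.range bd

theorem mem_cyc_succ {n : ℕ} {c : Chain X (n + 1)} : c ∈ cyc (n + 1) ↔ bd c = 0 := Iff.rfl

theorem bd_mem_bdry {n : ℕ} (c : Chain X (n + 1)) : bd c ∈ bdry X n := ⟨c, rfl⟩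

theorem bdry_le_cyc (n : ℕ) : bdry X n ≤ cyc n := by
  rintro _ ⟨c, rfl⟩
  cases n with
  | zero => trivial
  | succ n => exact bd_bd c

theorem map_mem_cyc (f : C(X, Y)) {n : ℕ} {c : Chain X n} (hc : c ∈ cyc n) :
    map f n c ∈ cyc n := by
  cases n with
  | zero => trivial
  | succ n => rw [mem_cyc_succ, bd_map, mem_cyc_succ.mp hc, map_zero]

theorem map_mem_bdry (f : C(X, Y)) {n : ℕ} {c : Chain X n} (hc : c ∈ bdry X n) :
    map f n c ∈ bdry Y n := by
  obtain ⟨d, rfl⟩ := hc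
  exact ⟨map f (n + 1) d, bd_map f d⟩

/-- The cylinder on a standard simplex. -/
def cyl (n : ℕ) : Set ((Fin n → ℝ) × ℝ) := stdSimplex ℝ (Fin n) ×ˢ Set.Icc 0 1

theorem convexCyl (n : ℕ) : Convex ℝ (cyl n) := (convexSimplex n).prod (convex_Icc 0 1)

/-- The inclusion of a standard simplex in its cylinder at a given height. -/
def cylIncl (n : ℕ) (s : unitInterval) : C(stdSimplex ℝ (Fin n), cyl n) :=
  ⟨fun t => ⟨(t, s), t.2, s.2⟩, by fun_prop⟩

theorem isAff_cylIncl (n : ℕ) (s : unitInterval) :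
    IsAff (convexSimplex n) (convexCyl n) (cylIncl n s) := by
  intro k v t
  refine Subtype.ext (Prod.ext ?_ ?_)
  · simp only [coe_affSimp, cylIncl, Function.comp_apply, Prod.fst_sum, ContinuousMap.coe_mk,
      Prod.smul_fst]
    exact coe_affSimp _ v t
  · simp only [coe_affSimp, cylIncl, Function.comp_apply, Prod.snd_sum, ContinuousMap.coe_mk,
      Prod.smul_snd, smul_eq_mul, ← Finset.sum_mul]
    rw [stdSimplex.sum_eq_one, one_mul]

/-- The map of cylinders induced by a map of vertices. -/
def cylMap {m n : ℕ} (f : Fin m → Fin n) : C(cyl m, cyl n) :=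
  ⟨fun p => ⟨((simplexMap f ⟨p.1.1, p.2.1⟩ : Fin n → ℝ), p.1.2),
    (simplexMap f ⟨p.1.1, p.2.1⟩).2, p.2.2⟩, by fun_prop⟩

theorem isAff_simplexMap {m n : ℕ} (f : Fin m → Fin n) :
    IsAff (convexSimplex m) (convexSimplex n) (simplexMap f) := by
  have h : simplexMap f = affSimp (convexSimplex n) (iota n ∘ f) := by
    rw [← affSimp_comp_simplexMap, affSimp_iota]
    rfl
  rw [h]
  exact isAff_affSimp _ _

theorem isAff_cylMap {m n : ℕ} (f : Fin m → Fin n) :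
    IsAff (convexCyl m) (convexCyl n) (cylMap f) := by
  intro k v t
  refine Subtype.ext (Prod.ext ?_ ?_)
  · have h := isAff_simplexMap f k (fun i => ⟨(v i).1.1, (v i).2.1⟩) t
    have h' := congrArg Subtype.val h
    simp only [coe_affSimp] at h'
    simp only [coe_affSimp, cylMap, Function.comp_apply, Prod.fst_sum, ContinuousMap.coe_mk,
      Prod.smul_fst]
    exact h'
  · simp [coe_affSimp, cylMap, Prod.snd_sum]

/-- The homotopy between the bottom and the top of the cylinder. -/
def cylHtpy (n k : ℕ) : AffChain (stdSimplex ℝ (Fin n)) k →ₗ[ZMod 2] AffChain (cyl n) (k + 1) :=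
  coneHtpy (fun k => affMap (cylIncl n 0) k) (fun k => affMap (cylIncl n 1) k)
    -- Any apex in the convex cylinder that depends naturally on the tuple would serve.
    (fun k v => cylIncl n 0 (bary (convexSimplex n) k v)) k

/-- Naturality in the simplex: this identifies the walls of a prism with the prisms on the faces. -/
theorem affMap_cylHtpy {m n : ℕ} (f : Fin m → Fin n) {k : ℕ}
    (c : AffChain (stdSimplex ℝ (Fin m)) k) :
    affMap (cylMap f) (k + 1) (cylHtpy m k c) = cylHtpy n k (affMap (simplexMap f) k c) := by
  have h : ∀ s k (c : AffChain (stdSimplex ℝ (Fin m)) k),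
      affMap (cylMap f) k (affMap (cylIncl m s) k c) =
        affMap (cylIncl n s) k (affMap (simplexMap f) k c) := by
    intro s k c
    suffices h : (affMap (cylMap f) k).comp (affMap (cylIncl m s) k) =
      (affMap (cylIncl n s) k).comp (affMap (simplexMap f) k) from LinearMap.congr_fun h c
    refine lhom_ext' fun v => LinearMap.ext_ring ?_
    simp only [LinearMap.comp_apply, lsingle_apply, affMap_single]
    rfl
  refine affMap_coneHtpy (fun k v => ?_) (h 0) (h 1) c
  rw [← (isAff_simplexMap f).bary]
  rfl

/-- The map from a cylinder induced by a singular simplex and a homotopy. -/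
def cylPush (h : C(unitInterval × X, Y)) {n : ℕ} (σ : Simp X n) : C(cyl n, Y) :=
  h.comp ⟨fun p => (⟨p.1.2, p.2.2⟩, σ ⟨p.1.1, p.2.1⟩), by fun_prop⟩

/-- The prism operator of a homotopy. -/
def prism (h : C(unitInterval × X, Y)) (n : ℕ) : Chain X n →ₗ[ZMod 2] Chain Y (n + 1) :=
  linearCombination (ZMod 2) fun σ =>
    push (convexCyl n) (cylPush h σ) (n + 1) (cylHtpy n n (single (iota n) 1))

theorem prism_single (h : C(unitInterval × X, Y)) {n : ℕ} (σ : Simp X n) :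
    prism h n (single σ 1) =
      push (convexCyl n) (cylPush h σ) (n + 1) (cylHtpy n n (single (iota n) 1)) := by
  simp [prism]

/-- The boundary of a prism consists of its bottom, its top and its walls; modulo two there are no
orientations to track. -/
theorem bd_prism {f g : C(X, Y)} (h : f.Homotopy g) {n : ℕ} (c : Chain X (n + 1)) :
    bd (prism h.toContinuousMap (n + 1) c) =
      map f (n + 1) c + map g (n + 1) c + prism h.toContinuousMap n (bd c) := by
  suffices h : bd.comp (prism h.toContinuousMap (n + 1)) =
    map f (n + 1) + map g (n + 1) + (prism h.toContinuousMap n).comp bd from LinearMap.congr_fun h c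
  refine lhom_ext' fun σ => LinearMap.ext_ring ?_
  simp only [LinearMap.comp_apply, lsingle_apply, LinearMap.add_apply]
  rw [prism_single, bd_push, cylHtpy, affBd_coneHtpy, map_add, map_add,
    push_affMap _ (isAff_cylIncl _ _), push_affMap _ (isAff_cylIncl _ _)]
  · congr 1
    · have h0 : (cylPush h.toContinuousMap σ).comp (cylIncl (n + 1) 0) = f.comp σ :=
        ContinuousMap.ext fun t => h.apply_zero _
      have h1 : (cylPush h.toContinuousMap σ).comp (cylIncl (n + 1) 1) = g.comp σ :=
        ContinuousMap.ext fun t => h.apply_one _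
      rw [h0, h1, push_iota, push_iota, map_single, map_single]
    · change push _ _ _ (cylHtpy (n + 1) n _) = _
      simp only [affBd_single, bd_single, map_sum]
      refine Finset.sum_congr rfl fun i _ => ?_
      have hi : (fun k => iota (n + 1) (i.succAbove k)) = simplexMap i.succAbove ∘ iota n := by
        funext k
        exact (stdSimplex.map_vertex _ _).symm
      rw [hi, ← affMap_single, ← affMap_cylHtpy, push_affMap _ (isAff_cylMap _), prism_single]
      rfl
  -- Bottom and top agree on the empty tuple, as the cone construction requires in its lowest
  -- degree.
  · refine lhom_ext' fun v => LinearMap.ext_ring ?_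
    simp only [LinearMap.comp_apply, lsingle_apply, affMap_single]
    congr 1
    exact Subsingleton.elim _ _
  · exact fun _ _ => affBd_affMap _ _
  · exact fun _ _ => affBd_affMap _ _

/-- Homotopic maps agree on cycles up to boundaries. -/
theorem map_add_map_mem_bdry {f g : C(X, Y)} (h : f.Homotopy g) {n : ℕ} {c : Chain X n}
    (hc : c ∈ cyc n) : map f n c + map g n c ∈ bdry Y n := by
  cases n with
  | zero =>
    have hfg : map f 0 = map g 0 := by
      refine lhom_ext' fun v => LinearMap.ext_ring ?_
      simp only [LinearMap.comp_apply, lsingle_apply, map_single]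
      congr 1
      refine ContinuousMap.ext fun t => ?_
      have := t.2.2
      simp at this
    rw [hfg, ZModModule.add_self]
    exact zero_mem _
  | succ n =>
    refine ⟨prism h.toContinuousMap (n + 1) c, ?_⟩
    rw [bd_prism, mem_cyc_succ.mp hc, map_zero, add_zero]

end Cycles

/-! ### Small chains -/

theorem mem_of_mem_supported {α M : Type*} [AddCommGroup M] [Module (ZMod 2) M] {S : Set α}
    {f : (α →₀ ZMod 2) →ₗ[ZMod 2] M} {P : Submodule (ZMod 2) M}
    (h : ∀ a ∈ S, f (single a 1) ∈ P) {c : α →₀ ZMod 2}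
    (hc : c ∈ supported (ZMod 2) (ZMod 2) S) : f c ∈ P := by
  suffices hle : supported (ZMod 2) (ZMod 2) S ≤ P.comap f from hle hc
  rw [supported_eq_span_single, Submodule.span_le]
  rintro _ ⟨a, ha, rfl⟩
  exact h a ha

section Mesh

variable {E : Type*} [NormedAddCommGroup E] [NormedSpace ℝ E] {K : Set E}

/-- The difference is the average of the n + 1 vectors from `v j` to the vertices, one of which is
zero. This gives the factor n / (n + 1), which increases with n. -/
theorem norm_bary_sub_le (hK : Convex ℝ K) {N n : ℕ} (hn : n ≤ N) {d : ℝ} {v : Fin (n + 1) → K}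
    (hv : ∀ i j, ‖(v i : E) - v j‖ ≤ d) (j : Fin (n + 1)) :
    ‖(bary hK n v : E) - v j‖ ≤ N / (N + 1) * d := by
  have hd : 0 ≤ d := (norm_nonneg _).trans (hv 0 0)
  have h1 : (bary hK n v : E) - v j = ∑ i, ((n : ℝ) + 1)⁻¹ • ((v i : E) - v j) := by
    rw [bary, coe_affSimp]
    simp only [smul_sub, Finset.sum_sub_distrib, Finset.sum_const, Finset.card_univ,
      Fintype.card_fin, ← Nat.cast_smul_eq_nsmul ℝ, smul_smul]
    congr 1
    · refine Finset.sum_congr rfl fun i _ => ?_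
      congr 1
      exact (stdSimplex.barycenter_apply i).trans (by simp)
    · push_cast
      rw [mul_inv_cancel₀ (by positivity), one_smul]
  rw [h1, ← Finset.add_sum_erase _ _ (Finset.mem_univ j), sub_self, smul_zero, zero_add]
  calc _ ≤ ∑ i ∈ Finset.univ.erase j, ((n : ℝ) + 1)⁻¹ * d := by
        refine norm_sum_le_of_le _ fun i _ => ?_
        rw [norm_smul, Real.norm_of_nonneg (by positivity)]
        exact mul_le_mul_of_nonneg_left (hv i j) (by positivity)
    _ = n / (n + 1) * d := by
        rw [Finset.sum_const, Finset.card_erase_of_mem (Finset.mem_univ j)]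
        simp
        ring
    _ ≤ N / (N + 1) * d := by
        refine mul_le_mul_of_nonneg_right ?_ hd
        rw [div_le_div_iff₀ (by positivity) (by positivity)]
        have : (n : ℝ) ≤ N := by exact_mod_cast hn
        linarith

/-- Subdivision of a simplex decreases its mesh, and does not leave its convex hull. -/
theorem barySd_single_mem (hK : Convex ℝ K) (N : ℕ) {d : ℝ} (n : ℕ) (hn : n ≤ N + 1)
    (v : Fin n → K) (hv : ∀ i j, ‖(v i : E) - v j‖ ≤ d) :
    barySd hK n (single v 1) ∈ supported (ZMod 2) (ZMod 2)
      {w : Fin n → K | (∀ k, (w k : E) ∈ convexHull ℝ (Set.range fun i => (v i : E))) ∧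
        ∀ i j, ‖(w i : E) - w j‖ ≤ N / (N + 1) * d} := by
  induction n with
  | zero =>
    refine single_mem_supported _ _ ?_
    exact ⟨fun k => Fin.elim0 k, fun k => Fin.elim0 k⟩
  | succ n ih =>
    have hd : 0 ≤ d := (norm_nonneg _).trans (hv 0 0)
    have hb := norm_bary_sub_le hK (N := N) (by omega) hv
    have hbK : (bary hK n v : E) ∈ convexHull ℝ (Set.range fun i => (v i : E)) :=
      (convex_convexHull ℝ _).sum_mem (fun i _ => stdSimplex.barycenter.2.1 i)
        stdSimplex.barycenter.2.2 fun i _ => subset_convexHull ℝ _ (Set.mem_range_self i)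
    have hρ : (0 : ℝ) ≤ N / (N + 1) * d := by positivity
    -- A ball about the barycenter that contains the vertices contains their hull. Carrying the hull
    -- condition through the induction thus bounds the distance from the new apex to the subdivided
    -- faces.
    have hball : convexHull ℝ (Set.range fun i => (v i : E)) ⊆
        Metric.closedBall (bary hK n v : E) (N / (N + 1) * d) := by
      refine convexHull_min ?_ (convex_closedBall _ _)
      rintro _ ⟨i, rfl⟩
      rw [Metric.mem_closedBall, dist_comm, dist_eq_norm]
      exact hb i
    rw [barySd, affSd_succ_single, affBd_single, map_sum, map_sum]
    refine Submodule.sum_mem _ fun i _ => ?_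
    refine mem_of_mem_supported (fun w hw => ?_)
      (ih (by omega) (fun k => v (i.succAbove k)) fun _ _ => hv _ _)
    have hw' : ∀ k, (w k : E) ∈ convexHull ℝ (Set.range fun i => (v i : E)) := fun k =>
      convexHull_mono (by rintro _ ⟨i, rfl⟩; exact ⟨_, rfl⟩) (hw.1 k)
    rw [cone_single]
    refine single_mem_supported _ _ ⟨fun k => ?_, fun k l => ?_⟩
    · refine Fin.cases ?_ (fun k => ?_) k
      · exact hbK
      · exact hw' k
    · refine Fin.cases ?_ (fun k => ?_) k <;> refine Fin.cases ?_ (fun l => ?_) l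
      · simpa using hρ
      · have := hball (hw' l)
        rwa [Metric.mem_closedBall, dist_comm, dist_eq_norm] at this
      · have := hball (hw' k)
        rwa [Metric.mem_closedBall, dist_eq_norm] at this
      · exact hw.2 k l

/-- With n vertices the ratio (n - 1) / n would already do; n / (n + 1) is also below 1 and avoids a
subtraction. -/
theorem barySd_pow_mem (hK : Convex ℝ K) {d : ℝ} {n : ℕ} (k : ℕ)
    (v : Fin n → K) (hv : ∀ i j, ‖(v i : E) - v j‖ ≤ d) :
    (barySd hK n ^ k) (single v 1) ∈ supported (ZMod 2) (ZMod 2)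
      {w : Fin n → K | ∀ i j, ‖(w i : E) - w j‖ ≤ ((n : ℝ) / (n + 1)) ^ k * d} := by
  induction k with
  | zero => exact single_mem_supported _ _ (by simpa using hv)
  | succ k ih =>
    rw [pow_succ' (barySd hK n), Module.End.mul_apply]
    refine mem_of_mem_supported (f := barySd hK n) (fun w hw => ?_) ih
    refine supported_mono ?_ (barySd_single_mem hK n n (by omega) w hw)
    rintro u ⟨-, hu⟩
    rw [Set.mem_ofPred_eq, pow_succ', mul_assoc]
    exact hu

end Mesh

section Small

variable {X : Type*} [TopologicalSpace X]

/-- The chains whose simplices are each contained in `A` or in `B`. -/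
def small (A B : Set X) (n : ℕ) : Submodule (ZMod 2) (Chain X n) :=
  supported (ZMod 2) (ZMod 2) {σ | Set.range σ ⊆ A ∨ Set.range σ ⊆ B}

theorem push_mem_small {E : Type*} [NormedAddCommGroup E] [NormedSpace ℝ E] {K : Set E}
    (hK : Convex ℝ K) {A B : Set X} {g : C(K, X)} (hg : Set.range g ⊆ A ∨ Set.range g ⊆ B) {n : ℕ}
    (c : AffChain K n) : push hK g n c ∈ small A B n := by
  refine mem_of_mem_supported (S := Set.univ) (fun v _ => ?_) (by simp)
  rw [push_single]
  refine single_mem_supported _ _ ?_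
  refine hg.imp ?_ ?_ <;> exact fun h => (Set.range_comp_subset_range _ g).trans h

theorem sd_mem_small {A B : Set X} {n : ℕ} {c : Chain X n} (hc : c ∈ small A B n) :
    sd n c ∈ small A B n := by
  refine mem_of_mem_supported (fun σ hσ => ?_) hc
  rw [sd_single]
  exact push_mem_small _ hσ _

theorem sdHtpy_mem_small {A B : Set X} {n : ℕ} {c : Chain X n} (hc : c ∈ small A B n) :
    sdHtpy n c ∈ small A B (n + 1) := by
  refine mem_of_mem_supported (fun σ hσ => ?_) hc
  rw [sdHtpy_single]
  exact push_mem_small _ hσ _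

theorem sd_pow_mem_small {A B : Set X} {n k l : ℕ} (hkl : k ≤ l) {c : Chain X n}
    (hc : (sd n ^ k) c ∈ small A B n) : (sd n ^ l) c ∈ small A B n := by
  induction l, hkl using Nat.le_induction with
  | base => exact hc
  | succ l _ ih =>
    rw [pow_succ']
    exact sd_mem_small ih

theorem bd_sd_pow {n : ℕ} (k : ℕ) (c : Chain X (n + 1)) :
    bd ((sd (n + 1) ^ k) c) = (sd n ^ k) (bd c) := by
  induction k with
  | zero => rfl
  | succ k ih => rw [pow_succ', pow_succ', Module.End.mul_apply, Module.End.mul_apply, bd_sd, ih]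

/-- The preimages of A and B cover the compact standard simplex. Once the mesh of an iterated
subdivision is below a Lebesgue number of this cover, each piece lies in one of the preimages. -/
theorem exists_sd_pow_single_mem {A B : Set X} (hA : IsOpen A) (hB : IsOpen B)
    (hAB : A ∪ B = Set.univ) {n : ℕ} (σ : Simp X n) :
    ∃ k, (sd n ^ k) (single σ 1) ∈ small A B n := by
  obtain ⟨δ, hδ, h⟩ := lebesgue_number_lemma_of_metric (s := Set.univ)
    (c := fun i : Bool => σ ⁻¹' (cond i A B)) isCompact_univ
    (by rintro (_ | _); exacts [hB.preimage σ.continuous, hA.preimage σ.continuous])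
    (by
      intro x _
      have hx : σ x ∈ A ∪ B := hAB ▸ Set.mem_univ _
      rcases hx with hx | hx
      exacts [Set.mem_iUnion.mpr ⟨true, hx⟩, Set.mem_iUnion.mpr ⟨false, hx⟩])
  have hlim : Filter.Tendsto (fun k : ℕ => ((n : ℝ) / (n + 1)) ^ k * 2) Filter.atTop (nhds 0) := by
    rw [← zero_mul (2 : ℝ)]
    refine (tendsto_pow_atTop_nhds_zero_of_lt_one (by positivity) ?_).mul_const 2
    rw [div_lt_one (by positivity)]
    linarith
  obtain ⟨k, hk⟩ := (hlim.eventually (gt_mem_nhds hδ)).exists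
  refine ⟨k, ?_⟩
  have hpow : ∀ c, (sd n ^ k) (push (convexSimplex n) σ n c) =
      push (convexSimplex n) σ n ((barySd (convexSimplex n) n ^ k) c) := by
    intro c
    clear hk
    induction k with
    | zero => rfl
    | succ k ih => rw [pow_succ', pow_succ', Module.End.mul_apply, ih, sd_push]; rfl
  rw [← push_iota σ, hpow]
  refine mem_of_mem_supported (fun w hw => ?_)
    (barySd_pow_mem (convexSimplex n) (d := 2) k (iota n) ?_)
  · rw [push_single]
    refine single_mem_supported _ _ ?_
    cases n with
    | zero =>
      left
      rintro _ ⟨t, rfl⟩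
      have := t.2.2
      simp at this
    | succ n =>
      obtain ⟨i, hi⟩ := h (w 0) trivial
      -- All vertices are within δ of the first one, and balls are convex.
      have hball : ∀ t, affSimp (convexSimplex (n + 1)) w t ∈ Metric.ball (w 0) δ := by
        intro t
        have hmem := (convex_ball (w 0 : Fin (n + 1) → ℝ) δ).sum_mem (t := Finset.univ)
          (w := t) (z := fun i => (w i : Fin (n + 1) → ℝ)) (fun i _ => t.2.1 i) t.2.2 (fun i _ => by
            rw [Metric.mem_ball, dist_eq_norm]
            exact (hw i 0).trans_lt hk)
        exact hmem
      cases i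
      · right
        rintro _ ⟨t, rfl⟩
        exact hi (hball t)
      · left
        rintro _ ⟨t, rfl⟩
        exact hi (hball t)
  -- The initial mesh is at most 2 because the vertices have norm at most 1.
  · intro i j
    refine (norm_sub_le _ _).trans ?_
    have h1 : ∀ i, ‖(iota n i).1‖ ≤ 1 := fun i =>
      mem_closedBall_zero_iff.mp (stdSimplex_subset_closedBall (iota n i).2)
    exact (add_le_add (h1 i) (h1 j)).trans (by norm_num)

theorem exists_sd_pow_mem {A B : Set X} (hA : IsOpen A) (hB : IsOpen B)
    (hAB : A ∪ B = Set.univ) {n : ℕ} (c : Chain X n) : ∃ k, (sd n ^ k) c ∈ small A B n := by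
  induction c using Finsupp.induction_linear with
  | zero => exact ⟨0, by simp⟩
  | add c d hc hd =>
    obtain ⟨k, hk⟩ := hc
    obtain ⟨l, hl⟩ := hd
    refine ⟨max k l, ?_⟩
    rw [map_add]
    exact add_mem (sd_pow_mem_small (le_max_left _ _) hk) (sd_pow_mem_small (le_max_right _ _) hl)
  | single σ a =>
    obtain ⟨k, hk⟩ := exists_sd_pow_single_mem hA hB hAB σ
    refine ⟨k, ?_⟩
    rw [← mul_one a, ← smul_eq_mul, ← smul_single, map_smul]
    exact Submodule.smul_mem _ _ hk

theorem sd_mem_cyc {n : ℕ} {c : Chain X n} (hc : c ∈ cyc n) : sd n c ∈ cyc n := by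
  cases n with
  | zero => trivial
  | succ n => rw [mem_cyc_succ, bd_sd, mem_cyc_succ.mp hc, map_zero]

theorem bd_sdHtpy_of_mem_cyc {n : ℕ} {c : Chain X n} (hc : c ∈ cyc n) :
    bd (sdHtpy n c) = c + sd n c := by
  cases n with
  | zero => rw [sdHtpy_zero, sd_zero, map_zero, ZModModule.add_self]
  | succ n => rw [bd_sdHtpy, mem_cyc_succ.mp hc, map_zero, add_zero]

/-- The homotopies for the successive subdivisions telescope. Each of them keeps small chains small,
which is needed for boundaries as well as for cycles. -/
theorem exists_bd_eq_add_sd_pow {n : ℕ} {c : Chain X n} (hc : c ∈ cyc n) (k : ℕ) :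
    ∃ t, bd t = c + (sd n ^ k) c ∧ ∀ A B, c ∈ small A B n → t ∈ small A B (n + 1) := by
  induction k with
  | zero => exact ⟨0, by simp [ZModModule.add_self], fun _ _ _ => zero_mem _⟩
  | succ k ih =>
    obtain ⟨t, ht, hs⟩ := ih
    have hck : (sd n ^ k) c ∈ cyc n := by
      clear ht
      induction k with
      | zero => exact hc
      | succ k ih =>
        rw [pow_succ']
        exact sd_mem_cyc (ih)
    refine ⟨t + sdHtpy n ((sd n ^ k) c), ?_, fun A B h => add_mem (hs A B h) (sdHtpy_mem_small ?_)⟩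
    · rw [map_add, ht, bd_sdHtpy_of_mem_cyc hck, pow_succ', Module.End.mul_apply]
      rw [add_assoc, ← add_assoc _ _ (sd n _), ZModModule.add_self, zero_add]
    · exact sd_pow_mem_small (Nat.zero_le k) h

/-- Every cycle is homologous to a small one. -/
theorem exists_small_cycle {A B : Set X} (hA : IsOpen A) (hB : IsOpen B) (hAB : A ∪ B = Set.univ)
    {n : ℕ} {c : Chain X n} (hc : c ∈ cyc n) : ∃ d ∈ small A B n, c + d ∈ bdry X n := by
  obtain ⟨k, hk⟩ := exists_sd_pow_mem hA hB hAB c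
  obtain ⟨t, ht, -⟩ := exists_bd_eq_add_sd_pow hc k
  exact ⟨_, hk, t, ht⟩

/-- A small boundary is the boundary of a small chain. -/
theorem exists_small_bd_eq {A B : Set X} (hA : IsOpen A) (hB : IsOpen B) (hAB : A ∪ B = Set.univ)
    {n : ℕ} {c : Chain X n} (hc : c ∈ bdry X n) (hs : c ∈ small A B n) :
    ∃ d ∈ small A B (n + 1), bd d = c := by
  obtain ⟨w, rfl⟩ := hc
  obtain ⟨k, hk⟩ := exists_sd_pow_mem hA hB hAB w
  obtain ⟨t, ht, hts⟩ := exists_bd_eq_add_sd_pow (bdry_le_cyc n (bd_mem_bdry w)) k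
  -- If c is the boundary of w, the subdivision of w bounds the subdivision of c, and the small
  -- chain t joins the latter to c.
  refine ⟨(sd (n + 1) ^ k) w + t, add_mem hk (hts A B hs), ?_⟩
  rw [map_add, ht, bd_sd_pow, add_comm, add_assoc, ZModModule.add_self, add_zero]

/-! ### The Mayer-Vietoris sequence -/

/-- The inclusion of a subspace. -/
def incl (A : Set X) : C(A, X) := ⟨Subtype.val, continuous_subtype_val⟩

/-- The inclusion of an intersection into the left factor. -/
def interLeft (A B : Set X) : C(↥(A ∩ B), A) := ContinuousMap.inclusion Set.inter_subset_left

/-- The inclusion of an intersection into the right factor. -/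
def interRight (A B : Set X) : C(↥(A ∩ B), B) := ContinuousMap.inclusion Set.inter_subset_right

theorem incl_injective (A : Set X) : Function.Injective (incl A) := Subtype.val_injective

theorem map_incl_mem_supported (A : Set X) {n : ℕ} (c : Chain A n) :
    map (incl A) n c ∈ supported (ZMod 2) (ZMod 2) {σ : Simp X n | Set.range σ ⊆ A} := by
  refine mem_of_mem_supported (S := Set.univ) (fun σ _ => ?_) (by simp)
  rw [map_single]
  refine single_mem_supported _ _ ?_
  rintro _ ⟨t, rfl⟩
  exact (σ t).2

theorem exists_map_incl_eq {A : Set X} {n : ℕ} {c : Chain X n}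
    (hc : c ∈ supported (ZMod 2) (ZMod 2) {σ : Simp X n | Set.range σ ⊆ A}) :
    ∃ d, map (incl A) n d = c := by
  change LinearMap.id (R := ZMod 2) c ∈ LinearMap.range (map (incl A) n)
  refine mem_of_mem_supported (fun σ hσ => ?_) hc
  refine ⟨single ⟨fun t => ⟨σ t, hσ ⟨t, rfl⟩⟩, by fun_prop⟩ 1, ?_⟩
  rw [map_single]
  rfl

theorem exists_add_of_mem_small {A B : Set X} {n : ℕ} {c : Chain X n} (hc : c ∈ small A B n) :
    ∃ a b, c = map (incl A) n a + map (incl B) n b := by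
  rw [small, Set.ofPred_or, supported_union, Submodule.mem_sup] at hc
  obtain ⟨a, ha, b, hb, rfl⟩ := hc
  obtain ⟨a, rfl⟩ := exists_map_incl_eq ha
  obtain ⟨b, rfl⟩ := exists_map_incl_eq hb
  exact ⟨a, b, rfl⟩

theorem map_incl_mem_small (A B : Set X) {n : ℕ} (a : Chain A n) :
    map (incl A) n a ∈ small A B n :=
  supported_mono (fun _ h => Or.inl h) (map_incl_mem_supported A a)

/-- The simplices of the common image lie in A and in B, hence in the intersection; injectivity of
the inclusions recovers a and b. -/
theorem exists_inter {A B : Set X} {n : ℕ} {a : Chain A n} {b : Chain B n}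
    (h : map (incl A) n a = map (incl B) n b) :
    ∃ g, map (interLeft A B) n g = a ∧ map (interRight A B) n g = b := by
  have hm : map (incl A) n a ∈
      supported (ZMod 2) (ZMod 2) {σ : Simp X n | Set.range σ ⊆ A ∩ B} := by
    simp only [Set.subset_inter_iff, Set.ofPred_and, supported_inter]
    exact ⟨map_incl_mem_supported A a, h ▸ map_incl_mem_supported B b⟩
  obtain ⟨g, hg⟩ := exists_map_incl_eq hm
  refine ⟨g, map_injective (incl_injective A) n ?_, map_injective (incl_injective B) n ?_⟩
  · rw [← map_comp, ← hg]
    rfl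
  · rw [← map_comp, ← h, ← hg]
    rfl

theorem mem_cyc_of_map_mem_cyc {Y : Type*} [TopologicalSpace Y] {f : C(X, Y)}
    (hf : Function.Injective f) {n : ℕ} {c : Chain X n} (hc : map f n c ∈ cyc n) : c ∈ cyc n := by
  cases n with
  | zero => trivial
  | succ n =>
    refine map_injective hf n ?_
    rw [← bd_map, mem_cyc_succ.mp hc, map_zero]

/-- Decomposition of cycles: exactness of the Mayer-Vietoris sequence. -/
theorem exists_decomposition {A B : Set X} (hA : IsOpen A) (hB : IsOpen B)
    (hAB : A ∪ B = Set.univ) {n : ℕ} {c : Chain X (n + 1)} (hc : c ∈ cyc (n + 1)) :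
    ∃ (a : Chain A (n + 1)) (b : Chain B (n + 1)) (g : Chain ↥(A ∩ B) n), g ∈ cyc n ∧
      bd a = map (interLeft A B) n g ∧ bd b = map (interRight A B) n g ∧
      c + (map (incl A) (n + 1) a + map (incl B) (n + 1) b) ∈ bdry X (n + 1) := by
  obtain ⟨d, hd, hcd⟩ := exists_small_cycle hA hB hAB hc
  obtain ⟨a, b, rfl⟩ := exists_add_of_mem_small hd
  -- The sum of the two parts is a cycle, so modulo two their boundaries coincide in X and come from
  -- the intersection.
  have h0 := bdry_le_cyc _ hcd
  rw [mem_cyc_succ, map_add, mem_cyc_succ.mp hc, zero_add, map_add, add_eq_zero_iff_eq, bd_map,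
    bd_map] at h0
  obtain ⟨g, hga, hgb⟩ := exists_inter h0
  refine ⟨a, b, g, ?_, hga.symm, hgb.symm, hcd⟩
  refine mem_cyc_of_map_mem_cyc (f := interLeft A B) (Set.inclusion_injective Set.inter_subset_left) ?_
  rw [hga]
  exact bdry_le_cyc _ (bd_mem_bdry a)

/-- A cycle of `A` bounding in `A ∪ B` comes from a cycle of `A ∩ B` bounding in `B`. -/
theorem exists_inter_of_mem_bdry {A B : Set X} (hA : IsOpen A) (hB : IsOpen B)
    (hAB : A ∪ B = Set.univ) {n : ℕ} {c : Chain A n} (hc : c ∈ cyc n)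
    (hbd : map (incl A) n c ∈ bdry X n) :
    ∃ g : Chain ↥(A ∩ B) n, g ∈ cyc n ∧ c + map (interLeft A B) n g ∈ bdry A n ∧
      map (interRight A B) n g ∈ bdry B n := by
  obtain ⟨w, hw, hwc⟩ := exists_small_bd_eq hA hB hAB hbd (map_incl_mem_small A B c)
  obtain ⟨a, b, rfl⟩ := exists_add_of_mem_small hw
  -- Rearranged, c plus the boundary of a equals the boundary of b: the left side lives in A and the
  -- right side in B.
  rw [map_add, bd_map, bd_map, eq_comm, eq_add_iff, ← map_add] at hwc
  obtain ⟨g, hga, hgb⟩ := exists_inter hwc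
  refine ⟨g, ?_, ⟨a, ?_⟩, b, hgb.symm⟩
  · refine mem_cyc_of_map_mem_cyc (f := interLeft A B) (Set.inclusion_injective Set.inter_subset_left) ?_
    rw [hga]
    exact add_mem hc (bdry_le_cyc _ (bd_mem_bdry a))
  · rw [hga, ← add_assoc, ZModModule.add_self, zero_add]

end Small

/-! ### Acyclicity by deformation, and gluing of cycles -/

section Gluing

variable {X Y : Type*} [TopologicalSpace X] [TopologicalSpace Y]

/-- Vanishing of a homology class in the larger of two spaces with a one-sided homotopy inverse. -/
theorem mem_bdry_of_map_mem_bdry {f : C(X, Y)} {g : C(Y, X)}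
    (h : (ContinuousMap.id X).Homotopy (g.comp f)) {n : ℕ} {c : Chain X n} (hc : c ∈ cyc n)
    (hf : map f n c ∈ bdry Y n) : c ∈ bdry X n := by
  have h1 := map_add_map_mem_bdry h hc
  rw [map_id, map_comp] at h1
  exact (Submodule.add_mem_iff_left _ (map_mem_bdry g hf)).mp h1

/-- The chains all of whose simplices are replaced by a constant one with an additional vertex. -/
def constCone (x : X) (n : ℕ) : Chain X n →ₗ[ZMod 2] Chain X (n + 1) :=
  lmapDomain (ZMod 2) (ZMod 2) fun _ => ContinuousMap.const _ x

theorem constCone_single (x : X) {n : ℕ} (σ : Simp X n) :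
    constCone x n (single σ 1) = single (ContinuousMap.const _ x) 1 := by simp [constCone]

theorem bd_single_const (x : X) (n : ℕ) :
    bd (single (ContinuousMap.const _ x : Simp X (n + 1)) 1) =
      ((n + 1 : ℕ) : ZMod 2) • single (ContinuousMap.const _ x) 1 := by
  rw [bd_single]
  simp only [ContinuousMap.const_comp, Finset.sum_const, Finset.card_univ, Fintype.card_fin,
    Nat.cast_smul_eq_nsmul]

/-- A constant simplex with m vertices has m equal faces, and successive face counts differ by one.
On cycles the constant map is therefore null homologous. -/
theorem bd_constCone (x : X) {n : ℕ} (c : Chain X (n + 1)) :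
    bd (constCone x (n + 1) c) =
      map (ContinuousMap.const X x) (n + 1) c + constCone x n (bd c) := by
  suffices h : bd.comp (constCone x (n + 1)) =
    map (ContinuousMap.const X x) (n + 1) + (constCone x n).comp bd from LinearMap.congr_fun h c
  refine lhom_ext' fun σ => LinearMap.ext_ring ?_
  simp only [LinearMap.comp_apply, lsingle_apply, LinearMap.add_apply, constCone_single,
    bd_single_const, map_single, ContinuousMap.const_comp]
  rw [bd_single, map_sum]
  simp only [constCone_single, Finset.sum_const, Finset.card_univ, Fintype.card_fin]
  rw [← Nat.cast_smul_eq_nsmul (ZMod 2), Nat.cast_succ (n + 1), add_smul, one_smul]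
  exact add_comm _ _

/-- The empty simplex is the boundary of any point: reduced homology of a nonempty space vanishes in
degree -1. -/
theorem cyc_zero_le_bdry [Nonempty X] : cyc 0 ≤ bdry X 0 := by
  intro c _
  obtain ⟨x⟩ := ‹Nonempty X›
  refine ⟨constCone x 0 c, ?_⟩
  suffices h : (bd (X := X)).comp (constCone x 0) = LinearMap.id from LinearMap.congr_fun h c
  refine lhom_ext' fun σ => LinearMap.ext_ring ?_
  simp only [LinearMap.comp_apply, lsingle_apply, constCone_single, bd_single_const]
  simp only [zero_add, Nat.cast_one, one_smul, LinearMap.id_apply]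
  congr 1
  refine ContinuousMap.ext fun t => ?_
  have := t.2.2
  simp at this

/-- A contractible space is acyclic. -/
theorem cyc_le_bdry_of_homotopy {x : X}
    (h : (ContinuousMap.id X).Homotopy (ContinuousMap.const X x)) (n : ℕ) :
    cyc n ≤ bdry X n := by
  have : Nonempty X := ⟨x⟩
  cases n with
  | zero => exact cyc_zero_le_bdry
  | succ n =>
    intro c hc
    have h1 := map_add_map_mem_bdry h hc
    rw [map_id] at h1
    have h2 : bd (constCone x (n + 1) c) = map (ContinuousMap.const X x) (n + 1) c := by
      rw [bd_constCone, mem_cyc_succ.mp hc, map_zero, add_zero]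
    exact (Submodule.add_mem_iff_left _ (h2 ▸ bd_mem_bdry _)).mp h1

/-- The connecting cycle of a cycle, and the freedom in choosing the parts of a decomposition. -/
theorem exists_glue {A B : Set X} (hA : IsOpen A) (hB : IsOpen B)
    (hAB : A ∪ B = Set.univ) {n : ℕ} {c : Chain X (n + 1)} (hc : c ∈ cyc (n + 1)) :
    ∃ g : Chain ↥(A ∩ B) n, g ∈ cyc n ∧ ∀ (g₀ : Chain ↥(A ∩ B) n) (a₀ : Chain A (n + 1))
      (b₀ : Chain B (n + 1)), g + g₀ ∈ bdry _ n → bd a₀ = map (interLeft A B) n g₀ →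
      bd b₀ = map (interRight A B) n g₀ → ∃ (a₁ : Chain A (n + 1)) (b₁ : Chain B (n + 1)),
        a₁ ∈ cyc (n + 1) ∧ b₁ ∈ cyc (n + 1) ∧
        c + (map (incl A) (n + 1) a₀ + map (incl B) (n + 1) b₀) +
          (map (incl A) (n + 1) a₁ + map (incl B) (n + 1) b₁) ∈ bdry X (n + 1) := by
  obtain ⟨a, b, g, hg, ha, hb, hab⟩ := exists_decomposition hA hB hAB hc
  -- The parts a and a₀ have boundaries g and g₀, whose sum bounds h. Adding h to both corrected
  -- parts closes them up, and its two copies cancel in X.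
  refine ⟨g, hg, fun g₀ a₀ b₀ ⟨h, hh⟩ ha₀ hb₀ => ⟨a + a₀ + map (interLeft A B) _ h,
    b + b₀ + map (interRight A B) _ h, ?_, ?_, ?_⟩⟩
  · rw [mem_cyc_succ, map_add, map_add, ha, ha₀, bd_map, hh, ← map_add, ZModModule.add_self]
  · rw [mem_cyc_succ, map_add, map_add, hb, hb₀, bd_map, hh, ← map_add, ZModModule.add_self]
  · have hD : map (incl A) (n + 1) (map (interLeft A B) (n + 1) h) =
        map (incl B) (n + 1) (map (interRight A B) (n + 1) h) := by
      rw [← map_comp, ← map_comp]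
      rfl
    simp only [map_add, hD]
    convert hab using 1
    generalize map (incl A) (n + 1) a = x
    generalize map (incl B) (n + 1) b = y
    generalize map (incl A) (n + 1) a₀ = x₀
    generalize map (incl B) (n + 1) b₀ = y₀
    generalize map (incl B) (n + 1) _ = z
    have : c + (x₀ + y₀) + (x + x₀ + z + (y + y₀ + z)) =
      c + (x + y) + ((x₀ + x₀) + (y₀ + y₀) + (z + z)) := by abel
    simpa [ZModModule.add_self] using this

end Gluing

/-! ### Punctured Euclidean space -/

/-- The complement of the origin. -/
abbrev Punct (r : ℕ) : Type := {v : Fin r → ℝ // v ≠ 0}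

namespace Punct

/-- The antipodal map. -/
def neg (r : ℕ) : C(Punct r, Punct r) :=
  ⟨fun v => ⟨-v.1, neg_ne_zero.mpr v.2⟩, by fun_prop⟩

theorem neg_comp_neg (r : ℕ) : (neg r).comp (neg r) = ContinuousMap.id _ :=
  ContinuousMap.ext fun v => Subtype.ext (neg_neg v.1)

theorem eq_zero_iff {r : ℕ} (v : Fin (r + 1) → ℝ) :
    v = 0 ↔ Fin.init v = 0 ∧ v (Fin.last r) = 0 := by
  refine ⟨fun h => by subst h; exact ⟨rfl, rfl⟩, fun ⟨h1, h2⟩ => ?_⟩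
  rw [← Fin.snoc_init_self v, h1, h2]
  funext k
  refine Fin.lastCases ?_ (fun k => ?_) k <;> simp

theorem continuous_init (r : ℕ) : Continuous fun v : Fin (r + 1) → ℝ => (Fin.init v : Fin r → ℝ) :=
  continuous_pi fun i => continuous_apply i.castSucc

variable (r : ℕ)

/-- The complement of the closed lower half axis. -/
def upper : Set (Punct (r + 1)) := {v | Fin.init v.1 ≠ 0 ∨ 0 < v.1 (Fin.last r)}

/-- The complement of the closed upper half axis. -/
def lower : Set (Punct (r + 1)) := {v | Fin.init v.1 ≠ 0 ∨ v.1 (Fin.last r) < 0}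

theorem isOpen_init : IsOpen {v : Punct (r + 1) | Fin.init v.1 ≠ 0} :=
  isOpen_ne.preimage ((continuous_init r).comp continuous_subtype_val)

theorem continuous_last : Continuous fun v : Punct (r + 1) => v.1 (Fin.last r) :=
  (continuous_apply _).comp continuous_subtype_val

theorem isOpen_upper : IsOpen (upper r) :=
  (isOpen_init r).union (isOpen_lt continuous_const (continuous_last r))

theorem isOpen_lower : IsOpen (lower r) :=
  (isOpen_init r).union (isOpen_lt (continuous_last r) continuous_const)

theorem upper_union_lower : upper r ∪ lower r = Set.univ := by
  refine Set.eq_univ_of_forall fun v => ?_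
  by_cases h : Fin.init v.1 = 0
  · have h' : v.1 (Fin.last r) ≠ 0 := fun h' => v.2 ((eq_zero_iff v.1).mpr ⟨h, h'⟩)
    rcases lt_or_gt_of_ne h' with h' | h'
    · exact Or.inr (Or.inr h')
    · exact Or.inl (Or.inr h')
  · exact Or.inl (Or.inl h)

theorem init_ne_zero (v : ↥(upper r ∩ lower r)) : Fin.init v.1.1 ≠ 0 := by
  rcases v.2.1 with h | h
  · exact h
  · exact v.2.2.resolve_right h.not_gt

/-- The antipodal map from the upper to the lower part. -/
def negUpper : C(upper r, lower r) :=
  ⟨fun v => ⟨neg _ v.1, v.2.imp (fun h h' => h (neg_eq_zero.mp h')) (neg_neg_of_pos ·)⟩,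
    by fun_prop⟩

/-- The antipodal map from the lower to the upper part. -/
def negLower : C(lower r, upper r) :=
  ⟨fun v => ⟨neg _ v.1, v.2.imp (fun h h' => h (neg_eq_zero.mp h')) (neg_pos_of_neg ·)⟩,
    by fun_prop⟩

/-- The projection away from the axis. -/
def outer : C(↥(upper r ∩ lower r), Punct r) :=
  ⟨fun v => ⟨Fin.init v.1.1, init_ne_zero r v⟩, by
    refine Continuous.subtype_mk ((continuous_init r).comp ?_) _
    fun_prop⟩

theorem snoc_ne_zero {r : ℕ} {w : Fin r → ℝ} {t : ℝ} (h : w ≠ 0 ∨ t ≠ 0) :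
    (Fin.snoc w t : Fin (r + 1) → ℝ) ≠ 0 := by
  intro h0
  rw [eq_zero_iff, Fin.init_snoc, Fin.snoc_last] at h0
  tauto

/-- The equatorial inclusion. -/
def equator : C(Punct r, ↥(upper r ∩ lower r)) :=
  ⟨fun w => ⟨⟨Fin.snoc w.1 0, snoc_ne_zero (Or.inl w.2)⟩,
    Or.inl (by rw [Fin.init_snoc]; exact w.2), Or.inl (by rw [Fin.init_snoc]; exact w.2)⟩, by
    refine Continuous.subtype_mk (Continuous.subtype_mk ?_ _) _
    exact Continuous.finSnoc (by fun_prop) (by fun_prop)⟩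

theorem continuous_snoc {Z : Type*} [TopologicalSpace Z] {f : Z → Fin r → ℝ} {g : Z → ℝ}
    (hf : Continuous f) (hg : Continuous g) :
    Continuous fun z => (Fin.snoc (f z) (g z) : Fin (r + 1) → ℝ) :=
  Continuous.finSnoc hf hg

/-- The complement of the axis deforms to the equator. -/
def equatorHtpy : (ContinuousMap.id ↥(upper r ∩ lower r)).Homotopy
    ((equator r).comp (outer r)) where
  toFun p := ⟨⟨Fin.snoc (Fin.init p.2.1.1) ((1 - p.1) * p.2.1.1 (Fin.last r)),
    snoc_ne_zero (Or.inl (init_ne_zero r p.2))⟩,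
    Or.inl (by rw [Fin.init_snoc]; exact init_ne_zero r p.2),
    Or.inl (by rw [Fin.init_snoc]; exact init_ne_zero r p.2)⟩
  continuous_toFun := by
    refine Continuous.subtype_mk (Continuous.subtype_mk (continuous_snoc r ?_ ?_) _) _
    · exact (continuous_init r).comp (by fun_prop)
    · exact Continuous.mul (by fun_prop)
        ((continuous_last r).comp (continuous_subtype_val.comp continuous_snd))
  map_zero_left v := by
    refine Subtype.ext (Subtype.ext ?_)
    simp
  map_one_left v := by
    refine Subtype.ext (Subtype.ext ?_)
    simp [equator, outer]

/-- The north pole. -/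
def pole : upper r :=
  ⟨⟨Fin.snoc 0 1, snoc_ne_zero (Or.inr one_ne_zero)⟩, Or.inr (by simp)⟩

/-- Before the end of the segment to the pole the off-axis component is only rescaled, and a
positive last coordinate stays positive; the endpoint has last coordinate 1. The segment thus avoids
the closed lower half axis. -/
theorem upper_segment (s : unitInterval) (v : upper r) :
    (1 - (s : ℝ)) • Fin.init v.1.1 ≠ 0 ∨ 0 < (1 - (s : ℝ)) * v.1.1 (Fin.last r) + s := by
  rcases eq_or_lt_of_le s.2.2 with h | h
  · right
    rw [h]
    norm_num
  · have h1 : 0 < 1 - (s : ℝ) := by linarith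
    refine v.2.imp (fun hv => smul_ne_zero h1.ne' hv) fun hv => ?_
    have := mul_pos h1 hv
    linarith [s.2.1]

/-- The upper part is contractible. -/
def upperHtpy : (ContinuousMap.id (upper r)).Homotopy (ContinuousMap.const _ (pole r)) where
  toFun p := ⟨⟨Fin.snoc ((1 - (p.1 : ℝ)) • Fin.init p.2.1.1)
      ((1 - (p.1 : ℝ)) * p.2.1.1 (Fin.last r) + p.1),
      snoc_ne_zero ((upper_segment r p.1 p.2).imp id ne_of_gt)⟩, by
        simpa [upper] using upper_segment r p.1 p.2⟩
  continuous_toFun := by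
    refine Continuous.subtype_mk (Continuous.subtype_mk (continuous_snoc r ?_ ?_) _) _
    · exact Continuous.smul (f := fun p : unitInterval × upper r => 1 - (p.1 : ℝ)) (by fun_prop)
        ((continuous_init r).comp (by fun_prop))
    · exact (Continuous.mul (by fun_prop) ((continuous_last r).comp
        (continuous_subtype_val.comp continuous_snd))).add (by fun_prop)
  map_zero_left v := by
    refine Subtype.ext (Subtype.ext ?_)
    simp
  map_one_left v := by
    refine Subtype.ext (Subtype.ext ?_)
    simp [pole]

theorem upper_acyclic (n : ℕ) : cyc n ≤ bdry (upper r) n :=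
  cyc_le_bdry_of_homotopy (upperHtpy r) n

theorem lower_acyclic (n : ℕ) : cyc n ≤ bdry (lower r) n := by
  intro c hc
  have h : (negUpper r).comp (negLower r) = ContinuousMap.id _ :=
    ContinuousMap.ext fun v => Subtype.ext (Subtype.ext (neg_neg v.1.1))
  rw [← map_id c, ← h, map_comp]
  exact map_mem_bdry _ (upper_acyclic r n (map_mem_cyc _ hc))

instance : Nonempty (Punct (r + 1)) := ⟨(pole r).1⟩

instance : IsEmpty (Punct 0) := ⟨fun v => v.2 (Subsingleton.elim _ _)⟩

variable {r}

theorem inter_mem_bdry {n : ℕ} {g : Chain ↥(upper r ∩ lower r) n} (hg : g ∈ cyc n)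
    (h : map (outer r) n g ∈ bdry _ n) : g ∈ bdry _ n :=
  mem_bdry_of_map_mem_bdry (equatorHtpy r) hg h

/-- The homology of a punctured Euclidean space outside of the degree of its fundamental class. -/
theorem cyc_le_bdry (n : ℕ) (h : n ≠ r) : cyc n ≤ bdry (Punct r) n := by
  induction r generalizing n with
  | zero =>
    obtain ⟨n, rfl⟩ := Nat.exists_eq_succ_of_ne_zero h
    have : IsEmpty (Simp (Punct 0) (n + 1)) :=
      ⟨fun σ => IsEmpty.false (σ stdSimplex.barycenter)⟩
    intro c _
    rw [Subsingleton.elim c 0]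
    exact zero_mem _
  | succ r ih =>
    cases n with
    | zero => exact cyc_zero_le_bdry
    | succ n =>
      intro c hc
      obtain ⟨g, hg, H⟩ := exists_glue (isOpen_upper r) (isOpen_lower r) (upper_union_lower r) hc
      -- By induction the connecting cycle bounds, so zero may be taken as the reference
      -- decomposition. The cycle then splits into cycles of the two contractible parts.
      have hg' := inter_mem_bdry hg (ih n (by omega) (map_mem_cyc _ hg))
      obtain ⟨a, b, ha, hb, hab⟩ := H 0 0 0 (by rwa [add_zero]) (by simp) (by simp)
      rw [map_zero, map_zero, add_zero, add_zero] at hab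
      exact (Submodule.add_mem_iff_left _ (add_mem (map_mem_bdry _ (upper_acyclic r _ ha))
        (map_mem_bdry _ (lower_acyclic r _ hb)))).mp hab

/-- The fundamental class of a punctured Euclidean space: an antipodally invariant cycle generating
the homology, which in positive dimension is the sum of a chain and its antipode. -/
theorem exists_fundamental_cycle (r : ℕ) : ∃ z : Chain (Punct r) r, z ∈ cyc r ∧
    map (neg r) r z = z ∧ (r ≠ 0 → ∃ c, z = c + map (neg r) r c) ∧
    ∀ w ∈ cyc r, ∃ ε : ZMod 2, w + ε • z ∈ bdry (Punct r) r := by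
  induction r with
  | zero =>
    have hu : Subsingleton (Simp (Punct 0) 0) := by
      refine ⟨fun σ τ => ContinuousMap.ext fun t => ?_⟩
      have := t.2.2
      simp at this
    let σ : Simp (Punct 0) 0 := ⟨fun t => by
      have := t.2.2
      simp at this, by
      refine continuous_iff_continuousAt.mpr fun t => ?_
      have := t.2.2
      simp at this⟩
    -- The sphere of dimension -1 is empty, and its reduced homology is generated by the empty
    -- simplex in degree -1.
    refine ⟨single σ 1, trivial, ?_, fun h => (h rfl).elim, fun w _ => ⟨w σ, ?_⟩⟩
    · rw [map_single, Subsingleton.elim ((neg 0).comp σ) σ]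
    · have hw : w = w σ • single σ 1 := by
        ext τ
        rw [Subsingleton.elim τ σ]
        simp
      rw [← hw, ZModModule.add_self]
      exact zero_mem _
  | succ r ih =>
    obtain ⟨z, hz, hneg, -, hgen⟩ := ih
    -- The class of the equator bounds a chain c in the upper part. Since the class is invariant,
    -- the antipode of c bounds it in the lower part, and the two hemispheres glue to the new cycle.
    obtain ⟨c, hc⟩ := upper_acyclic r r (map_mem_cyc (interLeft _ _) (map_mem_cyc (equator r) hz))
    have hc' : bd (map (negUpper r) (r + 1) c) =
        map (interRight _ _) r (map (equator r) r z) := by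
      rw [bd_map, hc, ← map_comp, ← map_comp, ← hneg, ← map_comp, ← map_comp, hneg]
      congr 2
      refine ContinuousMap.ext fun v => Subtype.ext (Subtype.ext ?_)
      change -(Fin.snoc (-v.1) 0 : Fin (r + 1) → ℝ) = Fin.snoc v.1 0
      funext k
      refine Fin.lastCases ?_ (fun k => ?_) k <;> simp
    have hnn : ∀ {n} (d : Chain (Punct (r + 1)) n), map (neg _) n (map (neg _) n d) = d := by
      intro n d
      rw [← map_comp, neg_comp_neg, map_id]
    have hnu : map (neg (r + 1)) (r + 1) (map (incl (upper r)) (r + 1) c) =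
        map (incl (lower r)) (r + 1) (map (negUpper r) (r + 1) c) := by
      rw [← map_comp, ← map_comp]
      rfl
    have hbd : bd (map (incl (upper r)) (r + 1) c) =
        bd (map (incl (lower r)) (r + 1) (map (negUpper r) (r + 1) c)) := by
      rw [bd_map, bd_map (incl (lower r)), hc, hc', ← map_comp (incl (upper r)),
        ← map_comp (incl (lower r))]
      rfl
    refine ⟨map (incl (upper r)) (r + 1) c +
      map (neg (r + 1)) (r + 1) (map (incl (upper r)) (r + 1) c),
      ?_, ?_, fun _ => ⟨_, rfl⟩, fun w hw => ?_⟩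
    · rw [mem_cyc_succ, map_add bd, hnu, hbd]
      exact ZModModule.add_self _
    · rw [map_add (map (neg (r + 1)) (r + 1)), hnn]
      exact add_comm _ _
    · obtain ⟨g, hg, H⟩ := exists_glue (isOpen_upper r) (isOpen_lower r) (upper_union_lower r) hw
      obtain ⟨ε, hε⟩ := hgen _ (map_mem_cyc (outer r) hg)
      have hout : (outer r).comp (equator r) = ContinuousMap.id _ := by
        refine ContinuousMap.ext fun v => Subtype.ext ?_
        simp [outer, equator]
      have hg' : g + ε • map (equator r) r z ∈ bdry _ r := by
        refine inter_mem_bdry (add_mem hg (Submodule.smul_mem _ _ (map_mem_cyc _ hz))) ?_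
        rwa [map_add, map_smul, ← map_comp, hout, map_id]
      -- The connecting cycle of w is ε times the equator up to a boundary, so ε times the two
      -- hemispheres serves as reference decomposition.
      obtain ⟨a, b, ha, hb, hab⟩ := H (ε • map (equator r) r z) (ε • c)
        (ε • map (negUpper r) (r + 1) c) hg' (by rw [map_smul, hc, map_smul])
        (by rw [map_smul, hc', map_smul])
      refine ⟨ε, ?_⟩
      rw [hnu, smul_add, ← map_smul, ← map_smul]
      exact (Submodule.add_mem_iff_left _ (add_mem (map_mem_bdry _ (upper_acyclic r _ ha))
        (map_mem_bdry _ (lower_acyclic r _ hb)))).mp hab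

end Punct

/-! ### Lines in Euclidean space -/

/-- The space of symmetric matrices `v vᵀ` with `v ≠ 0`, a model for real projective space. -/
abbrev Lines (r : ℕ) : Type :=
  {M : Fin r → Fin r → ℝ // ∃ v : Fin r → ℝ, v ≠ 0 ∧ ∀ i j, M i j = v i * v j}

namespace Lines

/-- The matrix `v vᵀ`. -/
def quot (r : ℕ) : C(Punct r, Lines r) :=
  ⟨fun v => ⟨fun i j => v.1 i * v.1 j, v.1, v.2, fun _ _ => rfl⟩, by
    refine Continuous.subtype_mk (continuous_pi fun i => continuous_pi fun j => ?_) _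
    exact ((continuous_apply i).comp continuous_subtype_val).mul
      ((continuous_apply j).comp continuous_subtype_val)⟩

theorem quot_comp_neg (r : ℕ) : (quot r).comp (Punct.neg r) = quot r := by
  refine ContinuousMap.ext fun v => Subtype.ext ?_
  funext i j
  simp [quot, Punct.neg]

variable (r : ℕ)

/-- The lines different from the last coordinate axis. -/
def offAxis : Set (Lines (r + 1)) := {M | ∃ i j : Fin r, M.1 i.castSucc j.castSucc ≠ 0}

/-- The lines not in the last coordinate hyperplane. -/
def chart : Set (Lines (r + 1)) := {M | M.1 (Fin.last r) (Fin.last r) ≠ 0}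

theorem continuous_entry (i j : Fin r) : Continuous fun M : Lines r => M.1 i j :=
  (continuous_apply j).comp ((continuous_apply i).comp continuous_subtype_val)

theorem isOpen_offAxis : IsOpen (offAxis r) := by
  have : offAxis r = ⋃ (i : Fin r) (j : Fin r),
      (fun M : Lines (r + 1) => M.1 i.castSucc j.castSucc) ⁻¹' {x | x ≠ 0} := by
    ext M
    simp [offAxis]
  rw [this]
  exact isOpen_iUnion fun i => isOpen_iUnion fun j => isOpen_ne.preimage (continuous_entry _ _ _)

theorem isOpen_chart : IsOpen (chart r) := isOpen_ne.preimage (continuous_entry _ _ _)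

theorem mem_offAxis_iff {M : Lines (r + 1)} {v : Fin (r + 1) → ℝ}
    (h : ∀ i j, M.1 i j = v i * v j) : M ∈ offAxis r ↔ Fin.init v ≠ 0 := by
  constructor
  · rintro ⟨i, j, hij⟩ h0
    rw [h] at hij
    exact hij (by rw [show v i.castSucc = 0 from congrFun h0 i, zero_mul])
  · intro h0
    obtain ⟨i, hi⟩ := Function.ne_iff.mp h0
    exact ⟨i, i, by rw [h]; exact mul_ne_zero hi hi⟩

theorem offAxis_union_chart : offAxis r ∪ chart r = Set.univ := by
  refine Set.eq_univ_of_forall fun M => ?_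
  obtain ⟨v, hv, h⟩ := M.2
  by_cases h0 : Fin.init v = 0
  · right
    have hl : v (Fin.last r) ≠ 0 := fun hl => hv ((Punct.eq_zero_iff v).mpr ⟨h0, hl⟩)
    change M.1 _ _ ≠ 0
    rw [h]
    exact mul_ne_zero hl hl
  · exact Or.inl ((mem_offAxis_iff r h).mpr h0)

/-- The upper left block of the matrix of a line. -/
def block : C(offAxis r, Lines r) :=
  ⟨fun M => ⟨fun i j => M.1.1 i.castSucc j.castSucc, by
    obtain ⟨v, hv, h⟩ := M.1.2
    exact ⟨Fin.init v, (mem_offAxis_iff r h).mp M.2, fun i j => h _ _⟩⟩, by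
    refine Continuous.subtype_mk (continuous_pi fun i => continuous_pi fun j => ?_) _
    exact (continuous_entry _ _ _).comp continuous_subtype_val⟩

/-- The linear inclusion of lines. -/
def pad : C(Lines r, Lines (r + 1)) where
  toFun M := ⟨Fin.snoc (fun i => Fin.snoc (M.1 i) 0) 0, by
    obtain ⟨v, hv, h⟩ := M.2
    refine ⟨Fin.snoc v 0, Punct.snoc_ne_zero (Or.inl hv), fun i j => ?_⟩
    refine Fin.lastCases ?_ (fun i => ?_) i <;> refine Fin.lastCases ?_ (fun j => ?_) j <;>
      simp [h]⟩
  continuous_toFun := by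
    refine Continuous.subtype_mk (continuous_pi fun i => continuous_pi fun j => ?_) _
    refine Fin.lastCases ?_ (fun i => ?_) i <;> refine Fin.lastCases ?_ (fun j => ?_) j
    · simpa using continuous_const
    · simpa using continuous_const
    · simpa using continuous_const
    · simpa using continuous_entry _ _ _

theorem pad_mem_offAxis (M : Lines r) : pad r M ∈ offAxis r := by
  obtain ⟨v, hv, h⟩ := M.2
  obtain ⟨i, hi⟩ := Function.ne_iff.mp hv
  exact ⟨i, i, by simpa [pad, h] using hi⟩

/-- The linear inclusion of lines, as a map to the complement of the axis. -/
def padOff : C(Lines r, offAxis r) :=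
  ⟨fun M => ⟨pad r M, pad_mem_offAxis r M⟩, (pad r).continuous.subtype_mk _⟩

theorem block_comp_padOff : (block r).comp (padOff r) = ContinuousMap.id _ := by
  refine ContinuousMap.ext fun M => Subtype.ext ?_
  funext i j
  simp [block, padOff, pad]

theorem incl_comp_padOff : (incl (offAxis r)).comp (padOff r) = pad r := rfl

/-- The lines off the axis deform to the linear subspace. -/
def offHtpy : (ContinuousMap.id (offAxis r)).Homotopy ((padOff r).comp (block r)) where
  -- Scaling the last coordinate of a generator by 1 - s scales the last row and column of the
  -- matrix by 1 - s, and the corner by its square.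
  toFun p := ⟨⟨fun i j => Fin.snoc (α := fun _ => ℝ) (fun _ => 1) (1 - (p.1 : ℝ)) i *
      Fin.snoc (α := fun _ => ℝ) (fun _ => 1) (1 - (p.1 : ℝ)) j * p.2.1.1 i j, by
        obtain ⟨v, hv, h⟩ := p.2.1.2
        refine ⟨fun i => Fin.snoc (α := fun _ => ℝ) (fun _ => 1) (1 - (p.1 : ℝ)) i * v i,
          fun h0 => (mem_offAxis_iff r h).mp p.2.2 ?_, fun i j => by simp only [h]; ring⟩
        funext i
        simpa [Fin.init] using congrFun h0 i.castSucc⟩, by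
      obtain ⟨i, j, hij⟩ := p.2.2
      exact ⟨i, j, by simpa using hij⟩⟩
  continuous_toFun := by
    refine Continuous.subtype_mk (Continuous.subtype_mk
      (continuous_pi fun i => continuous_pi fun j => ?_) _) _
    have h1 : ∀ i : Fin (r + 1), Continuous fun p : unitInterval × offAxis r =>
        (Fin.snoc (α := fun _ => ℝ) (fun _ => 1) (1 - (p.1 : ℝ)) i : ℝ) := by
      intro i
      refine Fin.lastCases ?_ (fun i => ?_) i
      · simp only [Fin.snoc_last]
        fun_prop
      · simp only [Fin.snoc_castSucc]
        fun_prop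
    exact ((h1 i).mul (h1 j)).mul
      ((continuous_entry _ i j).comp (continuous_subtype_val.comp continuous_snd))
  map_zero_left M := by
    refine Subtype.ext (Subtype.ext ?_)
    funext i j
    refine Fin.lastCases ?_ (fun i => ?_) i <;> refine Fin.lastCases ?_ (fun j => ?_) j <;> simp
  map_one_left M := by
    refine Subtype.ext (Subtype.ext ?_)
    funext i j
    refine Fin.lastCases ?_ (fun i => ?_) i <;> refine Fin.lastCases ?_ (fun j => ?_) j <;>
      simp [padOff, pad, block]

/-- The generator of a line with positive last coordinate. -/
def gen (M : Lines (r + 1)) (i : Fin (r + 1)) : ℝ :=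
  -- On v vᵀ with nonzero last coordinate this is v times the sign of that coordinate.
  M.1 i (Fin.last r) / √(M.1 (Fin.last r) (Fin.last r))

variable {r}

theorem last_pos {M : Lines (r + 1)} (hM : M ∈ chart r) : 0 < M.1 (Fin.last r) (Fin.last r) := by
  obtain ⟨v, hv, h⟩ := M.2
  refine lt_of_le_of_ne ?_ (Ne.symm hM)
  rw [h]
  exact mul_self_nonneg _

theorem gen_last_pos {M : Lines (r + 1)} (hM : M ∈ chart r) : 0 < gen r M (Fin.last r) :=
  div_pos (last_pos hM) (Real.sqrt_pos.mpr (last_pos hM))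

/-- The matrix has rank one, so `gen` is a section of `quot` over the chart; being continuous, it
turns straight-line homotopies of vectors into homotopies of lines. -/
theorem gen_mul_gen {M : Lines (r + 1)} (hM : M ∈ chart r) (i j : Fin (r + 1)) :
    gen r M i * gen r M j = M.1 i j := by
  have hp := last_pos hM
  rw [gen, gen, div_mul_div_comm, Real.mul_self_sqrt hp.le, div_eq_iff hp.ne']
  obtain ⟨v, hv, h⟩ := M.2
  simp only [h]
  ring

theorem continuous_gen (i : Fin (r + 1)) : Continuous fun M : chart r => gen r M.1 i := by
  refine Continuous.div ((continuous_entry _ _ _).comp continuous_subtype_val)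
    (Real.continuous_sqrt.comp ((continuous_entry _ _ _).comp continuous_subtype_val)) fun M => ?_
  exact (Real.sqrt_pos.mpr (last_pos M.2)).ne'

theorem ne_zero_of_last_pos {v : Fin (r + 1) → ℝ} (h : 0 < v (Fin.last r)) : v ≠ 0 :=
  fun h0 => h.ne' (congrFun h0 _)

/-- The line spanned by a vector with positive last coordinate. -/
def ofPos (v : Fin (r + 1) → ℝ) (h : 0 < v (Fin.last r)) : chart r :=
  ⟨quot (r + 1) ⟨v, ne_zero_of_last_pos h⟩, mul_ne_zero h.ne' h.ne'⟩

theorem ofPos_congr {v w : Fin (r + 1) → ℝ} {h : 0 < v (Fin.last r)} {h' : 0 < w (Fin.last r)}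
    (hvw : v = w) : ofPos v h = ofPos w h' := by
  subst hvw
  rfl

theorem continuous_ofPos {Z : Type*} [TopologicalSpace Z] {v : Z → Fin (r + 1) → ℝ}
    (hv : Continuous v) (h : ∀ z, 0 < v z (Fin.last r)) : Continuous fun z => ofPos (v z) (h z) :=
  Continuous.subtype_mk ((quot (r + 1)).continuous.comp (hv.subtype_mk _)) _

theorem ofPos_gen (M : chart r) : ofPos (gen r M.1) (gen_last_pos M.2) = M := by
  refine Subtype.ext (Subtype.ext ?_)
  funext i j
  exact gen_mul_gen M.2 i j

theorem interp_pos {s : unitInterval} {a b : ℝ} (ha : 0 < a) (hb : 0 < b) :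
    0 < (1 - (s : ℝ)) * a + s * b := by
  rcases eq_or_lt_of_le s.2.1 with h | h
  · rw [← h]
    simpa using ha
  · have h1 : 0 ≤ (1 - (s : ℝ)) * a := mul_nonneg (by linarith [s.2.2]) ha.le
    linarith [mul_pos h hb]

/-- The straight line between the generator of a line and a vector. -/
def interp (s : unitInterval) (M : Lines (r + 1)) (w : Fin (r + 1) → ℝ) : Fin (r + 1) → ℝ :=
  fun i => (1 - (s : ℝ)) * gen r M i + s * w i

theorem interp_last_pos (s : unitInterval) {M : Lines (r + 1)} (hM : M ∈ chart r)
    {w : Fin (r + 1) → ℝ} (hw : 0 < w (Fin.last r)) : 0 < interp s M w (Fin.last r) :=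
  interp_pos (gen_last_pos hM) hw

variable (r)

/-- The last coordinate axis. -/
def axis : Fin (r + 1) → ℝ := Fin.snoc 0 1

theorem axis_last : 0 < axis r (Fin.last r) := by simp [axis]

/-- The affine chart is contractible. -/
def chartHtpy : (ContinuousMap.id (chart r)).Homotopy
    (ContinuousMap.const _ (ofPos (axis r) (axis_last r))) where
  toFun p := ofPos (interp p.1 p.2.1 (axis r)) (interp_last_pos p.1 p.2.2 (axis_last r))
  continuous_toFun := by
    refine continuous_ofPos (continuous_pi fun i => ?_) _
    exact (Continuous.mul (by fun_prop) ((continuous_gen i).comp continuous_snd)).add (by fun_prop)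
  map_zero_left M := by
    refine (ofPos_congr ?_).trans (ofPos_gen M)
    funext i
    simp [interp]
  map_one_left M := by
    refine ofPos_congr (h' := axis_last r) ?_
    funext i
    simp [interp]

theorem chart_acyclic (n : ℕ) : cyc n ≤ bdry (chart r) n := cyc_le_bdry_of_homotopy (chartHtpy r) n

/-- The last column of the matrix of a line in the affine chart off the axis. -/
def column : C(↥(offAxis r ∩ chart r), Punct r) :=
  ⟨fun M => ⟨fun i => M.1.1 i.castSucc (Fin.last r), by
    obtain ⟨i, j, hij⟩ := M.2.1
    have hl := M.2.2
    obtain ⟨v, hv, h⟩ := M.1.2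
    intro h0
    have h1 := congrFun h0 i
    change M.1.1 _ _ ≠ 0 at hl
    simp only [h, Pi.zero_apply, mul_eq_zero, ne_eq, not_or] at h1 hij hl
    tauto⟩, by
    refine Continuous.subtype_mk (continuous_pi fun i => ?_) _
    exact (continuous_entry _ _ _).comp continuous_subtype_val⟩

theorem ofPos_mem_offAxis {v : Fin (r + 1) → ℝ} (h : 0 < v (Fin.last r)) (h0 : Fin.init v ≠ 0) :
    (ofPos v h).1 ∈ offAxis r :=
  (mem_offAxis_iff r (fun _ _ => rfl)).mpr h0

theorem snoc_one_pos (w : Fin r → ℝ) : 0 < (Fin.snoc w 1 : Fin (r + 1) → ℝ) (Fin.last r) := by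
  simp

/-- The inclusion of the affine chart off the axis. -/
def affineIncl : C(Punct r, ↥(offAxis r ∩ chart r)) :=
  ⟨fun w => ⟨(ofPos (Fin.snoc w.1 1) (snoc_one_pos r w.1)).1,
    ofPos_mem_offAxis r _ (by rw [Fin.init_snoc]; exact w.2),
    (ofPos (Fin.snoc w.1 1) (snoc_one_pos r w.1)).2⟩, by
    refine Continuous.subtype_mk (continuous_subtype_val.comp (continuous_ofPos ?_ _)) _
    exact Punct.continuous_snoc r continuous_subtype_val continuous_const⟩

/-- Off the last coordinate the generator is the last column divided by the root of the corner
entry. The interpolation therefore stays a positive multiple of the column. -/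
theorem init_interp_ne_zero (s : unitInterval) (M : ↥(offAxis r ∩ chart r)) :
    Fin.init (interp s M.1 (Fin.snoc (column r M).1 1)) ≠ 0 := by
  have hp := last_pos M.2.2
  have h1 : 0 < (√(M.1.1 (Fin.last r) (Fin.last r)))⁻¹ := inv_pos.mpr (Real.sqrt_pos.mpr hp)
  have h2 : Fin.init (interp s M.1 (Fin.snoc (column r M).1 1)) =
      ((1 - (s : ℝ)) * (√(M.1.1 (Fin.last r) (Fin.last r)))⁻¹ + s * 1) • (column r M).1 := by
    funext i
    simp only [Fin.init, interp, gen, Fin.snoc_castSucc, Pi.smul_apply, smul_eq_mul, column,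
      ContinuousMap.coe_mk]
    ring
  rw [h2]
  exact smul_ne_zero (interp_pos h1 one_pos).ne' (column r M).2

/-- The affine chart off the axis deforms to a punctured affine space. -/
def affineHtpy : (ContinuousMap.id ↥(offAxis r ∩ chart r)).Homotopy
    ((affineIncl r).comp (column r)) where
  toFun p := ⟨(ofPos (interp p.1 p.2.1 (Fin.snoc (column r p.2).1 1))
      (interp_last_pos p.1 p.2.2.2 (snoc_one_pos r _))).1,
    ofPos_mem_offAxis r _ (init_interp_ne_zero r p.1 p.2),
    (ofPos (interp p.1 p.2.1 (Fin.snoc (column r p.2).1 1))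
      (interp_last_pos p.1 p.2.2.2 (snoc_one_pos r _))).2⟩
  continuous_toFun := by
    refine Continuous.subtype_mk (continuous_subtype_val.comp
      (continuous_ofPos (continuous_pi fun i => ?_) _)) _
    have h1 : Continuous fun p : unitInterval × ↥(offAxis r ∩ chart r) => gen r p.2.1 i :=
      (continuous_gen i).comp
        ((ContinuousMap.inclusion (Set.inter_subset_right (s := offAxis r))).continuous.comp
          continuous_snd)
    have h2 : Continuous fun p : unitInterval × ↥(offAxis r ∩ chart r) =>
        (Fin.snoc (column r p.2).1 1 : Fin (r + 1) → ℝ) :=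
      Punct.continuous_snoc r
        (continuous_subtype_val.comp ((column r).continuous.comp continuous_snd)) continuous_const
    exact (Continuous.mul (by fun_prop) h1).add
      (Continuous.mul (by fun_prop) ((continuous_apply i).comp h2))
  map_zero_left M := by
    refine Subtype.ext ?_
    refine congrArg (incl (chart r)) ((ofPos_congr
      (h := interp_last_pos 0 M.2.2 (snoc_one_pos r _)) ?_).trans (ofPos_gen ⟨M.1, M.2.2⟩))
    funext i
    simp [interp]
  map_one_left M := by
    refine Subtype.ext (congrArg (incl (chart r)) (ofPos_congr
      (h := interp_last_pos 1 M.2.2 (snoc_one_pos r _)) (h' := snoc_one_pos r _) ?_))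
    funext i
    simp [interp]

variable {r}

/-- The link of the axis maps to the linear subspace by the double cover that forgets signs. -/
theorem block_comp_affineIncl :
    ((block r).comp (interLeft (offAxis r) (chart r))).comp (affineIncl r) = quot r := by
  refine ContinuousMap.ext fun w => Subtype.ext ?_
  funext i j
  change (Fin.snoc w.1 1 : Fin (r + 1) → ℝ) i.castSucc *
    (Fin.snoc w.1 1 : Fin (r + 1) → ℝ) j.castSucc = w.1 i * w.1 j
  simp

/-- The projection to the linear subspace kills the homology of the link of the axis. -/
theorem map_block_mem_bdry (hr : r ≠ 0) {n : ℕ} (hn : n ≤ r) {g : Chain ↥(offAxis r ∩ chart r) n}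
    (hg : g ∈ cyc n) :
    map (block r) n (map (interLeft (offAxis r) (chart r)) n g) ∈ bdry (Lines r) n := by
  -- After the deformation of the link, the projected cycle becomes the image under `quot` of a
  -- cycle in punctured space.
  have h1 := map_mem_bdry ((block r).comp (interLeft (offAxis r) (chart r)))
    (map_add_map_mem_bdry (affineHtpy r) hg)
  rw [map_add, map_id, ← map_comp _ ((affineIncl r).comp (column r)), ← ContinuousMap.comp_assoc,
    block_comp_affineIncl, map_comp, map_comp] at h1
  refine (Submodule.add_mem_iff_left _ ?_).mp h1
  have hcol := map_mem_cyc (column r) hg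
  rcases hn.lt_or_eq with hn | rfl
  · exact map_mem_bdry _ (Punct.cyc_le_bdry n hn.ne hcol)
  -- The decisive use of coefficients modulo two: the fundamental cycle is c plus its antipode, and
  -- `quot` sends the two summands to the same chain.
  · obtain ⟨z, hz, -, hc, hgen⟩ := Punct.exists_fundamental_cycle n
    obtain ⟨c, rfl⟩ := hc hr
    obtain ⟨ε, hε⟩ := hgen _ hcol
    have h2 := map_mem_bdry (quot n) hε
    rwa [map_add, map_smul, map_add, ← map_comp _ (Punct.neg n), quot_comp_neg,
      ZModModule.add_self, smul_zero,
      add_zero] at h2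

theorem inter_mem_bdry {n : ℕ} (hn : n ≠ r) {g : Chain ↥(offAxis r ∩ chart r) n}
    (hg : g ∈ cyc n) : g ∈ bdry _ n :=
  mem_bdry_of_map_mem_bdry (affineHtpy r) hg (Punct.cyc_le_bdry n hn (map_mem_cyc _ hg))

/-- Mayer-Vietoris makes c homologous, off the axis, to a cycle of the link; projecting back to the
subspace keeps c and kills the cycle of the link. -/
theorem mem_bdry_of_map_pad (hr : r ≠ 0) {n : ℕ} (hn : n ≤ r) {c : Chain (Lines r) n}
    (hc : c ∈ cyc n) (h : map (pad r) n c ∈ bdry _ n) : c ∈ bdry _ n := by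
  rw [← incl_comp_padOff, map_comp] at h
  obtain ⟨g, hg, hcg, -⟩ := exists_inter_of_mem_bdry (isOpen_offAxis r) (isOpen_chart r)
    (offAxis_union_chart r) (map_mem_cyc _ hc) h
  have h1 := map_mem_bdry (block r) hcg
  rw [map_add, ← map_comp, block_comp_padOff, map_id] at h1
  exact (Submodule.add_mem_iff_left _ (map_block_mem_bdry hr hn hg)).mp h1

/-- In degrees other than that of the link of the axis, cycles are homologous to cycles of the
linear subspace. -/
theorem exists_add_map_pad_mem_bdry {n : ℕ} (hn : n ≠ r) {c : Chain (Lines (r + 1)) (n + 1)}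
    (hc : c ∈ cyc (n + 1)) : ∃ z ∈ cyc (n + 1), c + map (pad r) (n + 1) z ∈ bdry _ (n + 1) := by
  -- Outside the exceptional degree the connecting cycle bounds, so both parts can be made cycles.
  -- The one in the chart bounds, and the one off the axis deforms into the subspace.
  obtain ⟨g, hg, H⟩ := exists_glue (isOpen_offAxis r) (isOpen_chart r) (offAxis_union_chart r) hc
  obtain ⟨a, b, ha, hb, hab⟩ := H 0 0 0 (by rw [add_zero]; exact inter_mem_bdry hn hg) (by simp)
    (by simp)
  refine ⟨map (block r) _ a, map_mem_cyc _ ha, ?_⟩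
  rw [map_zero, map_zero, add_zero, add_zero, ← add_assoc] at hab
  have hb' := map_mem_bdry (incl (chart r)) (chart_acyclic r _ hb)
  have h1 := (Submodule.add_mem_iff_left _ hb').mp hab
  have h2 := map_mem_bdry (incl (offAxis r)) (map_add_map_mem_bdry (offHtpy r) ha)
  rw [map_id, map_add, ← map_comp, ← ContinuousMap.comp_assoc, incl_comp_padOff, map_comp] at h2
  have h3 := add_mem h1 h2
  rwa [add_assoc, ← add_assoc (map (incl (offAxis r)) _ a), ZModModule.add_self, zero_add] at h3

instance : Nonempty (Lines (r + 1)) := ⟨(ofPos (axis r) (axis_last r)).1⟩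

theorem exists_add_map_pad_mem_bdry_of_le {n : ℕ} (hn : n ≤ r) {c : Chain (Lines (r + 1)) n}
    (hc : c ∈ cyc n) : ∃ z ∈ cyc n, c + map (pad r) n z ∈ bdry _ n := by
  cases n with
  | zero => exact ⟨0, trivial, by rw [map_zero, add_zero]; exact cyc_zero_le_bdry hc⟩
  | succ n => exact exists_add_map_pad_mem_bdry (by omega) hc

/-- The homology of real projective space vanishes above its dimension. -/
theorem cyc_le_bdry {n : ℕ} (hn : r < n) : cyc n ≤ bdry (Lines r) n := by
  induction r generalizing n with
  | zero =>
    obtain ⟨n, rfl⟩ := Nat.exists_eq_succ_of_ne_zero hn.ne'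
    have : IsEmpty (Simp (Lines 0) (n + 1)) :=
      ⟨fun σ => by
        obtain ⟨v, hv, -⟩ := (σ stdSimplex.barycenter).2
        exact hv (Subsingleton.elim _ _)⟩
    intro c _
    rw [Subsingleton.elim c 0]
    exact zero_mem _
  | succ r ih =>
    cases n with
    | zero => omega
    | succ n =>
      intro c hc
      obtain ⟨z, hz, h⟩ := exists_add_map_pad_mem_bdry (by omega) hc
      exact (Submodule.add_mem_iff_left _ (map_mem_bdry _ (ih (by omega) hz))).mp h

end Lines

/-! ### Unaugmented homology -/

section Unaugmented

variable {X Y X' Y' : Type*} [TopologicalSpace X] [TopologicalSpace Y] [TopologicalSpace X']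
  [TopologicalSpace Y']

/-- Unaugmented singular cycles. -/
def ucyc : ∀ j, Submodule (ZMod 2) (Chain X (j + 1))
  | 0 => ⊤
  | _ + 1 => LinearMap.ker bd

theorem mem_ucyc_succ {j : ℕ} {c : Chain X (j + 2)} : c ∈ ucyc (j + 1) ↔ bd c = 0 := Iff.rfl

theorem map_mem_ucyc (f : C(X, Y)) {j : ℕ} {c : Chain X (j + 1)} (hc : c ∈ ucyc j) :
    map f (j + 1) c ∈ ucyc j := by
  cases j with
  | zero => trivial
  | succ j => rw [mem_ucyc_succ, bd_map, mem_ucyc_succ.mp hc, map_zero]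

theorem simp_zero_eq (σ τ : Simp X 0) : σ = τ := by
  refine ContinuousMap.ext fun t => ?_
  have := t.2.2
  simp at this

theorem map_zero_eq (f g : C(X, Y)) : map f 0 = map g 0 := by
  refine lhom_ext' fun v => LinearMap.ext_ring ?_
  simp only [LinearMap.comp_apply, lsingle_apply, map_single]
  rw [simp_zero_eq (f.comp v) (g.comp v)]

theorem prism_zero {f g : C(X, Y)} (h : f.Homotopy g) (c : Chain X 0) :
    prism h.toContinuousMap 0 c = 0 := by
  suffices h : prism h.toContinuousMap 0 = 0 from LinearMap.congr_fun h c
  refine lhom_ext' fun σ => LinearMap.ext_ring ?_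
  simp only [LinearMap.comp_apply, lsingle_apply, prism_single]
  exact map_zero _

/-- Homotopic maps agree on unaugmented cycles up to boundaries. -/
theorem map_add_map_mem_bdry_of_mem_ucyc {f g : C(X, Y)} (h : f.Homotopy g) {j : ℕ}
    {c : Chain X (j + 1)} (hc : c ∈ ucyc j) :
    map f (j + 1) c + map g (j + 1) c ∈ bdry Y (j + 1) := by
  refine ⟨prism h.toContinuousMap (j + 1) c, ?_⟩
  cases j with
  | zero => rw [bd_prism, prism_zero, add_zero]
  | succ j => rw [bd_prism, mem_ucyc_succ.mp hc, map_zero, add_zero]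

/-- Injectivity on homology. -/
def InjAt (f : C(X, Y)) (j : ℕ) : Prop :=
  ∀ c ∈ ucyc j, map f (j + 1) c ∈ bdry Y (j + 1) → c ∈ bdry X (j + 1)

/-- Surjectivity on homology. -/
def SurjAt (f : C(X, Y)) (j : ℕ) : Prop :=
  ∀ c ∈ ucyc (X := Y) j, ∃ z ∈ ucyc (X := X) j, c + map f (j + 1) z ∈ bdry Y (j + 1)

section Transfer

variable {f : C(X, Y)} {f' : C(X', Y')} {a : C(X, X')} {a' : C(X', X)} {b : C(Y, Y')}
  {b' : C(Y', Y)} {j : ℕ}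

theorem mem_bdry_of_htpy (ha : (ContinuousMap.id X).Homotopy (a'.comp a)) {c : Chain X (j + 1)}
    (hc : c ∈ ucyc j) (h : map a (j + 1) c ∈ bdry X' (j + 1)) : c ∈ bdry X (j + 1) := by
  have h1 := map_add_map_mem_bdry_of_mem_ucyc ha hc
  rw [map_id, map_comp] at h1
  exact (Submodule.add_mem_iff_left _ (map_mem_bdry _ h)).mp h1

/-- Only a one-sided homotopy inverse of the left vertical map is needed: it makes that map
injective on homology. -/
theorem InjAt.of_htpy (h : InjAt f' j) (hab : b.comp f = f'.comp a)
    (ha : (ContinuousMap.id X).Homotopy (a'.comp a)) : InjAt f j := by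
  intro c hc hfc
  refine mem_bdry_of_htpy ha hc (h _ (map_mem_ucyc a hc) ?_)
  rw [← map_comp, ← hab, map_comp]
  exact map_mem_bdry b hfc

/-- A cycle c of Y is homologous to its image under b' ∘ b. Solving for b c in the lower row and
returning along b' and a' solves for c. -/
theorem SurjAt.of_htpy (h : SurjAt f' j) (hab : b'.comp f' = f.comp a')
    (hb : (ContinuousMap.id Y).Homotopy (b'.comp b)) : SurjAt f j := by
  intro c hc
  obtain ⟨z, hz, hcz⟩ := h _ (map_mem_ucyc b hc)
  refine ⟨map a' _ z, map_mem_ucyc _ hz, ?_⟩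
  have h1 := map_mem_bdry b' hcz
  rw [map_add, ← map_comp, ← map_comp, hab, map_comp f a'] at h1
  have h2 := add_mem (map_add_map_mem_bdry_of_mem_ucyc hb hc) h1
  rwa [map_id, add_assoc, ← add_assoc (map _ _ c), ZModModule.add_self, zero_add] at h2

end Transfer

/-! ### Two copies of a space -/

/-- The inclusion of one of two copies of a space. -/
def inc (b : Bool) : C(X, Bool × X) := ⟨fun x => (b, x), by fun_prop⟩

/-- The map induced on two copies of a space. -/
def double (f : C(X, Y)) : C(Bool × X, Bool × Y) := (ContinuousMap.id Bool).prodMap f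

/-- A simplex is connected, so its label in `Bool` is constant and may be read off at the
barycenter. -/
theorem simp_eq_inc_comp {n : ℕ} (σ : Simp (Bool × X) (n + 1)) :
    σ = (inc (σ stdSimplex.barycenter).1).comp (ContinuousMap.snd.comp σ) := by
  refine ContinuousMap.ext fun t => Prod.ext ?_ rfl
  exact PreconnectedSpace.constant inferInstance (f := fun t => (σ t).1)
    (continuous_fst.comp σ.continuous)

/-- The part of a chain in one of two copies of a space. -/
def part (b : Bool) (n : ℕ) : Chain (Bool × X) (n + 1) →ₗ[ZMod 2] Chain X (n + 1) :=
  linearCombination (ZMod 2) fun σ =>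
    if (σ stdSimplex.barycenter).1 = b then single (ContinuousMap.snd.comp σ) 1 else 0

theorem part_map_inc (b b' : Bool) {n : ℕ} (c : Chain X (n + 1)) :
    part b n (map (inc b') (n + 1) c) = if b' = b then c else 0 := by
  suffices h : (part (X := X) b n).comp (map (inc b') (n + 1)) =
      if b' = b then LinearMap.id else 0 by
    have := LinearMap.congr_fun h c
    split_ifs at this ⊢ <;> exact this
  refine lhom_ext' fun σ => LinearMap.ext_ring ?_
  simp only [LinearMap.comp_apply, lsingle_apply, map_single, part, linearCombination_single,
    one_smul]
  change (if b' = b then _ else _) = _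
  split_ifs
  · rfl
  · rfl

theorem eq_sum_part {n : ℕ} (c : Chain (Bool × X) (n + 1)) :
    c = ∑ b, map (inc b) (n + 1) (part b n c) := by
  suffices h : LinearMap.id = ∑ b, (map (X := X) (inc b) (n + 1)).comp (part b n) by
    simpa using LinearMap.congr_fun h c
  refine lhom_ext' fun σ => LinearMap.ext_ring ?_
  simp only [LinearMap.comp_apply, lsingle_apply, LinearMap.sum_apply, LinearMap.id_apply]
  obtain ⟨b, τ, rfl⟩ : ∃ (b : Bool) (τ : Simp X (n + 1)), σ = (inc b).comp τ :=
    ⟨_, _, simp_eq_inc_comp σ⟩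
  rw [← map_single, Fintype.sum_eq_single b]
  · rw [part_map_inc, if_pos rfl]
  · intro b' hb'
    rw [part_map_inc, if_neg hb'.symm, map_zero]

theorem bd_part (b : Bool) {n : ℕ} (c : Chain (Bool × X) (n + 2)) :
    bd (part b (n + 1) c) = part b n (bd c) := by
  conv_rhs => rw [eq_sum_part c]
  simp only [map_sum, bd_map, part_map_inc]
  simp

theorem part_double (f : C(X, Y)) (b : Bool) {n : ℕ} (c : Chain (Bool × X) (n + 1)) :
    part b n (map (double f) (n + 1) c) = map f (n + 1) (part b n c) := by
  conv_lhs => rw [eq_sum_part c]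
  have h : ∀ b', (double f).comp (inc b') = (inc b').comp f := fun _ => rfl
  simp only [map_sum, ← map_comp, h]
  simp only [map_comp, part_map_inc]
  simp

theorem part_mem_ucyc (b : Bool) {j : ℕ} {c : Chain (Bool × X) (j + 1)} (hc : c ∈ ucyc j) :
    part b j c ∈ ucyc j := by
  cases j with
  | zero => trivial
  | succ j => rw [mem_ucyc_succ, bd_part, mem_ucyc_succ.mp hc, map_zero]

theorem mem_bdry_of_part {n : ℕ} {c : Chain (Bool × X) (n + 1)}
    (h : ∀ b, part b n c ∈ bdry X (n + 1)) : c ∈ bdry _ (n + 1) := by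
  rw [eq_sum_part c]
  exact Submodule.sum_mem _ fun b _ => map_mem_bdry _ (h b)

theorem part_mem_bdry (b : Bool) {n : ℕ} {c : Chain (Bool × X) (n + 1)}
    (h : c ∈ bdry _ (n + 1)) : part b n c ∈ bdry X (n + 1) := by
  obtain ⟨d, rfl⟩ := h
  exact ⟨_, bd_part b d⟩

theorem InjAt.double {f : C(X, Y)} {j : ℕ} (h : InjAt f j) : InjAt (ModTwo.double f) j := by
  intro c hc hfc
  refine mem_bdry_of_part fun b => h _ (part_mem_ucyc b hc) ?_
  rw [← part_double]
  exact part_mem_bdry b hfc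

theorem SurjAt.double {f : C(X, Y)} {j : ℕ} (h : SurjAt f j) : SurjAt (ModTwo.double f) j := by
  intro c hc
  choose z hz hcz using fun b => h _ (part_mem_ucyc b hc)
  refine ⟨∑ b, map (inc b) _ (z b), Submodule.sum_mem _ fun b _ => map_mem_ucyc _ (hz b), ?_⟩
  refine mem_bdry_of_part fun b => ?_
  have hz' : part b j (∑ b', map (inc b') (j + 1) (z b')) = z b := by
    simp only [map_sum, part_map_inc, Finset.sum_ite_eq', Finset.mem_univ, if_true]
  rw [map_add, part_double, hz']
  exact hcz b

end Unaugmented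

/-! ### Stability of the unaugmented homology of projective spaces -/

namespace Lines

variable {r : ℕ}

theorem pad_injective : Function.Injective (pad r) := by
  intro M N h
  refine Subtype.ext ?_
  funext i j
  have := congrFun (congrFun (congrArg Subtype.val h) i.castSucc) j.castSucc
  simpa [pad] using this

/-- A cycle whose image bounds has an image of augmentation zero, so by injectivity of `pad` it is
an augmented cycle and the augmented statement applies. -/
theorem injAt_pad {j : ℕ} (hj : j < r) : InjAt (pad r) j := fun _ _ h =>
  mem_bdry_of_map_pad (by omega) hj (mem_cyc_of_map_mem_cyc pad_injective (bdry_le_cyc _ h)) h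

theorem surjAt_pad {j : ℕ} (hj : j < r) : SurjAt (pad r) j := by
  intro c hc
  cases j with
  | zero =>
    obtain ⟨r, rfl⟩ := Nat.exists_eq_succ_of_ne_zero hj.ne'
    obtain ⟨x⟩ : Nonempty (Lines (r + 1)) := inferInstance
    -- In degree zero the augmentation of c must first be cancelled by a multiple of a point of the
    -- subspace.
    let d := map (ContinuousMap.const (Lines (r + 2)) x) 1 c
    have hd : c + map (pad (r + 1)) 1 d ∈ cyc 1 := by
      rw [mem_cyc_succ, map_add, bd_map, bd_map, ← map_comp,
        map_zero_eq ((pad (r + 1)).comp _) (ContinuousMap.id _), map_id, ZModModule.add_self]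
    obtain ⟨z, hz, h⟩ := exists_add_map_pad_mem_bdry_of_le hj hd
    exact ⟨d + z, trivial, by rwa [map_add, ← add_assoc]⟩
  | succ j =>
    obtain ⟨z, hz, h⟩ := exists_add_map_pad_mem_bdry_of_le hj hc
    exact ⟨z, hz, h⟩

/-- The bounds exclude degree zero, the only degree where augmented and unaugmented cycles differ.
-/
theorem ucyc_le_bdry {j : ℕ} (hr : 1 ≤ r) (hj : r ≤ j) : ucyc j ≤ bdry (Lines r) (j + 1) := by
  cases j with
  | zero => omega
  | succ j => exact cyc_le_bdry (by omega)

end Lines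

/-! ### Homology of complexes of modules -/

section Homology

universe u

variable {R : Type u} [Ring R] {S T : ShortComplex (ModuleCat.{u} R)}

theorem homologyι_homologyπ (x : S.cycles) :
    S.homologyι (S.homologyπ x) = S.pOpcycles (S.iCycles x) :=
  ConcreteCategory.congr_hom S.homology_π_ι x

theorem homologyπ_surjective : Function.Surjective S.homologyπ :=
  (ModuleCat.epi_iff_surjective _).mp inferInstance

theorem homologyι_injective : Function.Injective S.homologyι :=
  (ModuleCat.mono_iff_injective _).mp inferInstance

theorem g_iCycles (x : S.cycles) : S.g (S.iCycles x) = 0 :=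
  ConcreteCategory.congr_hom S.iCycles_g x

theorem exists_iCycles_eq {x : S.X₂} (hx : S.g x = 0) : ∃ z : S.cycles, S.iCycles z = x := by
  refine ⟨S.moduleCatCyclesIso.inv ⟨x, hx⟩, ?_⟩
  exact ConcreteCategory.congr_hom S.moduleCatCyclesIso_inv_iCycles _

/-- Homology embeds in chains modulo boundaries, so induced maps can be tested on representing
cycles. -/
theorem homologyι_homologyMap (φ : S ⟶ T) (x : S.cycles) :
    T.homologyι (ShortComplex.homologyMap φ (S.homologyπ x)) = T.pOpcycles (φ.τ₂ (S.iCycles x)) := by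
  have h1 := ConcreteCategory.congr_hom (ShortComplex.homologyπ_naturality φ) x
  have h2 := ConcreteCategory.congr_hom (ShortComplex.cyclesMap_i φ) x
  simp only [ConcreteCategory.comp_apply] at h1 h2
  rw [h1, homologyι_homologyπ, h2]

theorem isIso_homologyMap (φ : S ⟶ T)
    (hinj : ∀ x : S.X₂, S.g x = 0 → φ.τ₂ x ∈ LinearMap.range T.f.hom → x ∈ LinearMap.range S.f.hom)
    (hsurj : ∀ y : T.X₂, T.g y = 0 → ∃ x : S.X₂, S.g x = 0 ∧ y - φ.τ₂ x ∈ LinearMap.range T.f.hom) :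
    IsIso (ShortComplex.homologyMap φ) := by
  rw [ConcreteCategory.isIso_iff_bijective]
  constructor
  · refine (injective_iff_map_eq_zero (ShortComplex.homologyMap φ).hom).mpr fun h hh => ?_
    obtain ⟨x, rfl⟩ := homologyπ_surjective h
    refine homologyι_injective ?_
    have h1 := homologyι_homologyMap φ x
    erw [hh, map_zero] at h1
    rw [homologyι_homologyπ, map_zero, ShortComplex.moduleCat_pOpcycles_eq_zero_iff]
    exact hinj _ (g_iCycles x) ((ShortComplex.moduleCat_pOpcycles_eq_zero_iff _ _).mp h1.symm)
  · intro h
    obtain ⟨y, rfl⟩ := homologyπ_surjective h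
    obtain ⟨x, hx, hxy⟩ := hsurj _ (g_iCycles y)
    obtain ⟨z, rfl⟩ := exists_iCycles_eq hx
    refine ⟨S.homologyπ z, homologyι_injective ?_⟩
    rw [homologyι_homologyMap, homologyι_homologyπ, eq_comm, ← sub_eq_zero, ← map_sub]
    exact (ShortComplex.moduleCat_pOpcycles_eq_zero_iff _ _).mpr hxy

theorem homologyMap_eq_zero (φ : S ⟶ T)
    (h : ∀ x : S.X₂, S.g x = 0 → x ∈ LinearMap.range S.f.hom) :
    ShortComplex.homologyMap φ = 0 := by
  have hS : S.Exact := S.moduleCat_exact_iff.mpr fun x hx => h x hx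
  exact ((ShortComplex.exact_iff_isZero_homology S).mp hS).eq_of_src _ _

end Homology

/-! ### Universal coefficients over a field -/

section Dual

variable (k : Type) [Field k]

/-- The duality functor. -/
abbrev dualFunctor : (ModuleCat.{0} k)ᵒᵖ ⥤ ModuleCat.{0} k :=
  (linearYoneda k (ModuleCat.{0} k)).obj (ModuleCat.of k k)

/-- Over a field, a functional that vanishes on the kernel of a linear map factors through that map;
hence dualizing is exact. -/
instance : (dualFunctor k).PreservesHomology := by
  refine Functor.preservesHomology_of_map_exact _ fun S hS => ?_
  have hS' : S.unop.Exact := hS.unop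
  rw [ShortComplex.moduleCat_exact_iff] at hS' ⊢
  intro (φ : S.X₂.unop ⟶ ModuleCat.of k k) (hφ : S.g.unop ≫ φ = 0)
  have hle : LinearMap.ker S.f.unop.hom ≤ LinearMap.ker φ.hom := by
    intro x hx
    obtain ⟨y, rfl⟩ := hS' x hx
    exact ConcreteCategory.congr_hom hφ y
  have hφ' : φ.hom ∈ LinearMap.range (LinearMap.dualMap S.f.unop.hom) := by
    rw [LinearMap.range_dualMap_eq_dualAnnihilator_ker, Submodule.mem_dualAnnihilator]
    exact fun x hx => hle hx
  obtain ⟨ψ, hψ⟩ := hφ'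
  exact ⟨ModuleCat.ofHom ψ, ModuleCat.hom_ext hψ⟩

variable {k} {K L : ChainComplex (ModuleCat.{0} k) ℕ}

/-- The map induced by a chain map on dual complexes. -/
abbrev dualMap (φ : K ⟶ L) :
    (((dualFunctor k).mapHomologicalComplex (ComplexShape.up ℕ)).obj
      ((HomologicalComplex.opFunctor _ (ComplexShape.down ℕ)).obj (Opposite.op L))) ⟶
    (((dualFunctor k).mapHomologicalComplex (ComplexShape.up ℕ)).obj
      ((HomologicalComplex.opFunctor _ (ComplexShape.down ℕ)).obj (Opposite.op K))) :=
  ((dualFunctor k).mapHomologicalComplex (ComplexShape.up ℕ)).map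
    ((HomologicalComplex.opFunctor _ (ComplexShape.down ℕ)).map φ.op)

/-- The homology of the dual complex is dual to homology. -/
def dualHomologyIso (K : ChainComplex (ModuleCat.{0} k) ℕ) (j : ℕ) :
    (((dualFunctor k).mapHomologicalComplex (ComplexShape.up ℕ)).obj
      ((HomologicalComplex.opFunctor _ (ComplexShape.down ℕ)).obj (Opposite.op K))).homology j ≅
    (dualFunctor k).obj (Opposite.op (K.homology j)) :=
  ShortComplex.mapHomologyIso
    (((HomologicalComplex.opFunctor _ (ComplexShape.down ℕ)).obj (Opposite.op K)).sc j)
    (dualFunctor k) ≪≫ (dualFunctor k).mapIso (K.homologyOp j)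

theorem comp_trans_hom {C : Type*} [Category C] {X X' Y Y' Z Z' : C} {f : X' ⟶ X} {g : Y' ⟶ Y}
    {h : Z' ⟶ Z} {a : X ≅ Y} {a' : X' ≅ Y'} {b : Y ≅ Z} {b' : Y' ≅ Z'}
    (h₁ : f ≫ a.hom = a'.hom ≫ g) (h₂ : g ≫ b.hom = b'.hom ≫ h) :
    f ≫ (a ≪≫ b).hom = (a' ≪≫ b').hom ≫ h := by
  rw [Iso.trans_hom, Iso.trans_hom, Category.assoc, ← h₂, reassoc_of% h₁]

theorem map_comp_mapIso_hom {C D : Type*} [Category C] [Category D] (F : C ⥤ D) {X X' Y Y' : C}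
    {f : X' ⟶ X} {g : Y' ⟶ Y} {a : X ≅ Y} {a' : X' ≅ Y'} (h : f ≫ a.hom = a'.hom ≫ g) :
    F.map f ≫ (F.mapIso a).hom = (F.mapIso a').hom ≫ F.map g := by
  rw [Functor.mapIso_hom, Functor.mapIso_hom, ← F.map_comp, h, F.map_comp]

theorem dualHomologyIso_naturality (φ : K ⟶ L) (j : ℕ) :
    HomologicalComplex.homologyMap (dualMap φ) j ≫ (dualHomologyIso K j).hom =
      (dualHomologyIso L j).hom ≫
        (dualFunctor k).map (HomologicalComplex.homologyMap φ j).op := by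
  have h1 := HomologicalComplex.homologyOp_hom_naturality φ j
  have h2 : HomologicalComplex.homologyMap (dualMap φ) j ≫ (ShortComplex.mapHomologyIso
      (((HomologicalComplex.opFunctor _ (ComplexShape.down ℕ)).obj (Opposite.op K)).sc j)
      (dualFunctor k)).hom = (ShortComplex.mapHomologyIso
      (((HomologicalComplex.opFunctor _ (ComplexShape.down ℕ)).obj (Opposite.op L)).sc j)
      (dualFunctor k)).hom ≫ (dualFunctor k).map (HomologicalComplex.homologyMap
        ((HomologicalComplex.opFunctor _ (ComplexShape.down ℕ)).map φ.op) j) :=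
    ShortComplex.mapHomologyIso_hom_naturality
    ((HomologicalComplex.shortComplexFunctor _ _ j).map
      ((HomologicalComplex.opFunctor (ModuleCat.{0} k) (ComplexShape.down ℕ)).map φ.op))
    (dualFunctor k)
  have h3 := map_comp_mapIso_hom (dualFunctor k) h1
  exact comp_trans_hom (b := (dualFunctor k).mapIso (K.homologyOp j))
    (b' := (dualFunctor k).mapIso (L.homologyOp j)) h2 h3

theorem isIso_homologyMap_dualMap (φ : K ⟶ L) (j : ℕ)
    [IsIso (HomologicalComplex.homologyMap φ j)] :
    IsIso (HomologicalComplex.homologyMap (dualMap φ) j) := by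
  have h := dualHomologyIso_naturality φ j
  rw [← Iso.eq_comp_inv] at h
  rw [h]
  infer_instance

theorem homologyMap_dualMap_eq_zero (φ : K ⟶ L) (j : ℕ)
    (hφ : HomologicalComplex.homologyMap φ j = 0) :
    HomologicalComplex.homologyMap (dualMap φ) j = 0 := by
  have h := dualHomologyIso_naturality φ j
  rw [← Iso.eq_comp_inv, hφ] at h
  rw [h]
  have h0 : (dualFunctor k).map (Quiver.Hom.op (0 : K.homology j ⟶ L.homology j)) = 0 :=
    (dualFunctor k).map_zero _ _
  rw [h0, Limits.comp_zero, Limits.zero_comp]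

end Dual

/-! ### Comparison with singular homology -/

section Comparison

variable (X Y : TopCat.{0})

/-- The singular chain complex modulo two. -/
abbrev singComplex : ChainComplex (ModuleCat.{0} (ZMod 2)) ℕ :=
  (TopCat.toSSet.obj X).chainComplex (ModuleCat.of (ZMod 2) (ZMod 2))

/-- The map induced on singular chain complexes. -/
abbrev singMap {X Y : TopCat.{0}} (f : X ⟶ Y) : singComplex X ⟶ singComplex Y :=
  SSet.chainComplexMap (TopCat.toSSet.map f) (ModuleCat.of (ZMod 2) (ZMod 2))

open Simplicial in
/-- The basis element of the singular chain complex given by a simplex. -/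
def basisElt {j : ℕ} (σ : Simp X (j + 1)) : (singComplex X).X j :=
  ((TopCat.toSSet.obj X).ιChainComplex (R := ModuleCat.of (ZMod 2) (ZMod 2))
    ((TopCat.toSSetObjEquiv X (Opposite.op ⦋j⦌)).symm σ)).hom (1 : ZMod 2)

/-- The comparison of singular chains. -/
def toSing (j : ℕ) : Chain X (j + 1) →ₗ[ZMod 2] (singComplex X).X j :=
  linearCombination (ZMod 2) (basisElt X)

theorem toSing_single {j : ℕ} (σ : Simp X (j + 1)) : toSing X j (single σ 1) = basisElt X σ := by
  simp [toSing]

open Simplicial in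
/-- The inverse of the comparison of singular chains. -/
def ofSing (j : ℕ) : (singComplex X).X j ⟶ ModuleCat.of (ZMod 2) (Chain X (j + 1)) :=
  Limits.Sigma.desc fun (x : (TopCat.toSSet.obj X) _⦋j⦌) =>
    ModuleCat.ofHom (lsingle (TopCat.toSSetObjEquiv X (Opposite.op ⦋j⦌) x))

open Simplicial in
theorem ι_ofSing {j : ℕ} (x : (TopCat.toSSet.obj X) _⦋j⦌) :
    (TopCat.toSSet.obj X).ιChainComplex x ≫ ofSing X j =
      ModuleCat.ofHom (lsingle (TopCat.toSSetObjEquiv X (Opposite.op ⦋j⦌) x)) :=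
  Limits.Sigma.ι_desc _ _

theorem ofSing_toSing {j : ℕ} (c : Chain X (j + 1)) : ofSing X j (toSing X j c) = c := by
  suffices h : (ofSing X j).hom.comp (toSing X j) = LinearMap.id from LinearMap.congr_fun h c
  refine lhom_ext' fun σ => LinearMap.ext_ring ?_
  simp only [LinearMap.comp_apply, lsingle_apply, toSing_single, LinearMap.id_apply]
  refine (ConcreteCategory.congr_hom (ι_ofSing X _) (1 : ZMod 2)).trans ?_
  simp

theorem toSing_ofSing {j : ℕ} (c : (singComplex X).X j) : toSing X j (ofSing X j c) = c := by
  suffices h : ofSing X j ≫ ModuleCat.ofHom (toSing X j) = 𝟙 _ from ConcreteCategory.congr_hom h c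
  refine SSet.chainComplex_hom_ext fun x => ?_
  rw [← Category.assoc, ι_ofSing]
  refine ModuleCat.hom_ext (LinearMap.ext_ring ?_)
  simp [toSing, basisElt]

theorem toSing_surjective (j : ℕ) : Function.Surjective (toSing X j) :=
  fun c => ⟨_, toSing_ofSing X c⟩

theorem toSing_injective (j : ℕ) : Function.Injective (toSing X j) :=
  fun c d h => by rw [← ofSing_toSing X c, h, ofSing_toSing]

theorem neg_one_pow_smul {M : Type*} [AddCommGroup M] [Module (ZMod 2) M] (n : ℕ) (x : M) :
    (-1 : ℤ) ^ n • x = x := by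
  rcases neg_one_pow_eq_or ℤ n with h | h <;> simp [h, ZModModule.neg_eq_self]

open Simplicial in
-- The signs of the alternating sum disappear modulo two. The degree shifts because simplices are
-- here counted by vertices.
theorem d_toSing {j : ℕ} (c : Chain X (j + 2)) :
    (singComplex X).d (j + 1) j (toSing X (j + 1) c) = toSing X j (bd c) := by
  suffices h : ((singComplex X).d (j + 1) j).hom.comp (toSing X (j + 1)) = (toSing X j).comp bd from
    LinearMap.congr_fun h c
  refine lhom_ext' fun σ => LinearMap.ext_ring ?_
  simp only [LinearMap.comp_apply, lsingle_apply, toSing_single, bd_single, map_sum]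
  have h := (TopCat.toSSet.obj X).ιChainComplex_d (R := ModuleCat.of (ZMod 2) (ZMod 2))
    ((TopCat.toSSetObjEquiv X (Opposite.op ⦋j + 1⦌)).symm σ)
  have h' := LinearMap.congr_fun (congrArg ModuleCat.Hom.hom h) (1 : ZMod 2)
  rw [ModuleCat.hom_sum] at h'
  refine h'.trans ?_
  refine (LinearMap.sum_apply _ _ _).trans (Finset.sum_congr rfl fun i _ => ?_)
  rw [ModuleCat.hom_zsmul]
  refine (LinearMap.smul_apply _ _ _).trans ((neg_one_pow_smul i.1 _).trans ?_)
  rfl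

open Simplicial in
theorem singMap_toSing {X Y : TopCat.{0}} (f : X ⟶ Y) {j : ℕ} (c : Chain X (j + 1)) :
    (singMap f).f j (toSing X j c) = toSing Y j (map f.hom (j + 1) c) := by
  suffices h : ((singMap f).f j).hom.comp (toSing X j) = (toSing Y j).comp (map f.hom (j + 1)) from
    LinearMap.congr_fun h c
  refine lhom_ext' fun σ => LinearMap.ext_ring ?_
  simp only [LinearMap.comp_apply, lsingle_apply, toSing_single, map_single]
  have h := SSet.ι_chainComplexMap_f _ _ (TopCat.toSSet.map f) (ModuleCat.of (ZMod 2) (ZMod 2))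
    ((TopCat.toSSetObjEquiv X (Opposite.op ⦋j⦌)).symm σ)
  exact ConcreteCategory.congr_hom h (1 : ZMod 2)

variable {X Y}

theorem toSing_mem_range_iff {j : ℕ} {c : Chain X (j + 1)} :
    toSing X j c ∈ LinearMap.range ((singComplex X).sc j).f.hom ↔ c ∈ bdry X (j + 1) := by
  -- The source of the incoming differential is indexed by `prev j`; quantifying over the index
  -- allows it to be replaced by `j + 1`.
  have h : ∀ i, (ComplexShape.down ℕ).prev j = i →
      (toSing X j c ∈ LinearMap.range ((singComplex X).sc j).f.hom ↔
        ∃ y, (singComplex X).d i j y = toSing X j c) := by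
    rintro _ rfl
    rfl
  rw [h (j + 1) (ChainComplex.prev ℕ j)]
  constructor
  · rintro ⟨y, hy⟩
    obtain ⟨d, rfl⟩ := toSing_surjective X _ y
    rw [d_toSing] at hy
    exact ⟨d, toSing_injective X j hy⟩
  · rintro ⟨d, rfl⟩
    exact ⟨toSing X _ d, d_toSing X d⟩

theorem toSing_g_eq_zero_iff {j : ℕ} {c : Chain X (j + 1)} :
    ((singComplex X).sc j).g (toSing X j c) = 0 ↔ c ∈ ucyc j := by
  have h : ∀ i, (ComplexShape.down ℕ).next j = i →
      (((singComplex X).sc j).g (toSing X j c) = 0 ↔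
        (singComplex X).d j i (toSing X j c) = 0) := by
    rintro _ rfl
    rfl
  cases j with
  | zero =>
    -- By convention the successor of degree zero is zero itself, with zero differential, which
    -- matches `ucyc 0 = ⊤`.
    rw [h 0 ChainComplex.next_nat_zero, (singComplex X).shape 0 0 (by simp)]
    exact iff_of_true rfl trivial
  | succ j =>
    rw [h j (ChainComplex.next_nat_succ j), d_toSing, mem_ucyc_succ]
    exact ⟨fun h => toSing_injective X j (h.trans (map_zero _).symm), fun h => by rw [h, map_zero]⟩

theorem isIso_homologyMap_singMap (f : X ⟶ Y) (j : ℕ) (hinj : InjAt f.hom j)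
    (hsurj : SurjAt f.hom j) : IsIso (HomologicalComplex.homologyMap (singMap f) j) := by
  refine isIso_homologyMap ((HomologicalComplex.shortComplexFunctor _ _ j).map (singMap f))
    (fun x hx hfx => ?_) fun y hy => ?_
  · obtain ⟨c, rfl⟩ := toSing_surjective X j x
    have hc := toSing_g_eq_zero_iff.mp hx
    refine toSing_mem_range_iff.mpr (hinj c hc (toSing_mem_range_iff.mp ?_))
    rw [← singMap_toSing]
    exact hfx
  · obtain ⟨c, rfl⟩ := toSing_surjective Y j y
    obtain ⟨z, hz, hcz⟩ := hsurj c (toSing_g_eq_zero_iff.mp hy)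
    refine ⟨toSing X j z, toSing_g_eq_zero_iff.mpr hz, ?_⟩
    have h := toSing_mem_range_iff.mpr hcz
    rw [map_add, ← singMap_toSing, ← ZModModule.sub_eq_add] at h
    exact h

theorem homologyMap_singMap_eq_zero (f : X ⟶ Y) (j : ℕ) (h : ucyc j ≤ bdry X (j + 1)) :
    HomologicalComplex.homologyMap (singMap f) j = 0 := by
  refine homologyMap_eq_zero ((HomologicalComplex.shortComplexFunctor _ _ j).map (singMap f))
    fun x hx => ?_
  obtain ⟨c, rfl⟩ := toSing_surjective X j x
  exact toSing_mem_range_iff.mpr (h (toSing_g_eq_zero_iff.mp hx))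

/-- A map inducing a bijection on homology induces an isomorphism on cohomology. -/
theorem isIso_singularCohomology_map (f : X ⟶ Y) (j : ℕ) (hinj : InjAt f.hom j)
    (hsurj : SurjAt f.hom j) : IsIso ((EtaleGen.singularCohomology (ZMod 2) j).map f.op) := by
  have := isIso_homologyMap_singMap f j hinj hsurj
  exact isIso_homologyMap_dualMap (k := ZMod 2) (singMap f) j

/-- A map whose source has no homology in some degree is zero on cohomology. -/
theorem singularCohomology_map_eq_zero (f : X ⟶ Y) (j : ℕ) (h : ucyc j ≤ bdry X (j + 1)) :
    (EtaleGen.singularCohomology (ZMod 2) j).map f.op = 0 :=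
  homologyMap_dualMap_eq_zero (k := ZMod 2) (singMap f) j (homologyMap_singMap_eq_zero f j h)

end Comparison

/-! ### Complex points of open subschemes of affine schemes -/

open EtaleGen

section AffinePoints

variable {A : CommRingCat.{0}}

theorem mem_of_specMap (φ : A ⟶ .of ℂ) (W : (Spec A).Opens) (x : Spec (.of ℂ))
    (hx : Spec.map φ x ∈ W) : ⊤ ≤ Spec.map φ ⁻¹ᵁ W := by
  intro y _
  have : Subsingleton (PrimeSpectrum ℂ) := inferInstance
  have hxy : y = x := this.elim _ _
  rw [hxy]
  exact hx

theorem le_basicOpen_iff (φ : A ⟶ .of ℂ) (a : A) :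
    ⊤ ≤ Spec.map φ ⁻¹ᵁ (PrimeSpectrum.basicOpen a : (Spec A).Opens) ↔ φ.hom a ≠ 0 := by
  constructor
  · intro h h0
    have h1 : φ.hom a ∉ (⊥ : PrimeSpectrum ℂ).asIdeal := h (x := (⊥ : PrimeSpectrum ℂ)) trivial
    exact h1 (h0 ▸ zero_mem _)
  · intro h
    refine mem_of_specMap φ _ (⊥ : PrimeSpectrum ℂ) ?_
    change φ.hom a ∉ (⊥ : PrimeSpectrum ℂ).asIdeal
    exact h

/-- The value of a section on `W` at a complex point of an affine scheme lying in `W`. -/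
def evalSpec (φ : A ⟶ .of ℂ) (W : (Spec A).Opens) (h : ⊤ ≤ Spec.map φ ⁻¹ᵁ W) :
    Γ(Spec A, W) →+* ℂ :=
  ((Spec.map φ).appLE W ⊤ h ≫ (Scheme.ΓSpecIso (.of ℂ)).hom).hom

theorem evalSpec_map (φ : A ⟶ .of ℂ) (W W' : (Spec A).Opens) (hW : W' ≤ W)
    (h : ⊤ ≤ Spec.map φ ⁻¹ᵁ W') (f : Γ(Spec A, W)) :
    evalSpec φ W' h ((Spec A).presheaf.map (homOfLE hW).op f) =
      evalSpec φ W (h.trans (fun _ hx => hW hx)) f := by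
  unfold evalSpec
  rw [← Scheme.Hom.map_appLE (Spec.map φ) h (homOfLE hW).op]
  rfl

theorem evalSpec_algebraMap (φ : A ⟶ .of ℂ) (W : (Spec A).Opens)
    (h : ⊤ ≤ Spec.map φ ⁻¹ᵁ W) (a : A) :
    evalSpec φ W h (algebraMap A Γ(Spec A, W) a) = φ.hom a := by
  rw [IsAffineOpen.algebraMap_Spec_obj]
  have h1 := evalSpec_map φ ⊤ W le_top h ((Scheme.ΓSpecIso A).inv a)
  refine h1.trans ?_
  have h2 : (Scheme.ΓSpecIso A).inv ≫ (Spec.map φ).appLE ⊤ ⊤ le_top ≫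
      (Scheme.ΓSpecIso (.of ℂ)).hom = φ := by
    rw [Iso.inv_comp_eq, ← Scheme.ΓSpecIso_naturality φ, Scheme.Hom.appTop,
      Scheme.Hom.app_eq_appLE]
    rfl
  exact congrArg (fun ψ => CommRingCat.Hom.hom ψ a) h2

theorem exists_evalSpec_eq (W : (Spec A).Opens) (a : A) :
    ∃ f : Γ(Spec A, W), ∀ (φ : A ⟶ .of ℂ) (h : ⊤ ≤ Spec.map φ ⁻¹ᵁ W),
      evalSpec φ W h f = φ.hom a :=
  ⟨algebraMap A Γ(Spec A, W) a, fun φ h => evalSpec_algebraMap φ W h a⟩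

/-- Near the image of a given point a section restricts to a basic open set, where it is a fraction
b / aⁿ; the same fraction computes its value at every complex point with a nonzero value of a. -/
theorem exists_evalSpec_eq_div (φ₀ : A ⟶ .of ℂ) (W : (Spec A).Opens)
    (h₀ : ⊤ ≤ Spec.map φ₀ ⁻¹ᵁ W) (f : Γ(Spec A, W)) :
    ∃ (a b : A) (n : ℕ), φ₀.hom a ≠ 0 ∧ ∀ φ : A ⟶ .of ℂ, φ.hom a ≠ 0 →
      ∃ h : ⊤ ≤ Spec.map φ ⁻¹ᵁ W, evalSpec φ W h f = φ.hom b / φ.hom a ^ n := by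
  have hx : Spec.map φ₀ (⊥ : PrimeSpectrum ℂ) ∈ W := h₀ (x := (⊥ : PrimeSpectrum ℂ)) trivial
  obtain ⟨_, ⟨_, ⟨a, rfl⟩, rfl⟩, ha, haW⟩ :=
    PrimeSpectrum.isBasis_basic_opens.exists_subset_of_mem_open hx W.isOpen
  obtain ⟨D, hD⟩ : ∃ D : (Spec A).Opens, D = PrimeSpectrum.basicOpen a := ⟨_, rfl⟩
  have hle : D ≤ W := hD ▸ haW
  have hφD (φ : A ⟶ .of ℂ) : ⊤ ≤ Spec.map φ ⁻¹ᵁ D ↔ φ.hom a ≠ 0 := hD ▸ le_basicOpen_iff φ a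
  have hloc : IsLocalization.Away a Γ(Spec A, D) := by
    subst hD
    exact StructureSheaf.IsLocalization.to_basicOpen A a
  obtain ⟨n, b, hb⟩ := IsLocalization.Away.surj a ((Spec A).presheaf.map (homOfLE hle).op f)
  refine ⟨a, b, n, (hφD φ₀).1 (mem_of_specMap φ₀ _ _ (hD ▸ ha)), fun φ hφ => ?_⟩
  have h := (hφD φ).2 hφ
  refine ⟨h.trans fun _ hx => hle hx, ?_⟩
  rw [← evalSpec_map φ W _ hle h, eq_div_iff (pow_ne_zero n hφ),
    ← evalSpec_algebraMap φ _ h b, ← hb, map_mul, map_pow, evalSpec_algebraMap]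

end AffinePoints

/-! ### Complex points as algebra homomorphisms, with the analytic topology -/

section OpenInAffine

variable {A : Type} [CommRing A] [Algebra ℝ A] (O : (Spec (.of A)).Opens)

/-- An open subscheme of an affine scheme over `ℝ`. -/
abbrev overOpen : Over (Spec (.of ℝ)) :=
  Over.mk (O.ι ≫ Spec.map (CommRingCat.ofHom (algebraMap ℝ A)))

variable {O}

/-- The morphism of rings given by a complex point. -/
def ringMor (p : ComplexPoints (overOpen O)) : CommRingCat.of A ⟶ .of ℂ :=
  Spec.preimage (p.left ≫ O.ι)

theorem specMap_ringMor (p : ComplexPoints (overOpen O)) :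
    Spec.map (ringMor p) = p.left ≫ O.ι :=
  Spec.map_preimage _

theorem ringMor_eq {p : ComplexPoints (overOpen O)} {φ : CommRingCat.of A ⟶ .of ℂ}
    (h : Spec.map φ = p.left ≫ O.ι) : ringMor p = φ :=
  Spec.map_injective ((specMap_ringMor p).trans h.symm)

theorem ofHom_algebraMap_comp_ringMor (p : ComplexPoints (overOpen O)) :
    CommRingCat.ofHom (algebraMap ℝ A) ≫ ringMor p = CommRingCat.ofHom (algebraMap ℝ ℂ) := by
  apply Spec.map_injective
  rw [Spec.map_comp, specMap_ringMor, Category.assoc]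
  exact Over.w p

/-- The values of regular functions at a complex point. -/
def toHom (p : ComplexPoints (overOpen O)) : A →ₐ[ℝ] ℂ where
  __ := (ringMor p).hom
  commutes' x := congrArg (fun ψ => CommRingCat.Hom.hom ψ x) (ofHom_algebraMap_comp_ringMor p)

theorem specMap_toHom (p : ComplexPoints (overOpen O)) :
    Spec.map (CommRingCat.ofHom (toHom p).toRingHom) = p.left ≫ O.ι :=
  specMap_ringMor p

theorem toHom_eq {p : ComplexPoints (overOpen O)} {φ : A →ₐ[ℝ] ℂ}
    (h : Spec.map (CommRingCat.ofHom φ.toRingHom) = p.left ≫ O.ι) : toHom p = φ := by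
  have := ringMor_eq h
  ext a
  exact congrArg (fun ψ => CommRingCat.Hom.hom ψ a) this

theorem toHom_injective : Function.Injective (toHom (O := O)) := by
  intro p q h
  apply Over.OverMorphism.ext
  rw [← cancel_mono O.ι]
  have h1 := specMap_toHom p
  rw [h, specMap_toHom q] at h1
  exact h1.symm

theorem specMap_toHom_mem (p : ComplexPoints (overOpen O)) (x : Spec (.of ℂ)) :
    Spec.map (CommRingCat.ofHom (toHom p).toRingHom) x ∈ O := by
  rw [specMap_toHom]
  exact (p.left x).2

theorem exists_toHom_eq (φ : A →ₐ[ℝ] ℂ)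
    (h : ∀ x, Spec.map (CommRingCat.ofHom φ.toRingHom) x ∈ O) :
    ∃ p : ComplexPoints (overOpen O), toHom p = φ := by
  have hr : Set.range (Spec.map (CommRingCat.ofHom φ.toRingHom)) ⊆ Set.range O.ι := by
    rw [Scheme.Opens.range_ι]
    rintro _ ⟨x, rfl⟩
    exact h x
  refine ⟨Over.homMk (IsOpenImmersion.lift O.ι _ hr) ?_, ?_⟩
  · change IsOpenImmersion.lift O.ι _ hr ≫ O.ι ≫ _ = Spec.map (CommRingCat.ofHom (algebraMap ℝ ℂ))
    rw [IsOpenImmersion.lift_fac_assoc, ← Spec.map_comp, ← CommRingCat.ofHom_comp]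
    congr 2
    exact φ.comp_algebraMap
  · exact toHom_eq (IsOpenImmersion.lift_fac O.ι _ hr).symm

theorem toHom_conj (p : ComplexPoints (overOpen O)) (a : A) :
    toHom p.conj a = starRingEnd ℂ (toHom p a) := by
  have h : toHom p.conj = (Complex.conjAe : ℂ →ₐ[ℝ] ℂ).comp (toHom p) := by
    refine toHom_eq ?_
    change _ = (Spec.map (CommRingCat.ofHom (starRingEnd ℂ)) ≫ p.left) ≫ O.ι
    rw [Category.assoc, ← specMap_toHom, ← Spec.map_comp]
    rfl
  rw [h]
  rfl

theorem conj_eq_self_iff (p : ComplexPoints (overOpen O)) :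
    p.conj = p ↔ ∀ a, (toHom p a).im = 0 := by
  rw [← toHom_injective.eq_iff, AlgHom.ext_iff]
  exact forall_congr' fun a => by rw [toHom_conj, Complex.conj_eq_iff_im]

theorem toHom_map {A' : Type} [CommRing A'] [Algebra ℝ A'] {O' : (Spec (.of A')).Opens}
    (s : A' →ₐ[ℝ] A) (f : overOpen O ⟶ overOpen O')
    (h : f.left ≫ O'.ι = O.ι ≫ Spec.map (CommRingCat.ofHom s.toRingHom))
    (p : ComplexPoints (overOpen O)) :
    toHom (ComplexPoints.map f p) = (toHom p).comp s := by
  refine toHom_eq ?_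
  change _ = (p.left ≫ f.left) ≫ O'.ι
  rw [Category.assoc, h, ← Category.assoc, ← specMap_toHom, ← Spec.map_comp]
  rfl

theorem inOpen_iff (p : ComplexPoints (overOpen O)) (V : O.toScheme.Opens) :
    p.InOpen V ↔ ⊤ ≤ Spec.map (ringMor p) ⁻¹ᵁ (O.ι ''ᵁ V) := by
  rw [specMap_ringMor, Scheme.Hom.comp_preimage, Scheme.Hom.preimage_image_eq]

theorem eval_eq (p : ComplexPoints (overOpen O)) (V : O.toScheme.Opens) (h : p.InOpen V)
    (f : Γ(O.toScheme, V)) :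
    p.eval V h f = evalSpec (ringMor p) (O.ι ''ᵁ V) ((inOpen_iff p V).1 h) f := by
  -- The type of `appLE` depends on the morphism, so the equality of morphisms is substituted for a
  -- variable ψ.
  have key (ψ : Spec (.of ℂ) ⟶ Spec (.of A)) (hψ : p.left ≫ O.ι = ψ)
      (h' : ⊤ ≤ ψ ⁻¹ᵁ (O.ι ''ᵁ V)) :
      p.left.appLE V ⊤ h = ψ.appLE (O.ι ''ᵁ V) ⊤ h' := by
    subst hψ
    rw [← Scheme.Hom.appLE_comp_appLE p.left O.ι (O.ι ''ᵁ V) V ⊤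
      (Scheme.Hom.preimage_image_eq _ _).ge h, Scheme.Opens.ι_appLE]
    exact (congrArg (· ≫ p.left.appLE V ⊤ h)
      ((Spec (.of A)).presheaf.map_id (Opposite.op (O.ι ''ᵁ V)))).trans (Category.id_comp _) |>.symm
  unfold ComplexPoints.eval evalSpec
  rw [key _ (specMap_ringMor p).symm ((inOpen_iff p V).1 h)]
  rfl

theorem continuous_toHom (a : A) :
    Continuous fun p : ComplexPoints (overOpen O) => toHom p a := by
  obtain ⟨f, hf⟩ := exists_evalSpec_eq (A := .of A) (O.ι ''ᵁ ⊤) a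
  refine continuous_def.2 fun W hW => ?_
  refine TopologicalSpace.isOpen_generateFrom_of_mem ⟨⊤, f, W, hW, ?_⟩
  ext p
  have h : p.InOpen ⊤ := le_top
  have h1 : p.eval ⊤ h f = toHom p a := (eval_eq p ⊤ h f).trans (hf (ringMor p) _)
  change toHom p a ∈ W ↔ ∃ _ : p.InOpen ⊤, p.eval ⊤ h f ∈ W
  rw [h1]
  exact ⟨fun hp => ⟨h, hp⟩, fun ⟨_, hp⟩ => hp⟩

/-- Every section is locally a fraction of global functions, and the condition that its denominator
be nonzero is open. Global functions thus determine the analytic topology. -/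
theorem continuous_of_toHom {Z : Type*} [TopologicalSpace Z] (F : Z → ComplexPoints (overOpen O))
    (hF : ∀ a, Continuous fun z => toHom (F z) a) : Continuous F := by
  refine continuous_generateFrom_iff.mpr ?_
  rintro _ ⟨V, f, W, hW, rfl⟩
  rw [isOpen_iff_mem_nhds]
  rintro z₀ ⟨h₀, hz₀⟩
  rw [eval_eq] at hz₀
  obtain ⟨a, b, n, ha, hab⟩ := exists_evalSpec_eq_div (ringMor (F z₀)) (O.ι ''ᵁ V)
    ((inOpen_iff _ V).1 h₀) f
  obtain ⟨_, he⟩ := hab _ ha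
  rw [he] at hz₀
  have hc : ContinuousAt (fun z => toHom (F z) b / toHom (F z) a ^ n) z₀ :=
    (hF b).continuousAt.div ((hF a).continuousAt.pow n) (pow_ne_zero n ha)
  filter_upwards [hc.preimage_mem_nhds (hW.mem_nhds hz₀),
    (hF a).continuousAt.eventually_ne ha] with z hz hza
  obtain ⟨h, he⟩ := hab (ringMor (F z)) hza
  refine ⟨(inOpen_iff _ V).2 h, ?_⟩
  rw [eval_eq, he]
  exact hz

end OpenInAffine

/-! ### Points of the configuration scheme -/

variable {r : ℕ}

/-- The values of invariant polynomials at a pair of complex vectors. -/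
def evalAt (z : Fin r × Fin 2 → ℂ) : Invariants ℝ r 2 →ₐ[ℝ] ℂ :=
  (MvPolynomial.aeval z).comp (Invariants ℝ r 2).val

theorem evalAt_apply (z : Fin r × Fin 2 → ℂ) (p : Invariants ℝ r 2) :
    evalAt z p = MvPolynomial.aeval z p.1 := rfl

theorem evalAt_perm (σ : Equiv.Perm (Fin 2)) (z : Fin r × Fin 2 → ℂ) :
    evalAt (z ∘ Prod.map id σ) = evalAt z := by
  refine AlgHom.ext fun p => ?_
  have hp : MvPolynomial.rename (Prod.map id σ) p.1 = p.1 := p.2 σ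
  rw [evalAt_apply, evalAt_apply, ← MvPolynomial.aeval_rename, hp]

theorem conj_evalAt (z : Fin r × Fin 2 → ℂ) (p : Invariants ℝ r 2) :
    starRingEnd ℂ (evalAt z p) = evalAt (starRingEnd ℂ ∘ z) p := by
  have h : (Complex.conjAe : ℂ →ₐ[ℝ] ℂ).comp (MvPolynomial.aeval z) =
      MvPolynomial.aeval (starRingEnd ℂ ∘ z) := MvPolynomial.algHom_ext fun q => by simp
  exact DFunLike.congr_fun h p.1

theorem continuous_evalAt (p : Invariants ℝ r 2) :
    Continuous fun z : Fin r × Fin 2 → ℂ => evalAt z p := by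
  simp only [evalAt_apply, MvPolynomial.aeval_def, MvPolynomial.eval₂_eq_eval_map]
  exact MvPolynomial.continuous_eval _

theorem evalAt_stabInvariants (z : Fin r × Fin 2 → ℂ) :
    (evalAt z).comp (stabInvariants ℝ r 2) = evalAt (r := r + 1) fun q =>
      Fin.snoc (α := fun _ => ℂ) (fun l => z (l, q.2)) 0 q.1 := by
  have h : (MvPolynomial.aeval z).comp (stabRing ℝ r 2) =
      MvPolynomial.aeval (R := ℝ) (S₁ := ℂ) fun q : Fin (r + 1) × Fin 2 =>
        Fin.snoc (α := fun _ => ℂ) (fun l => z (l, q.2)) 0 q.1 := by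
    refine MvPolynomial.algHom_ext fun q => ?_
    obtain ⟨l, i⟩ := q
    refine Fin.lastCases ?_ (fun l => ?_) l
    · simp [stabRing]
    · simp [stabRing]
  exact AlgHom.ext fun p => DFunLike.congr_fun h p.1

theorem specMap_aeval_mem_UOpen_iff (z : Fin r × Fin 2 → ℂ) (x : Spec (.of ℂ)) :
    Spec.map (CommRingCat.ofHom
      (MvPolynomial.aeval z : Coord ℝ r 2 →ₐ[ℝ] ℂ).toRingHom) x ∈ UOpen ℝ r 2 ↔
      ∃ l, z (l, 0) ≠ z (l, 1) := by
  have key (i j : Fin 2) (l : Fin r) :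
      (MvPolynomial.X (l, i) - MvPolynomial.X (l, j) : Coord ℝ r 2) ∉
        (Spec.map (CommRingCat.ofHom
          (MvPolynomial.aeval z : Coord ℝ r 2 →ₐ[ℝ] ℂ).toRingHom) x).asIdeal ↔
      z (l, i) ≠ z (l, j) := by
    have h0 : x.asIdeal = ⊥ :=
      (Ideal.eq_bot_or_top _).resolve_right (PrimeSpectrum.isPrime x).ne_top
    change MvPolynomial.aeval z (MvPolynomial.X (l, i) - MvPolynomial.X (l, j) : Coord ℝ r 2) ∉
      x.asIdeal ↔ _
    rw [h0, map_sub, MvPolynomial.aeval_X, MvPolynomial.aeval_X, Ideal.mem_bot, sub_eq_zero]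
  simp only [mem_UOpen_iff, key]
  refine ⟨fun h => h 0 1 (by decide), fun ⟨l, hl⟩ i j hij => ⟨l, ?_⟩⟩
  fin_cases i <;> fin_cases j
  · exact absurd rfl hij
  · exact hl
  · exact hl.symm
  · exact absurd rfl hij

theorem specMap_evalAt_mem_BOpen_iff (z : Fin r × Fin 2 → ℂ) (x : Spec (.of ℂ)) :
    Spec.map (CommRingCat.ofHom (evalAt z).toRingHom) x ∈ BOpen ℝ r 2 ↔
      ∃ l, z (l, 0) ≠ z (l, 1) := by
  rw [← specMap_aeval_mem_UOpen_iff z x, ← affineProj_preimage_BOpen]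
  rfl

/-- A real point of the quotient lifts to a complex point of affine space. -/
theorem exists_evalAt_eq (φ : Invariants ℝ r 2 →ₐ[ℝ] ℂ) (hφ : ∀ a, (φ a).im = 0) :
    ∃ z, φ = evalAt z := by
  have hre (a) : φ (algebraMap ℝ _ (φ a).re) = φ a := by
    rw [AlgHom.commutes]
    exact Complex.ext rfl (by simp [hφ])
  -- Real values make every element congruent to a real scalar modulo the kernel, so the quotient is
  -- ℝ.
  have hmax : (RingHom.ker φ).IsMaximal := by
    refine Ideal.isMaximal_iff.2 ⟨by simp [RingHom.mem_ker], fun J a hJ ha haJ => ?_⟩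
    have ha' : (φ a).re ≠ 0 := fun h =>
      ha (RingHom.mem_ker.2 (by rw [← hre, h, map_zero, map_zero]))
    have h1 : a - algebraMap ℝ _ (φ a).re ∈ J :=
      hJ (RingHom.mem_ker.2 (by rw [map_sub, hre, sub_self]))
    have h2 : algebraMap ℝ (Invariants ℝ r 2) (φ a).re ∈ J := by
      simpa using J.sub_mem haJ h1
    have h3 := J.mul_mem_left (algebraMap ℝ (Invariants ℝ r 2) (φ a).re⁻¹) h2
    rwa [← map_mul, inv_mul_cancel₀ ha', map_one] at h3
  -- Polynomials are integral over the invariants, so a maximal ideal m lies over the kernel. By the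
  -- Nullstellensatz its residue field is finite over ℝ and embeds in ℂ; the images of the variables
  -- are the required coordinates.
  obtain ⟨m, hm, hmφ⟩ := Ideal.exists_ideal_over_maximal_of_isIntegral (S := Coord ℝ r 2)
    (RingHom.ker φ) (by
      intro a ha
      have : a = 0 := Subtype.ext (RingHom.mem_ker.1 ha)
      rw [this]; exact zero_mem _)
  let := Ideal.Quotient.field m
  have : Module.Finite ℝ (Coord ℝ r 2 ⧸ m) := finite_of_finite_type_of_isJacobsonRing ℝ _
  let ψ : (Coord ℝ r 2 ⧸ m) →ₐ[ℝ] ℂ := IsAlgClosed.lift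
  let Φ : Coord ℝ r 2 →ₐ[ℝ] ℂ := ψ.comp (Ideal.Quotient.mkₐ ℝ m)
  refine ⟨fun q => Φ (MvPolynomial.X q), AlgHom.ext fun a => ?_⟩
  have hΦ : MvPolynomial.aeval (fun q => Φ (MvPolynomial.X q)) = Φ :=
    MvPolynomial.algHom_ext fun q => by simp
  rw [evalAt_apply, hΦ, ← hre a, AlgHom.commutes]
  -- The lift agrees with φ on an invariant a, since a minus the scalar φ(a) lies in the kernel and
  -- hence in m.
  have h1 : a - algebraMap ℝ _ (φ a).re ∈ RingHom.ker φ :=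
    RingHom.mem_ker.2 (by rw [map_sub, hre, sub_self])
  rw [← hmφ] at h1
  have h2 : Φ (a.1 - algebraMap ℝ _ (φ a).re) = 0 := by
    change ψ (Ideal.Quotient.mk m _) = 0
    rw [Ideal.Quotient.eq_zero_iff_mem.2, map_zero]
    exact h1
  rw [map_sub, AlgHom.commutes, sub_eq_zero] at h2
  exact h2.symm

/-! ### Real points of the configuration scheme -/

/-- A square root of `1` or of `-1`. -/
def unit (ε : Bool) : ℂ := if ε then 1 else Complex.I

/-- The pair of complex vectors `a ± v` or `a ± i v`. -/
def pair (a : Fin r → ℝ) (ε : Bool) (v : Fin r → ℝ) (q : Fin r × Fin 2) : ℂ :=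
  a q.1 + (if q.2 = 0 then 1 else -1) * unit ε * v q.1

theorem pair_zero (a : Fin r → ℝ) (ε : Bool) (v : Fin r → ℝ) (l : Fin r) :
    pair a ε v (l, 0) = a l + unit ε * v l := by simp [pair]

theorem pair_one (a : Fin r → ℝ) (ε : Bool) (v : Fin r → ℝ) (l : Fin r) :
    pair a ε v (l, 1) = a l - unit ε * v l := by simp [pair, sub_eq_add_neg]

/-- Changing the sign of v exchanges the two vectors, which invariant polynomials do not see. -/
theorem evalAt_pair_neg (a : Fin r → ℝ) (ε : Bool) (v : Fin r → ℝ) :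
    evalAt (pair a ε (-v)) = evalAt (pair a ε v) := by
  rw [← evalAt_perm (Equiv.swap 0 1) (pair a ε v)]
  congr 1
  funext ⟨l, i⟩
  fin_cases i
  · simp [pair_zero, pair_one, sub_eq_add_neg]
  · simp [pair_zero, pair_one]

/-- Conjugation fixes both vectors a ± v and exchanges a + iv with a - iv, so it fixes all values of
invariants. -/
theorem evalAt_pair_im (a : Fin r → ℝ) (ε : Bool) (v : Fin r → ℝ) (p : Invariants ℝ r 2) :
    (evalAt (pair a ε v) p).im = 0 := by
  rw [← Complex.conj_eq_iff_im, conj_evalAt]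
  cases ε with
  | true =>
    congr 2
    funext ⟨l, i⟩
    fin_cases i <;> simp [pair_zero, pair_one, unit]
  | false =>
    rw [← evalAt_pair_neg]
    congr 2
    funext ⟨l, i⟩
    fin_cases i <;> simp [pair_zero, pair_one, unit]

theorem continuous_pair :
    Continuous fun x : (Fin r → ℝ) × Bool × (Fin r → ℝ) => pair x.1 x.2.1 x.2.2 := by
  have h : Continuous unit := continuous_of_discreteTopology
  unfold pair
  fun_prop

theorem unit_ne_zero (ε : Bool) : unit ε ≠ 0 := by cases ε <;> simp [unit]

theorem pair_ne (a : Fin r → ℝ) (ε : Bool) {v : Fin r → ℝ} (hv : v ≠ 0) :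
    ∃ l, pair a ε v (l, 0) ≠ pair a ε v (l, 1) := by
  obtain ⟨l, hl⟩ := Function.ne_iff.1 hv
  refine ⟨l, fun h => hl ?_⟩
  rw [pair_zero, pair_one, sub_eq_add_neg, add_right_inj, self_eq_neg] at h
  simpa [unit_ne_zero] using h

/-- A vector with complex entries whose products are real is real up to a square root of `± 1`. -/
theorem exists_eq_unit_mul {d : Fin r → ℂ} (h0 : d ≠ 0) (h : ∀ k l, (d k * d l).im = 0) :
    ∃ (ε : Bool) (v : Fin r → ℝ), ∀ l, d l = unit ε * v l := by
  -- One nonzero entry decides: its square is real, so it is real or purely imaginary, and its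
  -- products with the other entries force these to be of the same type.
  obtain ⟨l, hl⟩ := Function.ne_iff.1 h0
  have hll := h l l
  simp only [Complex.mul_im] at h hll
  by_cases hi : (d l).im = 0
  · have hr : (d l).re ≠ 0 := fun hr => hl (Complex.ext hr hi)
    refine ⟨true, fun k => (d k).re, fun k => Complex.ext (by simp [unit]) ?_⟩
    have := h k l
    rw [hi, mul_zero, zero_add, mul_eq_zero, or_iff_left hr] at this
    simp [unit, this]
  · have hr : (d l).re = 0 := by
      have : (d l).re * (d l).im = 0 := by linarith
      exact (mul_eq_zero.1 this).resolve_right hi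
    refine ⟨false, fun k => (d k).im, fun k => Complex.ext ?_ (by simp [unit])⟩
    have := h k l
    rw [hr, mul_zero, add_zero, mul_eq_zero, or_iff_left hi] at this
    simp [unit, this]

variable (r) in
/-- The space of real points of the quotient. -/
abbrev RealConf : Type := RealPoints (B ℝ r 2)

/-- The values of invariant polynomials at a real point. -/
def realHom (p : RealConf r) : Invariants ℝ r 2 →ₐ[ℝ] ℂ :=
  toHom (O := BOpen ℝ r 2) p.1

theorem realHom_injective : Function.Injective (realHom (r := r)) := fun _ _ h =>
  Subtype.ext (toHom_injective h)

theorem realHom_im (p : RealConf r) (a : Invariants ℝ r 2) : (realHom p a).im = 0 :=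
  (conj_eq_self_iff (O := BOpen ℝ r 2) p.1).1 p.2 a

theorem continuous_realHom (a : Invariants ℝ r 2) : Continuous fun p : RealConf r => realHom p a :=
  (continuous_toHom (O := BOpen ℝ r 2) a).comp continuous_subtype_val

theorem continuous_of_realHom {Z : Type*} [TopologicalSpace Z] (F : Z → RealConf r)
    (hF : ∀ a, Continuous fun z => realHom (F z) a) : Continuous F :=
  Continuous.subtype_mk (continuous_of_toHom (O := BOpen ℝ r 2) (fun z => (F z).1) hF)
    fun z => (F z).2

theorem realHom_map_stab (p : RealConf r) :
    realHom (r := r + 1) ((RealPoints.map (stab ℝ r 2)).hom p) =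
      (realHom p).comp (stabInvariants ℝ r 2) :=
  toHom_map (O := BOpen ℝ r 2) (O' := BOpen ℝ (r + 1) 2) (stabInvariants ℝ r 2) (stab ℝ r 2)
    (Scheme.Hom.resLE_comp_ι _ _) p.1

theorem exists_realHom_eq (a : Fin r → ℝ) (ε : Bool) {v : Fin r → ℝ} (hv : v ≠ 0) :
    ∃ p : RealConf r, realHom p = evalAt (pair a ε v) := by
  obtain ⟨p, hp⟩ := exists_toHom_eq (O := BOpen ℝ r 2) (evalAt (pair a ε v)) fun x =>
    (specMap_evalAt_mem_BOpen_iff _ x).2 (pair_ne a ε hv)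
  exact ⟨⟨p, (conj_eq_self_iff (O := BOpen ℝ r 2) p).2 fun b => hp ▸ evalAt_pair_im a ε v b⟩, hp⟩

/-- The real point given by the vectors `a ± v` or `a ± i v`. -/
def point (a : Fin r → ℝ) (ε : Bool) {v : Fin r → ℝ} (hv : v ≠ 0) : RealConf r :=
  (exists_realHom_eq a ε hv).choose

theorem realHom_point (a : Fin r → ℝ) (ε : Bool) {v : Fin r → ℝ} (hv : v ≠ 0) :
    realHom (point a ε hv) = evalAt (pair a ε v) :=
  (exists_realHom_eq a ε hv).choose_spec

/-- The invariant polynomial `x_l + y_l`. -/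
def sumInv (l : Fin r) : Invariants ℝ r 2 :=
  ⟨MvPolynomial.X (l, 0) + MvPolynomial.X (l, 1), fun σ => by
    rw [smul_add, perm_smul_X, perm_smul_X]
    rcases (by decide +revert : σ = 1 ∨ σ = Equiv.swap 0 1) with rfl | rfl
    · rfl
    · simp [add_comm]⟩

/-- The invariant polynomial `(x_k - y_k) (x_l - y_l)`. -/
def diffInv (k l : Fin r) : Invariants ℝ r 2 :=
  ⟨(MvPolynomial.X (k, 0) - MvPolynomial.X (k, 1)) * (MvPolynomial.X (l, 0) - MvPolynomial.X (l, 1)),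
  fun σ => by
    rw [smul_mul', smul_sub, smul_sub, perm_smul_X, perm_smul_X, perm_smul_X, perm_smul_X]
    rcases (by decide +revert : σ = 1 ∨ σ = Equiv.swap 0 1) with rfl | rfl
    · rfl
    · simp only [Equiv.swap_apply_left, Equiv.swap_apply_right]
      ring⟩

theorem evalAt_sumInv (z : Fin r × Fin 2 → ℂ) (l : Fin r) :
    evalAt z (sumInv l) = z (l, 0) + z (l, 1) := by
  simp [evalAt_apply, sumInv]

theorem evalAt_diffInv (z : Fin r × Fin 2 → ℂ) (k l : Fin r) :
    evalAt z (diffInv k l) = (z (k, 0) - z (k, 1)) * (z (l, 0) - z (l, 1)) := by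
  simp [evalAt_apply, diffInv]

/-- For a lift z to complex vectors, real values of the sums x_l + y_l make the mean real, and real
values of the products of differences make the half difference v or iv. -/
theorem exists_eq_point (p : RealConf r) :
    ∃ (a : Fin r → ℝ) (ε : Bool) (v : Fin r → ℝ) (hv : v ≠ 0), p = point a ε hv := by
  obtain ⟨z, hz⟩ := exists_evalAt_eq (realHom p) (realHom_im p)
  have hne : ∃ l, z (l, 0) ≠ z (l, 1) := by
    have hx := specMap_toHom_mem (O := BOpen ℝ r 2) p.1 (⊥ : PrimeSpectrum ℂ)
    change Spec.map (CommRingCat.ofHom (realHom p).toRingHom) (⊥ : PrimeSpectrum ℂ) ∈ _ at hx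
    rw [hz] at hx
    exact (specMap_evalAt_mem_BOpen_iff z _).1 hx
  obtain ⟨ε, v, hv⟩ := exists_eq_unit_mul (d := fun l => (z (l, 0) - z (l, 1)) / 2) (by
    obtain ⟨l, hl⟩ := hne
    intro h
    have := congrFun h l
    simp [sub_eq_zero, hl] at this) fun k l => by
      have h := realHom_im p (diffInv k l)
      rw [hz, evalAt_diffInv] at h
      rw [div_mul_div_comm, show (2 * 2 : ℂ) = ((4 : ℝ) : ℂ) by norm_num, Complex.div_ofReal_im, h,
        zero_div]
  have ha (l) : (z (l, 0) + z (l, 1)) / 2 = (((z (l, 0) + z (l, 1)) / 2).re : ℂ) := by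
    have h := realHom_im p (sumInv l)
    rw [hz, evalAt_sumInv] at h
    refine Complex.ext rfl ?_
    rw [show (2 : ℂ) = ((2 : ℝ) : ℂ) by norm_num, Complex.div_ofReal_im, h]
    simp
  have hzp : z = pair (fun l => ((z (l, 0) + z (l, 1)) / 2).re) ε v := by
    funext ⟨l, i⟩
    fin_cases i
    · change z (l, 0) = pair _ _ _ (l, 0)
      rw [pair_zero, ← hv, ← ha]; ring
    · change z (l, 1) = pair _ _ _ (l, 1)
      rw [pair_one, ← hv, ← ha]; ring
  have hv0 : v ≠ 0 := by
    rintro rfl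
    obtain ⟨l, hl⟩ := hne
    have := hv l
    simp [sub_eq_zero, hl] at this
  exact ⟨_, ε, v, hv0, realHom_injective ((hz.trans (congrArg evalAt hzp)).trans
    (realHom_point (fun l => ((z (l, 0) + z (l, 1)) / 2).re) ε hv0).symm)⟩

/-! ### The space of real points up to homotopy -/

theorem eq_or_eq_neg_of_mul_eq {v w : Fin r → ℝ} (h : ∀ i j, v i * v j = w i * w j) :
    v = w ∨ v = -w := by
  by_cases hv : v = 0
  · left
    rw [hv]
    funext i
    have := h i i
    simp only [hv, Pi.zero_apply, mul_zero, zero_eq_mul, or_self] at this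
    exact this.symm
  obtain ⟨l, hl⟩ := Function.ne_iff.1 hv
  replace hl : v l ≠ 0 := hl
  rcases mul_self_eq_mul_self_iff.1 (h l l) with h1 | h1
  · left
    funext i
    have := h i l
    rw [← h1] at this
    exact mul_right_cancel₀ hl this
  · right
    funext i
    have := h i l
    have h2 : w l = -v l := by rw [h1, neg_neg]
    rw [h2] at this
    exact mul_right_cancel₀ hl (this.trans (by simp))

theorem point_congr {a a' : Fin r → ℝ} {ε ε' : Bool} {v w : Fin r → ℝ} {hv : v ≠ 0} {hw : w ≠ 0}
    (ha : a = a') (hε : ε = ε') (h : ∀ i j, v i * v j = w i * w j) :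
    point a ε hv = point a' ε' hw := by
  subst ha hε
  apply realHom_injective
  rw [realHom_point, realHom_point]
  rcases eq_or_eq_neg_of_mul_eq h with rfl | rfl
  · rfl
  · exact evalAt_pair_neg _ _ _

theorem map_stab_point (a : Fin r → ℝ) (ε : Bool) {v : Fin r → ℝ} (hv : v ≠ 0) :
    (RealPoints.map (stab ℝ r 2)).hom (point a ε hv) =
      point (r := r + 1) (Fin.snoc (α := fun _ => ℝ) a 0) ε
        (v := Fin.snoc (α := fun _ => ℝ) v 0) (Punct.snoc_ne_zero (Or.inl hv)) := by
  apply realHom_injective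
  rw [realHom_map_stab, realHom_point, realHom_point, evalAt_stabInvariants]
  congr 1
  funext ⟨l, i⟩
  refine Fin.lastCases ?_ (fun l => ?_) l <;> simp [pair]

/-- The real point given by a real vector, a sign and a line. -/
def linePoint (x : (Fin r → ℝ) × Bool × Lines r) : RealConf r :=
  point x.1 x.2.1 x.2.2.2.choose_spec.1

theorem linePoint_eq (a : Fin r → ℝ) (ε : Bool) (M : Lines r) {v : Fin r → ℝ} (hv : v ≠ 0)
    (h : ∀ i j, M.1 i j = v i * v j) : linePoint (a, ε, M) = point a ε hv :=
  point_congr rfl rfl fun i j => (M.2.choose_spec.2 i j).symm.trans (h i j)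

/-- The generator in `linePoint` is chosen without continuity, but the point depends only on the
line. Near a line with nonzero l-th diagonal entry, the l-th column over the root of that entry is a
continuous generator. -/
theorem continuous_linePoint : Continuous (linePoint (r := r)) := by
  refine continuous_of_realHom _ fun b => continuous_iff_continuousAt.2 fun x₀ => ?_
  obtain ⟨w, hw, hM⟩ := x₀.2.2.2
  obtain ⟨l, hl⟩ := Function.ne_iff.1 hw
  have hpos : 0 < x₀.2.2.1 l l := by
    rw [hM]
    exact mul_self_pos.2 hl
  let g (M : Lines r) (i : Fin r) : ℝ := M.1 i l / √(M.1 l l)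
  have hentry (i j : Fin r) : Continuous fun x : (Fin r → ℝ) × Bool × Lines r => x.2.2.1 i j :=
    (Lines.continuous_entry r i j).comp (continuous_snd.comp continuous_snd)
  have hg : ContinuousAt (fun x : (Fin r → ℝ) × Bool × Lines r =>
      evalAt (pair x.1 x.2.1 (g x.2.2)) b) x₀ := by
    refine (continuous_evalAt b).continuousAt.comp (ContinuousAt.comp
      (g := fun x : (Fin r → ℝ) × Bool × (Fin r → ℝ) => pair x.1 x.2.1 x.2.2)
      (f := fun x : (Fin r → ℝ) × Bool × Lines r => (x.1, x.2.1, g x.2.2))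
      continuous_pair.continuousAt ?_)
    refine continuousAt_fst.prodMk ((continuous_fst.comp continuous_snd).continuousAt.prodMk ?_)
    refine continuousAt_pi.2 fun i => (hentry i l).continuousAt.div
      (hentry l l).sqrt.continuousAt (Real.sqrt_pos.2 hpos).ne'
  refine hg.congr ?_
  filter_upwards [continuousAt_const.eventually_lt (hentry l l).continuousAt hpos] with x hx
  have hgg (i j : Fin r) : x.2.2.1 i j = g x.2.2 i * g x.2.2 j := by
    obtain ⟨v, hv, h⟩ := x.2.2.2
    change _ = x.2.2.1 i l / √(x.2.2.1 l l) * (x.2.2.1 j l / √(x.2.2.1 l l))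
    rw [div_mul_div_comm, Real.mul_self_sqrt hx.le, eq_div_iff hx.ne']
    simp only [h]
    ring
  have hg0 : g x.2.2 ≠ 0 := fun h0 => hx.ne' (by rw [hgg, h0, Pi.zero_apply, zero_mul])
  rw [← realHom_point x.1 x.2.1 hg0, ← linePoint_eq x.1 x.2.1 x.2.2 hg0 hgg]

/-- The mean of the two real or conjugate vectors of a real point. -/
def mean (p : RealConf r) (l : Fin r) : ℝ := (realHom p (sumInv l)).re / 2

/-- The products of coordinates of the difference of the two vectors of a real point. -/
def gram (p : RealConf r) (k l : Fin r) : ℝ := (realHom p (diffInv k l)).re / 4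

/-- The trace of the matrix `gram`. -/
def gramTrace (p : RealConf r) : ℝ := ∑ k, gram p k k

theorem continuous_mean : Continuous (mean (r := r)) :=
  continuous_pi fun _ => (Complex.continuous_re.comp (continuous_realHom _)).div_const 2

theorem continuous_gram (k l : Fin r) : Continuous fun p => gram p k l :=
  (Complex.continuous_re.comp (continuous_realHom _)).div_const 4

theorem continuous_gramTrace : Continuous (gramTrace (r := r)) :=
  continuous_finsetSum _ fun k _ => continuous_gram k k

theorem mean_point (a : Fin r → ℝ) (ε : Bool) {v : Fin r → ℝ} (hv : v ≠ 0) :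
    mean (point a ε hv) = a := by
  funext l
  rw [mean, realHom_point, evalAt_sumInv, pair_zero, pair_one]
  simp

/-- The difference of the vectors is 2v or 2iv, so its products are ±4 times those of v; this
explains the division by 4 in `gram`. -/
theorem gram_point (a : Fin r → ℝ) (ε : Bool) {v : Fin r → ℝ} (hv : v ≠ 0) (k l : Fin r) :
    gram (point a ε hv) k l = (if ε then 1 else -1) * (v k * v l) := by
  rw [gram, realHom_point, evalAt_diffInv, pair_zero, pair_one, pair_zero, pair_one]
  cases ε <;> simp [unit] <;> ring

theorem sum_mul_self_pos {v : Fin r → ℝ} (hv : v ≠ 0) : 0 < ∑ k, v k * v k := by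
  obtain ⟨l, hl⟩ := Function.ne_iff.1 hv
  exact Finset.sum_pos' (fun _ _ => mul_self_nonneg _) ⟨l, Finset.mem_univ l, mul_self_pos.2 hl⟩

theorem gramTrace_point (a : Fin r → ℝ) (ε : Bool) {v : Fin r → ℝ} (hv : v ≠ 0) :
    gramTrace (point a ε hv) = (if ε then 1 else -1) * ∑ k, v k * v k := by
  simp only [gramTrace, gram_point, Finset.mul_sum]

theorem gramTrace_ne_zero (p : RealConf r) : gramTrace p ≠ 0 := by
  obtain ⟨a, ε, v, hv, rfl⟩ := exists_eq_point p
  have := sum_mul_self_pos hv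
  rw [gramTrace_point]
  cases ε <;> simp [this.ne']

/-- Whether the two vectors of a real point are real or complex conjugate. -/
def isSplit (p : RealConf r) : Bool := decide (0 < gramTrace p)

theorem isSplit_point (a : Fin r → ℝ) (ε : Bool) {v : Fin r → ℝ} (hv : v ≠ 0) :
    isSplit (point a ε hv) = ε := by
  have := sum_mul_self_pos hv
  rw [isSplit, gramTrace_point]
  cases ε <;> simp [this, this.le]

theorem continuous_isSplit : Continuous (isSplit (r := r)) := by
  -- The trace never vanishes, so its positivity is both an open and a closed condition.
  refine (continuous_bool_rng true).2 ⟨?_, ?_⟩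
  · have h : isSplit (r := r) ⁻¹' {true} = gramTrace ⁻¹' Set.Ici 0 := by
      ext p
      simp [isSplit, (gramTrace_ne_zero p).symm.le_iff_lt]
    rw [h]
    exact isClosed_Ici.preimage continuous_gramTrace
  · have h : isSplit (r := r) ⁻¹' {true} = gramTrace ⁻¹' Set.Ioi 0 := by
      ext p
      simp [isSplit]
    rw [h]
    exact isOpen_Ioi.preimage continuous_gramTrace

/-- The factor |t| / t, for t the trace, is the sign of t: it removes the sign that i² introduces
for conjugate pairs. -/
theorem exists_gram_eq (p : RealConf r) : ∃ v : Fin r → ℝ, v ≠ 0 ∧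
    ∀ k l, |gramTrace p| / gramTrace p * gram p k l = v k * v l := by
  obtain ⟨a, ε, v, hv, rfl⟩ := exists_eq_point p
  have := sum_mul_self_pos hv
  refine ⟨v, hv, fun k l => ?_⟩
  rw [gramTrace_point, gram_point]
  cases ε <;> simp [abs_of_pos this, div_neg, div_self this.ne']

/-- The line through the difference of the two vectors of a real point. -/
def line (p : RealConf r) : Lines r :=
  ⟨fun k l => |gramTrace p| / gramTrace p * gram p k l, exists_gram_eq p⟩

theorem line_point (a : Fin r → ℝ) (ε : Bool) {v : Fin r → ℝ} (hv : v ≠ 0) (k l : Fin r) :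
    (line (point a ε hv)).1 k l = v k * v l := by
  have := sum_mul_self_pos hv
  change |gramTrace _| / gramTrace _ * gram _ k l = _
  rw [gramTrace_point, gram_point]
  cases ε <;> simp [abs_of_pos this, div_neg, div_self this.ne']

theorem continuous_line : Continuous (line (r := r)) :=
  Continuous.subtype_mk (continuous_pi fun k => continuous_pi fun l =>
    (continuous_gramTrace.abs.div continuous_gramTrace gramTrace_ne_zero).mul
      (continuous_gram k l)) _

theorem linePoint_line (p : RealConf r) : linePoint (mean p, isSplit p, line p) = p := by
  obtain ⟨a, ε, v, hv, rfl⟩ := exists_eq_point p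
  rw [mean_point, isSplit_point]
  exact linePoint_eq a ε _ hv (line_point a ε hv)

variable (r) in
/-- The sign and the line of a real point. -/
def toLines : C(RealConf r, Bool × Lines r) :=
  ⟨fun p => (isSplit p, line p), continuous_isSplit.prodMk continuous_line⟩

variable (r) in
/-- The real point with mean zero and given sign and line. -/
def ofLines : C(Bool × Lines r, RealConf r) :=
  ⟨fun x => linePoint (0, x), continuous_linePoint.comp (by fun_prop)⟩

variable (r) in
/-- The space of real points retracts to the points of mean zero. -/
def meanHtpy : (ContinuousMap.id (RealConf r)).Homotopy ((ofLines r).comp (toLines r)) where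
  -- Only the mean is scaled to zero; type and line stay fixed, so the two vectors remain distinct.
  toFun x := linePoint ((1 - x.1.1) • mean x.2, isSplit x.2, line x.2)
  continuous_toFun := by
    have h1 := continuous_mean (r := r)
    have h2 := continuous_isSplit (r := r)
    have h3 := continuous_line (r := r)
    refine continuous_linePoint.comp ?_
    fun_prop
  map_zero_left p := by simpa using linePoint_line p
  map_one_left p := by simp [ofLines, toLines]

variable (r) in
/-- The stabilization map on real points. -/
abbrev realStab : C(RealConf r, RealConf (r + 1)) := (RealPoints.map (stab ℝ r 2)).hom

theorem pad_apply_of_eq (M : Lines r) {v : Fin r → ℝ} (h : ∀ i j, M.1 i j = v i * v j)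
    (i j : Fin (r + 1)) : (Lines.pad r M).1 i j =
      Fin.snoc (α := fun _ => ℝ) v 0 i * Fin.snoc (α := fun _ => ℝ) v 0 j := by
  change Fin.snoc (α := fun _ => Fin (r + 1) → ℝ)
    (fun i => Fin.snoc (α := fun _ => ℝ) (M.1 i) 0) 0 i j = _
  refine Fin.lastCases ?_ (fun i => ?_) i <;> refine Fin.lastCases ?_ (fun j => ?_) j <;> simp [h]

/-- Appending zeros changes neither the type of the pair nor, up to padding, the line of its
difference. -/
theorem toLines_comp_realStab :
    (toLines (r + 1)).comp (realStab r) = (double (Lines.pad r)).comp (toLines r) := by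
  ext1 p
  obtain ⟨a, ε, v, hv, rfl⟩ := exists_eq_point p
  change (isSplit (realStab r _), line (realStab r _)) = (isSplit _, Lines.pad r (line _))
  rw [map_stab_point, isSplit_point, isSplit_point]
  refine Prod.ext rfl (Subtype.ext ?_)
  funext i j
  change (line _).1 i j = (Lines.pad r _).1 i j
  rw [line_point, pad_apply_of_eq _ (line_point a ε hv)]

theorem ofLines_comp_double :
    (ofLines (r + 1)).comp (double (Lines.pad r)) = (realStab r).comp (ofLines r) := by
  ext1 ⟨ε, M⟩
  obtain ⟨v, hv, h⟩ := M.2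
  change linePoint (0, ε, Lines.pad r M) = realStab r (linePoint (0, ε, M))
  rw [linePoint_eq 0 ε M hv h, map_stab_point,
    linePoint_eq 0 ε _ (Punct.snoc_ne_zero (Or.inl hv)) (pad_apply_of_eq M h)]
  refine point_congr ?_ rfl fun _ _ => rfl
  funext l
  refine Fin.lastCases ?_ (fun l => ?_) l <;> simp

/-- The real points deform to two copies of `Lines r`, each without homology in these degrees. -/
theorem ucyc_le_bdry_realConf (hr : 1 ≤ r) {j : ℕ} (hj : r ≤ j) :
    ucyc j ≤ bdry (RealConf r) (j + 1) := fun _ hc =>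
  mem_bdry_of_htpy (meanHtpy r) hc <| mem_bdry_of_part fun b =>
    Lines.ucyc_le_bdry hr hj (part_mem_ucyc b (map_mem_ucyc _ hc))

theorem injAt_realStab {j : ℕ} (hj : j < r) : InjAt (realStab r) j :=
  (Lines.injAt_pad hj).double.of_htpy toLines_comp_realStab (meanHtpy r)

theorem surjAt_realStab {j : ℕ} (hj : j < r) : SurjAt (realStab r) j :=
  (Lines.surjAt_pad hj).double.of_htpy ofLines_comp_double (meanHtpy (r + 1))

end ModTwo

end

theorem proposition7p6 (r : ℕ) (hr : 1 ≤ r) (j : ℕ) :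
    (j < r →
      CategoryTheory.IsIso ((EtaleGen.singularCohomology (ZMod 2) j).map
        (EtaleGen.RealPoints.map (EtaleGen.stab ℝ r 2)).op)) ∧
    (r ≤ j →
      (EtaleGen.singularCohomology (ZMod 2) j).map
        (EtaleGen.RealPoints.map (EtaleGen.stab ℝ r 2)).op = 0) :=
  ⟨fun hj => ModTwo.isIso_singularCohomology_map _ j (ModTwo.injAt_realStab hj)
      (ModTwo.surjAt_realStab hj),
    -- The map on cohomology lands in the cohomology of the smaller space, which vanishes in these
    -- degrees.
    fun hj => ModTwo.singularCohomology_map_eq_zero _ j (ModTwo.ucyc_le_bdry_realConf hr hj)⟩
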